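/- **Notation.** For $n\ge 2$ let $[n]=\{1,\dots,n\}$, let $\mathcal F_n$ be the set of functions $f:\{2,\dots,n-1\}\to[n]$, identified with the digraph with arcs $i\to f(i)$, and let $\vec C_{n,1}$ be the set of trees on $[n]$ rooted at $1$ with all edges directed towards $1$. Let $\vec s=\langle s_1,\dots,s_n\rangle$ be a sequence of positive integers with $\sum_i s_i=2n-2$, and let $\vec C_{n,\vec s}$ be the set of $T\in\vec C_{n,1}$ in which vertex $i$ has degree $s_i$ (in the underlying undirected tree) for every $i$. *The map $\Theta$.* Let $m_1>\dots>m_a$ be the largest elements of the directed cycles of $f\in\mathcal F_n$. $\Theta(f)$ arises from $f$ by deleting the arcs $m_i\to f(m_i)$ and adding the arcs $n\to f(m_1)$, $m_i\to f(m_{i+1})$ for $1\le i<a$, and $m_a\to 1$ (only $n\to1$ if there is no cycle). Conversely, for $T\in\vec C_{n,1}$ let $m_0=n$, let $m_i$ be the largest interior vertex on the path from $m_{i-1}$ to $1$ as long as there is one ($1\le i\le t$), and let $x_i$ be the vertex after $m_{i-1}$ on that path; $\Theta^{-1}(T)$ arises from $T$ by deleting the arcs leaving $m_0,\dots,m_t$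 and adding $m_i\to x_i$ for $1\le i\le t$. *Partitions and codes.* Let $\Pi_{n,\vec s}$ be the set of sequences $\langle\pi_1,\dots,\pi_n\rangle$ of pairwise disjoint sets with union $\{2,\dots,n-1\}$ and $|\pi_k|=s_k-1$. For $\pi\in\Pi_{n,\vec s}$ list the nonempty blocks as $B_1,\dots,B_k$ by increasing size, blocks of equal size by increasing index; put $b_j=|B_j|$ and $a_j=n-2-b_1-\dots-b_{j-1}$. The code of $\pi$ is the concatenation, for $j=1,\dots,k$, of the sequences of ranks (counted from $1$) of the elements of $B_j$, in decreasing order, in $\{2,\dots,n-1\}\setminus(B_1\cup\dots\cup B_{j-1})$. Let $\mathcal{DF}_{a,b}$ be the set of sequences $a\ge f(1)>\dots>f(b)\ge1$; an element of $\mathcal P_{\vec s}=\mathcal{DF}_{a_1,b_1}\times\dots\times\mathcal{DF}_{a_k,b_k}$ is written as the concatenation of its components. The rank of an element of $\mathcal P_{\vec s}$ is the number of lexicographically smaller elements of $\mathcal P_{\vec s}$. *Ranking and unranking.* For $T\in\vec C_{n,\vec s}$ let $\mathrm{rank}(T)$ be the rank in $\mathcal P_{\vec s}$ of the code of $\langle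 f^{-1}(1),\dots,f^{-1}(n)\rangle$, where $f=\Theta^{-1}(T)$. For an integer $r$ let $\mathrm{unrank}(r)$ be the result of the following procedure. Put $r_0=r$ and divide successively, $r_{j-1}=q_j\prod_{l>j}\binom{a_l}{b_l}+r_j$ with $0\le r_j<\prod_{l>j}\binom{a_l}{b_l}$ for $j=1,\dots,k$. For each $j$ find the sequence $f_j(1),\dots,f_j(b_j)$ greedily: starting with $m=q_j$, for $i=1,\dots,b_j$ let $f_j(i)-1$ be the largest $y$ with $\binom{y}{b_j-i+1}\le m$ and subtract $\binom{y}{b_j-i+1}$ from $m$. Finally recover the set partition $\pi$ whose code is $(f_1,\dots,f_k)$, let $f$ be the function with $f^{-1}(i)=\pi_i$ for all $i$, and return $\Theta(f)$. *Bit operations* are counted by the logarithmic cost criterion on a random access machine (finitely many named registers and an indirectly addressed memory, all holding natural numbers; programs made of constants, $+$, truncated $-$, $\times$, integer division, load, store, and conditionals and while-loops testing $x<y$): loading a constant costs its bit length, and each arithmetic operation, comparison or memory access costs the total bit length of the operands, respectively of the address and the number transferred. **Theorem.** 1. For every $n\ge2$, $\Theta$ is a bijection from $\mathcal F_n$ onto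 $\vec C_{n,1}$ and the procedure $\Theta^{-1}$ inverts it. 2. For every $n$ and every sequence $\vec s$ of $n$ positive integers with sum $2n-2$: - $T\mapsto\langle f^{-1}(1),\dots,f^{-1}(n)\rangle$, with $f=\Theta^{-1}(T)$, is a bijection from $\vec C_{n,\vec s}$ onto $\Pi_{n,\vec s}$; - the code is a bijection from $\Pi_{n,\vec s}$ onto $\mathcal P_{\vec s}$; - the lexicographic rank is a bijection from $\mathcal P_{\vec s}$ onto $\{0,\dots,|\vec C_{n,\vec s}|-1\}$, and the rank of $(f_1,\dots,f_k)$ is $$\sum_{j=1}^k\Bigl(\sum_{i=1}^{b_j}\binom{f_j(i)-1}{b_j-i+1}\Bigr)\prod_{l>j}\binom{a_l}{b_l};$$ - $\mathrm{rank}:\vec C_{n,\vec s}\to\{0,\dots,|\vec C_{n,\vec s}|-1\}$ and $\mathrm{unrank}:\{0,\dots,|\vec C_{n,\vec s}|-1\}\to\vec C_{n,\vec s}$ are mutually inverse bijections. 3. There are two fixed programs and a constant $K$ such that for all $n$ and $\vec s$ as in 2: given $n$, $\vec s$ and the table of arcs $i\to t_i$ ($2\le i\le n$) of any $T\in\vec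 C_{n,\vec s}$, the first program outputs $\mathrm{rank}(T)$; given $n$, $\vec s$ and any $r$ with $0\le r<|\vec C_{n,\vec s}|$, the second outputs the table of arcs of $\mathrm{unrank}(r)$; and each uses at most $K\,n^2\log n$ bit operations. -/

import Mathlib

namespace CayleyRank

/-! ### Trees, functions and the bijection `Θ` -/

/-- The vertex set `[n] = {1, …, n}`. -/
abbrev Vtx (n : ℕ) : Type := ↥(Finset.Icc 1 n)

/-- The class `𝓕ₙ` of functions `{2, …, n-1} → {1, …, n}`. -/
abbrev FunClass (n : ℕ) : Type := ↥(Finset.Ico 2 n) → Vtx n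

/-- `graph(f)`: the arcs are the pairs `(i, f i)` for `i = 2, …, n-1`. -/
def funGraph {n : ℕ} (f : FunClass n) : Digraph (Vtx n) where
  Adj u v := ∃ h : (u : ℕ) ∈ Finset.Ico 2 n, f ⟨u, h⟩ = v

/-- The undirected graph underlying a directed graph. -/
def underlying {V : Type*} (T : Digraph V) : SimpleGraph V :=
  SimpleGraph.fromRel T.Adj

/-- `T` is a directed tree rooted at `r`: its underlying graph is a tree and every arc is directed
towards the root, that is, its head is one step closer to `r` than its tail. -/
def IsRootDirectedTree {V : Type*} (T : Digraph V) (r : V) : Prop :=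
  (underlying T).IsTree ∧
    ∀ u v, T.Adj u v → (underlying T).dist u r = (underlying T).dist v r + 1

/-- The set of directed trees on `[n]` that are rooted at `1`. -/
def rootedTrees (n : ℕ) : Set (Digraph (Vtx n)) :=
  {T | ∃ r : Vtx n, (r : ℕ) = 1 ∧ IsRootDirectedTree T r}

/-- The trees on `[n]`, rooted at `1`, in which each vertex `i` has (undirected) degree `s i`. -/
def treesWithDegrees {n : ℕ} (s : Vtx n → ℕ) : Set (Digraph (Vtx n)) :=
  {T | T ∈ rootedTrees n ∧ ∀ i, ((underlying T).neighborSet i).ncard = s i}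

/-- `m` lies on a directed cycle of `G` and is the largest vertex of that cycle, i.e. `m` is the
right endpoint of a cycle. The left endpoint is then the head of the arc that leaves `m`, and
that arc is the back edge. -/
def IsCycleMax {n : ℕ} (G : Digraph (Vtx n)) (m : Vtx n) : Prop :=
  Relation.TransGen G.Adj m m ∧
    ∀ w, Relation.TransGen G.Adj m w → Relation.TransGen G.Adj w m → w ≤ m

/-- The map `Θ` on directed graphs. The back edges (the arcs that leave the cycle maxima
`m₁ > m₂ > ⋯ > mₐ`) are deleted; `n` is joined to the left endpoint of the cycle of `m₁`, each
`mᵢ` to the left endpoint of the cycle of `mᵢ₊₁`, and `mₐ` to `1` (`n` to `1` if there is no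
cycle). -/
def theta {n : ℕ} (G : Digraph (Vtx n)) : Digraph (Vtx n) where
  Adj u v :=
    (G.Adj u v ∧ ¬ IsCycleMax G u) ∨
    (((u : ℕ) = n ∨ IsCycleMax G u) ∧
      ((∃ m, IsGreatest {m' | IsCycleMax G m' ∧ m' < u} m ∧ G.Adj m v) ∨
       ((∀ m, IsCycleMax G m → ¬ m < u) ∧ (v : ℕ) = 1)))

/-- `v` is the largest interior vertex on the path from `u` to `1` in the tree `T`. -/
def NextMax {n : ℕ} (T : Digraph (Vtx n)) (u v : Vtx n) : Prop :=
  IsGreatest {w : Vtx n | (w : ℕ) ≠ 1 ∧ Relation.TransGen T.Adj u w} v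

/-- `m` is one of the vertices `n = m₀, m₁, …, mₜ`, where `mᵢ` is the largest interior vertex on
the path from `mᵢ₋₁` to `1` in `T`. -/
def IsPathMax {n : ℕ} (T : Digraph (Vtx n)) (m : Vtx n) : Prop :=
  ∃ u : Vtx n, (u : ℕ) = n ∧ Relation.ReflTransGen (NextMax T) u m

/-- The procedure for `Θ⁻¹`: the arcs that leave `n = m₀, m₁, …, mₜ` are removed from `T`, and the
arc `mᵢ → xᵢ` is added for `1 ≤ i ≤ t`, where `xᵢ` is the vertex after `mᵢ₋₁` on the path. -/
def thetaInv {n : ℕ} (T : Digraph (Vtx n)) : Digraph (Vtx n) where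
  Adj u v :=
    (T.Adj u v ∧ ¬ IsPathMax T u) ∨
    ∃ m, IsPathMax T m ∧ NextMax T m u ∧ T.Adj m v

/-! ### Ordered set partitions -/

/-- `Π_{n,s}`: the ordered set partitions `(π₁, …, πₙ)` of `{2, …, n-1}` with `|πₖ| = sₖ - 1`. -/
def setPartitions {n : ℕ} (s : Vtx n → ℕ) : Set (Vtx n → Finset ℕ) :=
  {p | Pairwise (fun i j => Disjoint (p i) (p j)) ∧
       Finset.univ.biUnion p = Finset.Ico 2 n ∧
       ∀ k, (p k).card + 1 = s k}

open Classical in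
/-- The ordered set partition `(f⁻¹(1), …, f⁻¹(n))`, where `f = Θ⁻¹(T)`. -/
noncomputable def treePartition {n : ℕ} (T : Digraph (Vtx n)) : Vtx n → Finset ℕ :=
  fun i => (Finset.univ.filter fun v => (thetaInv T).Adj v i).image Subtype.val

/-- The directed graph with an arc `u → v` for each element `u` of the block of index `v`. -/
def partitionGraph {n : ℕ} (p : Vtx n → Finset ℕ) : Digraph (Vtx n) where
  Adj u v := (u : ℕ) ∈ p v

/-- The indices of the nonempty blocks, by increasing size of the block, and by increasing index
among blocks of the same size. -/
def blockOrder {n : ℕ} (s : Vtx n → ℕ) : List (Vtx n) :=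
  ((((Finset.univ : Finset (Vtx n)).filter fun v => 1 < s v).image
      fun v => toLex (s v, v)).sort (· ≤ ·)).map fun q => (ofLex q).2

/-- The rank of `x` in the finite set `D`, counted from `1` (for `x ∈ D`). -/
def rankIn (D : Finset ℕ) (x : ℕ) : ℕ := (D.filter fun y => y ≤ x).card

/-- For a list of blocks `B₁, B₂, …` of `D`, the concatenation of the sequences of the ranks of the
elements of `Bᵢ`, taken in decreasing order, in `D ∖ (B₁ ∪ ⋯ ∪ Bᵢ₋₁)`. -/
def encodeBlocks : Finset ℕ → List (Finset ℕ) → List ℕ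
  | _, [] => []
  | D, B :: Bs => (B.sort (· ≥ ·)).map (rankIn D) ++ encodeBlocks (D \ B) Bs

/-- The inverse procedure: recover the blocks from their sizes and from the sequence of ranks. -/
def decodeBlocks : Finset ℕ → List ℕ → List ℕ → List (Finset ℕ)
  | _, [], _ => []
  | D, b :: bs, w =>
    let B := D.filter fun x => rankIn D x ∈ w.take b
    B :: decodeBlocks (D \ B) bs (w.drop b)

/-- The sequence that codes the ordered set partition `p`. -/
def encode {n : ℕ} (s : Vtx n → ℕ) (p : Vtx n → Finset ℕ) : List ℕ :=
  encodeBlocks (Finset.Ico 2 n) ((blockOrder s).map p)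

/-- The ordered set partition coded by the sequence `w`. -/
def decode {n : ℕ} (s : Vtx n → ℕ) (w : List ℕ) : Vtx n → Finset ℕ :=
  fun i => (((blockOrder s).zip (decodeBlocks (Finset.Ico 2 n)
    ((blockOrder s).map fun v => s v - 1) w)).lookup i).getD ∅

/-! ### Decreasing functions -/

/-- `𝓓𝓕_{a,b}`: decreasing functions `f : {1, …, b} → {1, …, a}`, written as the sequences
`f(1) > ⋯ > f(b)`. -/
def decFun (a b : ℕ) : Set (List ℕ) :=
  {l | l.length = b ∧ l.Pairwise (· > ·) ∧ ∀ x ∈ l, 1 ≤ x ∧ x ≤ a}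

/-- `𝓓𝓕_{a₁,b₁} × ⋯ × 𝓓𝓕_{aₜ,bₜ}`, an element `(f₁, …, fₜ)` being written as the concatenated
sequence `f₁(1), …, f₁(b₁), …, fₜ(1), …, fₜ(bₜ)`. -/
def decFunProd : List (ℕ × ℕ) → Set (List ℕ)
  | [] => {[]}
  | (a, b) :: ps => {w | ∃ l ∈ decFun a b, ∃ w' ∈ decFunProd ps, w = l ++ w'}

/-- The pairs `(a, b₁), (a - b₁, b₂), (a - b₁ - b₂, b₃), …`. -/
def shapeOfSizes : ℕ → List ℕ → List (ℕ × ℕ)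
  | _, [] => []
  | a, b :: bs => (a, b) :: shapeOfSizes (a - b) bs

/-- The parameters `(aⱼ, bⱼ)` of the product class that belongs to the degree sequence `s`. -/
def shape {n : ℕ} (s : Vtx n → ℕ) : List (ℕ × ℕ) :=
  shapeOfSizes (n - 2) ((blockOrder s).map fun v => s v - 1)

/-- The rank of `w` in `S` with respect to lexicographic order: the number of elements of `S`
that precede `w`. -/
noncomputable def lexRank (S : Set (List ℕ)) (w : List ℕ) : ℕ := {w' ∈ S | w' < w}.ncard

/-- `∏ C(aⱼ, bⱼ)`. -/
def chooseProd (ps : List (ℕ × ℕ)) : ℕ := (ps.map fun q => q.1.choose q.2).prod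

/-- `C(f(1)-1, k) + C(f(2)-1, k-1) + ⋯ + C(f(k)-1, 1)`, where `k` is the length of the sequence. -/
def decFunFormula : List ℕ → ℕ
  | [] => 0
  | x :: xs => (x - 1).choose (xs.length + 1) + decFunFormula xs

/-- `∑ⱼ rank(fⱼ) ∏_{l > j} C(aₗ, bₗ)`. -/
def decFunProdFormula : List (ℕ × ℕ) → List ℕ → ℕ
  | [], _ => 0
  | (_, b) :: ps, w =>
    decFunFormula (w.take b) * chooseProd ps + decFunProdFormula ps (w.drop b)

/-- The greedy procedure that finds the decreasing sequence of length `k` and of rank `m`: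
`f(1) - 1` is the largest `y` with `C(y, k) ≤ m`, and so on with `m - C(y, k)` and `k - 1`.
(Every such `y` is at most `m + k - 1`.) -/
def decFunUnrank : ℕ → ℕ → List ℕ
  | 0, _ => []
  | k + 1, m =>
    let y := Nat.findGreatest (fun y => y.choose (k + 1) ≤ m) (m + k)
    (y + 1) :: decFunUnrank k (m - y.choose (k + 1))

/-- Unranking in a product, by successive quotients and remainders. -/
def decFunProdUnrank : List (ℕ × ℕ) → ℕ → List ℕ
  | [], _ => []
  | (_, b) :: ps, r =>
    decFunUnrank b (r / chooseProd ps) ++ decFunProdUnrank ps (r % chooseProd ps)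

/-! ### Ranking and unranking of trees -/

/-- The rank of the tree `T`: pass to `Θ⁻¹(T)`, to its ordered set partition, to the sequence that
codes it, and take the lexicographic rank of that sequence in the product class. -/
noncomputable def rankTree {n : ℕ} (s : Vtx n → ℕ) (T : Digraph (Vtx n)) : ℕ :=
  lexRank (decFunProd (shape s)) (encode s (treePartition T))

/-- The reverse procedure. -/
def unrankTree {n : ℕ} (s : Vtx n → ℕ) (r : ℕ) : Digraph (Vtx n) :=
  theta (partitionGraph (decode s (decFunProdUnrank (shape s) r)))

/-! ### Random access machines with logarithmic cost

The machine has registers (the variables of a program) and a memory that is indexed by natural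
numbers; both hold natural numbers. An operation costs the number of bits of the numbers and
addresses on which it operates. -/

/-- The number of bits of `x`: `⌊log₂ x⌋ + 1`, and `1` for `x = 0`. -/
def bitLen (x : ℕ) : ℕ := Nat.log 2 x + 1

/-- The state of a machine. -/
structure MState where
  reg : ℕ → ℕ
  mem : ℕ → ℕ

/-- Write `x` into register `d`. -/
def MState.setReg (σ : MState) (d x : ℕ) : MState := ⟨Function.update σ.reg d x, σ.mem⟩

/-- Write `x` into the memory cell with address `a`. -/
def MState.setMem (σ : MState) (a x : ℕ) : MState := ⟨σ.reg, Function.update σ.mem a x⟩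

/-- The arithmetic operations; subtraction is truncated at `0` and division is integer division. -/
inductive ArithOp
  | add
  | sub
  | mul
  | div

/-- The value of an arithmetic operation. -/
def ArithOp.eval : ArithOp → ℕ → ℕ → ℕ
  | .add, x, y => x + y
  | .sub, x, y => x - y
  | .mul, x, y => x * y
  | .div, x, y => x / y

/-- Programs; the natural numbers `d`, `x`, `y`, `a` are names of registers. -/
inductive Program
  /-- do nothing -/
  | skip
  /-- `d := k` -/
  | const (d k : ℕ)
  /-- `d := x ∘ y` -/
  | arith (o : ArithOp) (d x y : ℕ)
  /-- `d := mem[a]` -/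
  | load (d a : ℕ)
  /-- `mem[a] := x` -/
  | store (a x : ℕ)
  /-- first `P`, then `Q` -/
  | seq (P Q : Program)
  /-- `if x < y then P else Q` -/
  | ifLt (x y : ℕ) (P Q : Program)
  /-- `while x < y do P` -/
  | whileLt (x y : ℕ) (P : Program)

/-- `Runs P σ τ c`: started in state `σ`, the program `P` halts in state `τ`, at total cost `c`. -/
inductive Runs : Program → MState → MState → ℕ → Prop
  | skip (σ : MState) : Runs .skip σ σ 1
  | const (d k : ℕ) (σ : MState) : Runs (.const d k) σ (σ.setReg d k) (bitLen k)
  | arith (o : ArithOp) (d x y : ℕ) (σ : MState) :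
      Runs (.arith o d x y) σ (σ.setReg d (o.eval (σ.reg x) (σ.reg y)))
        (bitLen (σ.reg x) + bitLen (σ.reg y))
  | load (d a : ℕ) (σ : MState) :
      Runs (.load d a) σ (σ.setReg d (σ.mem (σ.reg a)))
        (bitLen (σ.reg a) + bitLen (σ.mem (σ.reg a)))
  | store (a x : ℕ) (σ : MState) :
      Runs (.store a x) σ (σ.setMem (σ.reg a) (σ.reg x))
        (bitLen (σ.reg a) + bitLen (σ.reg x))
  | seq {P Q : Program} {σ τ υ : MState} {c d : ℕ} :
      Runs P σ τ c → Runs Q τ υ d → Runs (.seq P Q) σ υ (c + d)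
  | ifTrue {x y : ℕ} {P Q : Program} {σ τ : MState} {c : ℕ} :
      σ.reg x < σ.reg y → Runs P σ τ c →
      Runs (.ifLt x y P Q) σ τ (bitLen (σ.reg x) + bitLen (σ.reg y) + c)
  | ifFalse {x y : ℕ} {P Q : Program} {σ τ : MState} {c : ℕ} :
      ¬ σ.reg x < σ.reg y → Runs Q σ τ c →
      Runs (.ifLt x y P Q) σ τ (bitLen (σ.reg x) + bitLen (σ.reg y) + c)
  | whileTrue {x y : ℕ} {P : Program} {σ τ υ : MState} {c d : ℕ} :
      σ.reg x < σ.reg y → Runs P σ τ c → Runs (.whileLt x y P) τ υ d →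
      Runs (.whileLt x y P) σ υ (bitLen (σ.reg x) + bitLen (σ.reg y) + c + d)
  | whileFalse {x y : ℕ} {P : Program} {σ : MState} :
      ¬ σ.reg x < σ.reg y →
      Runs (.whileLt x y P) σ σ (bitLen (σ.reg x) + bitLen (σ.reg y))

/-- The table `t` lists the arcs of `T`: they are the pairs `(i, t i)` with `2 ≤ i ≤ n`. -/
def IsArcTable {n : ℕ} (T : Digraph (Vtx n)) (t : ℕ → ℕ) : Prop :=
  ∀ u v : Vtx n, T.Adj u v ↔ 2 ≤ (u : ℕ) ∧ t u = v

/-- The input of the ranking program: `n` in register `0`, `s i` in cell `i` for `1 ≤ i ≤ n`, and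
`t i` in cell `n + i` for `2 ≤ i ≤ n`; everything else is `0`. -/
def rankInput {n : ℕ} (s : Vtx n → ℕ) (t : ℕ → ℕ) : MState where
  reg x := if x = 0 then n else 0
  mem a :=
    if h : a ∈ Finset.Icc 1 n then s ⟨a, h⟩
    else if n + 2 ≤ a ∧ a ≤ n + n then t (a - n) else 0

/-- The input of the unranking program: `n` in register `0`, `r` in register `1`, and `s i` in
cell `i` for `1 ≤ i ≤ n`; everything else is `0`. -/
def unrankInput {n : ℕ} (s : Vtx n → ℕ) (r : ℕ) : MState where
  reg x := if x = 0 then n else if x = 1 then r else 0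
  mem a := if h : a ∈ Finset.Icc 1 n then s ⟨a, h⟩ else 0

end CayleyRank

open CayleyRank

namespace CayleyRank
open Relation

/-! ### Trees directed towards a root -/

/-! Cutting each cycle of `f` at its maximum leaves a segment that ends with that maximum. `theta`
strings these segments together on a path from `n` to `1`, with decreasing maxima. Whatever follows
a jump vertex `u` on this path lies on cycles with maxima below `u`, so the maxima can be read off
again as the successive largest vertices (`transGen_theta_of_isJump`, `isPathMax_theta_iff`); this
gives `thetaInv_theta`. Conversely, the segments between consecutive path maxima of a tree close up
to cycles of `thetaInv T`, and there are no other cycles (`isCycleMax_thetaInv_iff`); this gives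
`theta_thetaInv`.

`theta` merely reassigns the heads of arcs. If `1` is given a loop, each vertex other than `1` takes
over the arc of exactly one vertex other than `n` (`Redirects`). Hence the degree of `i` in the tree
is one more than the size of the fibre of `f` over `i` (`theta_degree`), and trees with given
degrees correspond to ordered set partitions with given block sizes. Since the rank in a set `D`
identifies `D` with `{1, …, |D|}`, the blocks can be coded one after the other by decreasing
sequences.

The decreasing sequences of length `b` whose first entry is below `x` number `C(x-1, b)`. Summing
over the positions gives the rank within one factor (combinatorial number system), and the product
of the factors is a mixed radix system. So `decFunProdFormula` is a strictly increasing bijection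
onto an initial interval, which forces it to be the lexicographic rank (`lexRank_eq_formula`); the
greedy procedure inverts it (`decFunUnrank_spec`).

For the running time, `theta` and `thetaInv` take `O(n²)` steps on numbers of `O(log n)` bits. A
block of size `b` is treated in one downward scan that keeps a single binomial coefficient up to
date, using one multiplication and one exact division by a number at most `n`, and one subtraction
when an element of the block is met. Its numbers have `O((b+1) log n)` bits, so the block costs `O(n
(b+1) log n)`, including a bounded number of operations on numbers of `O(n log n)` bits. As the
degrees `b + 1` sum to `2n - 2`, the total is `O(n² log n)` (`sum_outerCost_le`). -/

theorem underlying_adj_of_dist {V : Type*} {T : Digraph V} {r u v : V}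
    (hd : ∀ u v, T.Adj u v → (underlying T).dist u r = (underlying T).dist v r + 1)
    (h : T.Adj u v) : (underlying T).Adj u v := by
  refine (SimpleGraph.fromRel_adj _ _ _).2 ⟨?_, Or.inl h⟩
  rintro rfl
  have := hd _ _ h
  omega

/-- A geodesic from `u` to the root starts with an edge, and this edge must be an arc leaving `u`,
since an arc into `u` would come from farther away. An arc `u → v` followed by a geodesic from `v`
is a path, and a tree has only one path from `u` to the root. -/
theorem IsRootDirectedTree.existsUnique_adj {V : Type*} {T : Digraph V} {r u : V}
    (hT : IsRootDirectedTree T r) (hu : u ≠ r) : ∃! v, T.Adj u v := by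
  obtain ⟨ht, hd⟩ := hT
  have hconn := ht.connected
  obtain ⟨p, hp⟩ := hconn.exists_walk_length_eq_dist u r
  have hex : ∃ v, T.Adj u v := by
    cases p with
    | nil => exact absurd rfl hu
    | @cons _ w _ h q =>
      rcases ((SimpleGraph.fromRel_adj _ _ _).1 h).2 with h' | h'
      · exact ⟨w, h'⟩
      · have h1 := hd _ _ h'
        have h2 := SimpleGraph.dist_le q
        simp only [SimpleGraph.Walk.length_cons] at hp
        omega
  have key : ∀ v, T.Adj u v → ∃ (h : (underlying T).Adj u v) (q : (underlying T).Walk v r),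
      (SimpleGraph.Walk.cons h q).IsPath := by
    intro v hv
    obtain ⟨q, hq⟩ := hconn.exists_walk_length_eq_dist v r
    refine ⟨underlying_adj_of_dist hd hv, q, ?_⟩
    refine (SimpleGraph.Walk.cons_isPath_iff _ _).2 ⟨q.isPath_of_length_eq_dist hq, fun hmem => ?_⟩
    classical
    have h1 := SimpleGraph.dist_le (q.dropUntil u hmem)
    have h2 := q.length_dropUntil_le_length hmem
    have h3 := hd _ _ hv
    omega
  obtain ⟨v, hv⟩ := hex
  refine ⟨v, hv, fun w hw => ?_⟩
  obtain ⟨h1, q1, hq1⟩ := key v hv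
  obtain ⟨h2, q2, hq2⟩ := key w hw
  have := congrArg Subtype.val ((ht.isAcyclic.subsingleton_path u r).elim ⟨_, hq1⟩ ⟨_, hq2⟩)
  simp only [SimpleGraph.Walk.cons.injEq] at this
  exact this.1.symm

theorem IsRootDirectedTree.not_adj_root {V : Type*} {T : Digraph V} {r : V}
    (hT : IsRootDirectedTree T r) (v : V) : ¬ T.Adj r v := by
  intro h
  have := hT.2 _ _ h
  rw [SimpleGraph.dist_self] at this
  omega

theorem IsRootDirectedTree.irrefl_transGen {V : Type*} {T : Digraph V} {r : V}
    (hT : IsRootDirectedTree T r) (u : V) : ¬ TransGen T.Adj u u := by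
  have : ∀ v, TransGen T.Adj u v → (underlying T).dist v r < (underlying T).dist u r := by
    intro v h
    induction h with
    | single h => have := hT.2 _ _ h; omega
    | tail _ h ih => have := hT.2 _ _ h; omega
  exact fun h => lt_irrefl _ (this u h)

/-- The graph is connected because all vertices reach `r`. Every edge is the arc that leaves some
vertex other than `r`, so there are at most `|V| - 1` edges, and the graph is a tree. -/
theorem isRootDirectedTree_of_reach {V : Type*} [Finite V] {T : Digraph V} {r : V}
    (h0 : ∀ v, ¬ T.Adj r v) (h1 : ∀ u, u ≠ r → ∃! v, T.Adj u v)
    (h2 : ∀ u, ReflTransGen T.Adj u r) : IsRootDirectedTree T r := by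
  have hloop : ∀ u, ¬ T.Adj u u := by
    intro u hu
    have : ∀ v, ReflTransGen T.Adj u v → v = u := by
      intro v hv
      induction hv with
      | refl => rfl
      | tail _ h ih =>
        subst ih
        exact (h1 _ (by rintro rfl; exact h0 _ hu)).unique h hu
    have h3 := this r (h2 u)
    subst h3
    exact h0 _ hu
  have hadj : ∀ u v, T.Adj u v → (underlying T).Adj u v := fun u v h =>
    (SimpleGraph.fromRel_adj _ _ _).2 ⟨by rintro rfl; exact hloop _ h, Or.inl h⟩
  have hreach : ∀ u, (underlying T).Reachable u r := by
    intro u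
    induction h2 u using ReflTransGen.head_induction_on with
    | refl => exact SimpleGraph.Reachable.refl _
    | head h _ ih => exact (hadj _ _ h).reachable.trans ih
  have hconn : (underlying T).Connected :=
    { preconnected := fun u v => (hreach u).trans (hreach v).symm, nonempty := ⟨r⟩ }
  have hcard : Nat.card (underlying T).edgeSet + 1 = Nat.card V := by
    refine le_antisymm ?_ hconn.card_vert_le_card_edgeSet_add_one
    choose g hg hg' using h1
    have hsurj : Function.Surjective (fun u : {u : V // u ≠ r} =>
        (⟨s(u.1, g u.1 u.2), (SimpleGraph.mem_edgeSet _).2 (hadj _ _ (hg u.1 u.2))⟩ :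
          (underlying T).edgeSet)) := by
      rintro ⟨e, he⟩
      induction e using Sym2.ind with
      | _ x y =>
        have hxy := ((SimpleGraph.fromRel_adj _ _ _).1 ((SimpleGraph.mem_edgeSet _).1 he)).2
        rcases hxy with h | h
        · have hx : x ≠ r := by rintro rfl; exact h0 _ h
          exact ⟨⟨x, hx⟩, by simp [← hg' x hx y h]⟩
        · have hy : y ≠ r := by rintro rfl; exact h0 _ h
          exact ⟨⟨y, hy⟩, by simp [← hg' y hy x h, Sym2.eq_swap]⟩
    have h3 : Nat.card (underlying T).edgeSet ≤ _ := Nat.card_le_card_of_surjective _ hsurj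
    have h4 : Nat.card {u : V // u ≠ r} < Nat.card V :=
      Finite.card_subtype_lt (p := fun u => u ≠ r) (x := r) (by simp)
    omega
  have htree : (underlying T).IsTree := SimpleGraph.isTree_iff_connected_and_card.2 ⟨hconn, hcard⟩
  refine ⟨htree, fun u => ?_⟩
  induction h : (underlying T).dist u r using Nat.strong_induction_on generalizing u with
  | _ d ih =>
    subst h
    intro v hv
    have hur : u ≠ r := by rintro rfl; exact h0 _ hv
    have hd := htree.dist_eq_dist_add_one_of_adj r (hadj _ _ hv)
    rw [SimpleGraph.dist_comm, SimpleGraph.dist_comm (u := r) (v := v)] at hd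
    rcases hd with hd | hd
    · exact hd
    -- If the arc led away from `r`, a geodesic from `u` would begin with an edge to some closer
    -- `w`. It is not the arc leaving `u`, which goes to `v`; and by induction an arc from `w` to
    -- `u` would have to approach `r`.
    · exfalso
      obtain ⟨p, hp⟩ := hconn.exists_walk_length_eq_dist u r
      cases p with
      | nil => exact hur rfl
      | @cons _ w _ h q =>
        have h2 := SimpleGraph.dist_le q
        simp only [SimpleGraph.Walk.length_cons] at hp
        rcases ((SimpleGraph.fromRel_adj _ _ _).1 h).2 with h' | h'
        · have := congrArg (fun x => (underlying T).dist x r) ((h1 u hur).unique h' hv)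
          omega
        · have := ih _ (by omega) w rfl u h'
          omega

end CayleyRank

namespace CayleyRank
open Relation

/-! ### The bijection `Θ` -/

theorem exists_isGreatest_of_nonempty {α : Type*} [LinearOrder α] [Finite α] {s : Set α}
    (hs : s.Nonempty) : ∃ m, IsGreatest s m := by
  obtain ⟨m, hm, h⟩ := Set.exists_max_image s id (Set.toFinite s) hs
  exact ⟨m, hm, h⟩

theorem exists_isLeast_of_nonempty {α : Type*} [LinearOrder α] [Finite α] {s : Set α}
    (hs : s.Nonempty) : ∃ m, IsLeast s m := by
  obtain ⟨m, hm, h⟩ := Set.exists_min_image s id (Set.toFinite s) hs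
  exact ⟨m, hm, h⟩

/-- For a functional relation, everything reachable from a periodic point leads back to it. -/
theorem transGen_back_of_periodic {α : Type*} {r : α → α → Prop} (hr : Relator.RightUnique r)
    {m w : α} (hm : TransGen r m m) (hw : ReflTransGen r m w) : TransGen r w m := by
  induction hw with
  | refl => exact hm
  | tail _ h ih =>
    obtain ⟨b, hb, hbm⟩ := TransGen.head'_iff.1 ih
    rw [hr h hb]
    rcases reflTransGen_iff_eq_or_transGen.1 hbm with rfl | h'
    · exact hm
    · exact h'

theorem funGraph_rightUnique {n : ℕ} (f : FunClass n) : Relator.RightUnique (funGraph f).Adj := by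
  rintro a b c ⟨h, rfl⟩ ⟨h', rfl⟩
  rfl

theorem funGraph_adj_mem {n : ℕ} {f : FunClass n} {u v : Vtx n} (h : (funGraph f).Adj u v) :
    2 ≤ (u : ℕ) ∧ (u : ℕ) < n := by
  obtain ⟨h, -⟩ := h
  simpa using h

theorem funGraph_injective (n : ℕ) : Function.Injective (funGraph (n := n)) := by
  intro f g h
  funext ⟨u, hu⟩
  have hu' : u ∈ Finset.Icc 1 n := by simp at hu ⊢; omega
  have : (funGraph f).Adj ⟨u, hu'⟩ (f ⟨u, hu⟩) := ⟨hu, rfl⟩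
  rw [h] at this
  obtain ⟨_, h⟩ := this
  exact h.symm

theorem exists_funGraph_eq {n : ℕ} {G : Digraph (Vtx n)}
    (h1 : ∀ u v, G.Adj u v → 2 ≤ (u : ℕ) ∧ (u : ℕ) < n)
    (h2 : ∀ u : Vtx n, 2 ≤ (u : ℕ) → (u : ℕ) < n → ∃ v, G.Adj u v)
    (h3 : Relator.RightUnique G.Adj) : ∃ f : FunClass n, funGraph f = G := by
  have : ∀ u : ↥(Finset.Ico 2 n), ∃ v, ∀ h : (u : ℕ) ∈ Finset.Icc 1 n, G.Adj ⟨u, h⟩ v := by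
    rintro ⟨u, hu⟩
    have hu' := Finset.mem_Ico.1 hu
    have h : u ∈ Finset.Icc 1 n := by simp; omega
    obtain ⟨v, hv⟩ := h2 ⟨u, h⟩ hu'.1 hu'.2
    exact ⟨v, fun _ => hv⟩
  choose f hf using this
  refine ⟨f, Digraph.ext (funext fun u => funext fun v => propext ⟨?_, fun h => ?_⟩)⟩
  · rintro ⟨h, rfl⟩
    exact hf ⟨u, h⟩ u.2
  · have hu := h1 u v h
    exact ⟨Finset.mem_Ico.2 hu, h3 (hf ⟨u, Finset.mem_Ico.2 hu⟩ u.2) h⟩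

/-- The largest vertex `n`, or the largest vertex of a cycle. -/
def IsJump {n : ℕ} (G : Digraph (Vtx n)) (u : Vtx n) : Prop := (u : ℕ) = n ∨ IsCycleMax G u

/-- `v` is the largest cycle maximum below `u`. -/
def IsPrevMax {n : ℕ} (G : Digraph (Vtx n)) (u v : Vtx n) : Prop :=
  IsGreatest {m' | IsCycleMax G m' ∧ m' < u} v

theorem theta_adj {n : ℕ} {G : Digraph (Vtx n)} {u v : Vtx n} :
    (theta G).Adj u v ↔ (G.Adj u v ∧ ¬ IsCycleMax G u) ∨ (IsJump G u ∧
      ((∃ m, IsPrevMax G u m ∧ G.Adj m v) ∨ ((∀ m, IsCycleMax G m → ¬ m < u) ∧ (v : ℕ) = 1))) :=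
  Iff.rfl

theorem IsCycleMax.exists_adj {n : ℕ} {G : Digraph (Vtx n)} {m : Vtx n} (hm : IsCycleMax G m) :
    ∃ v, G.Adj m v := by
  obtain ⟨v, hv, -⟩ := TransGen.head'_iff.1 hm.1
  exact ⟨v, hv⟩

theorem IsCycleMax.bounds {n : ℕ} {f : FunClass n} {m : Vtx n} (hm : IsCycleMax (funGraph f) m) :
    2 ≤ (m : ℕ) ∧ (m : ℕ) < n := by
  obtain ⟨v, hv⟩ := hm.exists_adj
  exact funGraph_adj_mem hv

theorem IsCycleMax.eq_of_transGen {n : ℕ} {f : FunClass n} {m m' : Vtx n}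
    (hm : IsCycleMax (funGraph f) m) (hm' : IsCycleMax (funGraph f) m')
    (h : TransGen (funGraph f).Adj m m') : m' = m := by
  have h' := transGen_back_of_periodic (funGraph_rightUnique f) hm.1 h.to_reflTransGen
  exact le_antisymm (hm.2 _ h h') (hm'.2 _ h' h)

theorem exists_isCycleMax {n : ℕ} {f : FunClass n} {w : Vtx n}
    (hw : TransGen (funGraph f).Adj w w) :
    ∃ m, IsCycleMax (funGraph f) m ∧ TransGen (funGraph f).Adj w m := by
  obtain ⟨m, hm, hmax⟩ := exists_isGreatest_of_nonempty
    (s := {x | TransGen (funGraph f).Adj w x}) ⟨w, hw⟩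
  have hback := transGen_back_of_periodic (funGraph_rightUnique f) hw hm.to_reflTransGen
  exact ⟨m, ⟨hback.trans hm, fun x hx _ => hmax (hm.trans hx)⟩, hm⟩

/-- The only arc of the cycle that is cut is the one leaving its maximum, so the way from any other
vertex of the cycle to the maximum survives. -/
theorem reflTransGen_theta_of_cycle {n : ℕ} {f : FunClass n} {m x : Vtx n}
    (hm : IsCycleMax (funGraph f) m) (hx : TransGen (funGraph f).Adj m x) :
    ReflTransGen (theta (funGraph f)).Adj x m := by
  have h := (transGen_back_of_periodic (funGraph_rightUnique f) hm.1
    hx.to_reflTransGen).to_reflTransGen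
  induction h using ReflTransGen.head_induction_on with
  | refl => exact .refl
  | @head x y h _ ih =>
    by_cases hxm : x = m
    · rw [hxm]
    · exact (ih (hx.tail h)).head (theta_adj.2 (Or.inl ⟨h, fun hc => hxm (hm.eq_of_transGen hc hx)⟩))

theorem transGen_theta_of_isPrevMax {n : ℕ} {f : FunClass n} {u v : Vtx n}
    (hu : IsJump (funGraph f) u) (hv : IsPrevMax (funGraph f) u v) :
    TransGen (theta (funGraph f)).Adj u v := by
  obtain ⟨x, hx⟩ := hv.1.1.exists_adj
  exact TransGen.head' (theta_adj.2 (Or.inr ⟨hu, Or.inl ⟨v, hv, hx⟩⟩))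
    (reflTransGen_theta_of_cycle hv.1.1 (.single hx))

theorem theta_adj_of_isJump {n : ℕ} {f : FunClass n} {u v : Vtx n}
    (hu : IsJump (funGraph f) u) (h : (theta (funGraph f)).Adj u v) :
    (∃ m, IsPrevMax (funGraph f) u m ∧ (funGraph f).Adj m v) ∨
      ((∀ m, IsCycleMax (funGraph f) m → ¬ m < u) ∧ (v : ℕ) = 1) := by
  rcases theta_adj.1 h with ⟨h, hc⟩ | ⟨-, h⟩
  · have := funGraph_adj_mem h
    rcases hu with hu | hu
    · omega
    · exact absurd hu hc
  · exact h

/-- After a jump the path runs along the cycle of a smaller maximum, up to that maximum, and jumps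
again. The maxima decrease at each jump, until the path ends at `1`. -/
theorem transGen_theta_of_isJump {n : ℕ} (hn : 2 ≤ n) {f : FunClass n} {u w : Vtx n}
    (hu : IsJump (funGraph f) u) (h : TransGen (theta (funGraph f)).Adj u w) :
    (w : ℕ) = 1 ∨ ∃ m, IsCycleMax (funGraph f) m ∧ m < u ∧ TransGen (funGraph f).Adj m w := by
  induction h with
  | single h =>
    rcases theta_adj_of_isJump hu h with ⟨m, hm, h⟩ | ⟨-, h⟩
    · exact Or.inr ⟨m, hm.1.1, hm.1.2, .single h⟩
    · exact Or.inl h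
  | @tail w v _ h ih =>
    rcases ih with hw | ⟨m, hm, hmu, hmw⟩
    · exfalso
      rcases theta_adj.1 h with ⟨h, -⟩ | ⟨h | h, h'⟩
      · have := funGraph_adj_mem h
        omega
      · omega
      · have := h.bounds
        omega
    · rcases theta_adj.1 h with ⟨h, -⟩ | ⟨hj, h'⟩
      · exact Or.inr ⟨m, hm, hmu, hmw.tail h⟩
      -- The vertex `w` lies on a cycle of `f`, so an arc of `f` leaves it and it is not `n`.
      · have hwm : IsCycleMax (funGraph f) w := by
          rcases hj with hj | hj
          · have h1 := transGen_back_of_periodic (funGraph_rightUnique f) hm.1 hmw.to_reflTransGen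
            obtain ⟨x, hx, -⟩ := TransGen.head'_iff.1 h1
            have := funGraph_adj_mem hx
            omega
          · exact hj
        rcases h' with ⟨m', hm', h'⟩ | ⟨-, h'⟩
        · refine Or.inr ⟨m', hm'.1.1, hm'.1.2.trans ?_, .single h'⟩
          rwa [hm.eq_of_transGen hwm hmw]
        · exact Or.inl h'

theorem nextMax_theta_of_isPrevMax {n : ℕ} (hn : 2 ≤ n) {f : FunClass n} {u v : Vtx n}
    (hu : IsJump (funGraph f) u) (hv : IsPrevMax (funGraph f) u v) :
    NextMax (theta (funGraph f)) u v := by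
  refine ⟨⟨?_, transGen_theta_of_isPrevMax hu hv⟩, ?_⟩
  · have := hv.1.1.bounds
    omega
  · rintro w ⟨hw1, hw⟩
    obtain hw | ⟨m, hm, hmu, hmw⟩ := transGen_theta_of_isJump hn hu hw
    · exact absurd hw hw1
    · exact (hm.2 w hmw (transGen_back_of_periodic (funGraph_rightUnique f) hm.1
        hmw.to_reflTransGen)).trans (hv.2 ⟨hm, hmu⟩)

/-- This is what makes `theta` invertible: a vertex after `u` is at most the maximum of its cycle,
which is below `u`, so the largest vertex after `u` is the largest cycle maximum below `u`. -/
theorem nextMax_theta_iff {n : ℕ} (hn : 2 ≤ n) {f : FunClass n} {u v : Vtx n}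
    (hu : IsJump (funGraph f) u) :
    NextMax (theta (funGraph f)) u v ↔ IsPrevMax (funGraph f) u v := by
  refine ⟨fun h => ?_, nextMax_theta_of_isPrevMax hn hu⟩
  obtain hw | ⟨m, hm, hmu, -⟩ := transGen_theta_of_isJump hn hu h.1.2
  · exact absurd hw h.1.1
  · obtain ⟨v', hv'⟩ := exists_isGreatest_of_nonempty
      (s := {m' | IsCycleMax (funGraph f) m' ∧ m' < u}) ⟨m, hm, hmu⟩
    rwa [h.unique (nextMax_theta_of_isPrevMax hn hu hv')]

theorem IsCycleMax.exists_isPrevMax {n : ℕ} {f : FunClass n} {m : Vtx n}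
    (hm : IsCycleMax (funGraph f) m) :
    ∃ u, m < u ∧ IsJump (funGraph f) u ∧ IsPrevMax (funGraph f) u m := by
  have hb := hm.bounds
  -- The least jump vertex above `m` is the predecessor of `m`; it exists because `n` is a jump
  -- vertex.
  obtain ⟨u, ⟨hmu, hu⟩, hmin⟩ := exists_isLeast_of_nonempty
    (s := {x | m < x ∧ IsJump (funGraph f) x})
    ⟨⟨n, by simp; omega⟩, Subtype.mk_lt_mk.2 hb.2, Or.inl rfl⟩
  refine ⟨u, hmu, hu, ⟨hm, hmu⟩, ?_⟩
  rintro m' ⟨hm', hlt⟩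
  by_contra hcon
  exact absurd (hmin ⟨not_le.1 hcon, Or.inr hm'⟩) (not_le.2 hlt)

theorem isPathMax_theta_iff {n : ℕ} (hn : 2 ≤ n) {f : FunClass n} {m : Vtx n} :
    IsPathMax (theta (funGraph f)) m ↔ IsJump (funGraph f) m := by
  constructor
  · rintro ⟨u, hu, h⟩
    induction h with
    | refl => exact Or.inl hu
    | tail _ h ih => exact Or.inr ((nextMax_theta_iff hn ih).1 h).1.1
  · induction m using WellFoundedGT.induction with
    | ind m ih =>
      rintro (hm | hm)
      · exact ⟨m, hm, .refl⟩
      · obtain ⟨u, hmu, hu, h⟩ := hm.exists_isPrevMax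
        obtain ⟨t, ht, htu⟩ := ih u hmu hu
        exact ⟨t, ht, htu.tail ((nextMax_theta_iff hn hu).2 h)⟩

theorem IsPrevMax.adj_theta_iff {n : ℕ} {f : FunClass n} {u m v : Vtx n}
    (hu : IsJump (funGraph f) u) (hm : IsPrevMax (funGraph f) u m) :
    (theta (funGraph f)).Adj u v ↔ (funGraph f).Adj m v := by
  constructor
  · intro h
    rcases theta_adj_of_isJump hu h with ⟨m', hm', h⟩ | ⟨h, -⟩
    · rwa [hm.unique hm']
    · exact absurd hm.1.2 (h m hm.1.1)
  · exact fun h => theta_adj.2 (Or.inr ⟨hu, Or.inl ⟨m, hm, h⟩⟩)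

/-- The path maxima of the tree are `n` and the cycle maxima, in the same order. `thetaInv`
therefore hands back to each cycle maximum the head that its predecessor had taken over from it. -/
theorem thetaInv_theta {n : ℕ} (hn : 2 ≤ n) (f : FunClass n) :
    thetaInv (theta (funGraph f)) = funGraph f := by
  refine Digraph.ext (funext fun u => funext fun v => propext ?_)
  change ((theta (funGraph f)).Adj u v ∧ ¬ IsPathMax (theta (funGraph f)) u) ∨
    (∃ m, IsPathMax (theta (funGraph f)) m ∧ NextMax (theta (funGraph f)) m u ∧
      (theta (funGraph f)).Adj m v) ↔ _
  simp only [isPathMax_theta_iff hn]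
  constructor
  · rintro (⟨h, hu⟩ | ⟨m, hm, hmu, h⟩)
    · rcases theta_adj.1 h with ⟨h, -⟩ | ⟨h, -⟩
      · exact h
      · exact absurd h hu
    · exact (((nextMax_theta_iff hn hm).1 hmu).adj_theta_iff hm).1 h
  · intro h
    by_cases hu : IsCycleMax (funGraph f) u
    · obtain ⟨m, -, hm, hmu⟩ := hu.exists_isPrevMax
      exact Or.inr ⟨m, hm, (nextMax_theta_iff hn hm).2 hmu, (hmu.adj_theta_iff hm).2 h⟩
    · refine Or.inl ⟨theta_adj.2 (Or.inl ⟨h, hu⟩), ?_⟩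
      rintro (h' | h')
      · have := funGraph_adj_mem h
        omega
      · exact hu h'

/-! ### The graph `Θ(f)` is a tree -/

theorem theta_existsUnique_adj {n : ℕ} (f : FunClass n) {u : Vtx n} (hu : (u : ℕ) ≠ 1) :
    ∃! v, (theta (funGraph f)).Adj u v := by
  have hu2 := Finset.mem_Icc.1 u.2
  by_cases hj : IsJump (funGraph f) u
  · by_cases hex : ∃ m, IsCycleMax (funGraph f) m ∧ m < u
    · obtain ⟨m, hm⟩ := exists_isGreatest_of_nonempty
        (s := {m' | IsCycleMax (funGraph f) m' ∧ m' < u}) hex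
      obtain ⟨v, hv⟩ := hm.1.1.exists_adj
      refine ⟨v, (IsPrevMax.adj_theta_iff hj hm).2 hv, fun w hw => ?_⟩
      exact funGraph_rightUnique f ((IsPrevMax.adj_theta_iff hj hm).1 hw) hv
    · refine ⟨⟨1, by simp; omega⟩, theta_adj.2 (Or.inr ⟨hj, Or.inr ⟨fun m hm h => hex ⟨m, hm, h⟩,
        rfl⟩⟩), fun w hw => ?_⟩
      rcases theta_adj_of_isJump hj hw with ⟨m, hm, -⟩ | ⟨-, h⟩
      · exact absurd ⟨m, hm.1⟩ hex
      · exact Subtype.ext h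
  · have hun : (u : ℕ) ≠ n := fun h => hj (Or.inl h)
    have huc : ¬ IsCycleMax (funGraph f) u := fun h => hj (Or.inr h)
    refine ⟨f ⟨u, by simp; omega⟩, theta_adj.2 (Or.inl ⟨⟨by simp; omega, rfl⟩, huc⟩), fun w hw => ?_⟩
    rcases theta_adj.1 hw with ⟨⟨_, h⟩, -⟩ | ⟨h, -⟩
    · exact h.symm
    · exact absurd h hj

theorem theta_reflTransGen_one_of_isJump {n : ℕ} {f : FunClass n} {r : Vtx n}
    (hr : (r : ℕ) = 1) (u : Vtx n) (hu : IsJump (funGraph f) u) :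
    ReflTransGen (theta (funGraph f)).Adj u r := by
  induction u using WellFoundedLT.induction with
  | ind u ih =>
    by_cases hex : ∃ m, IsCycleMax (funGraph f) m ∧ m < u
    · obtain ⟨m, hm⟩ := exists_isGreatest_of_nonempty
        (s := {m' | IsCycleMax (funGraph f) m' ∧ m' < u}) hex
      exact (transGen_theta_of_isPrevMax hu hm).to_reflTransGen.trans
        (ih m hm.1.2 (Or.inr hm.1.1))
    · exact .single (theta_adj.2 (Or.inr ⟨hu, Or.inr ⟨fun m hm h => hex ⟨m, hm, h⟩, hr⟩⟩))

/-- A vertex that does not reach `1` is no jump vertex, so its arc in `f` survives and leads to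
another such vertex. By finiteness there is a cycle of `f` among these vertices. But a vertex on a
cycle reaches the maximum of the cycle, a jump vertex, and from there `1`. -/
theorem theta_reflTransGen_one {n : ℕ} {f : FunClass n} {r : Vtx n}
    (hr : (r : ℕ) = 1) (u : Vtx n) : ReflTransGen (theta (funGraph f)).Adj u r := by
  by_contra hu
  set S : Set (Vtx n) := {w | ¬ ReflTransGen (theta (funGraph f)).Adj w r}
  have hstep : ∀ w ∈ S, ∃ v ∈ S, (funGraph f).Adj w v := by
    intro w hw
    have hj : ¬ IsJump (funGraph f) w := fun h => hw (theta_reflTransGen_one_of_isJump hr w h)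
    have hw2 := Finset.mem_Icc.1 w.2
    have hwn : (w : ℕ) ≠ n := fun h => hj (Or.inl h)
    have hw1 : (w : ℕ) ≠ 1 := fun h => hw (by rw [Subtype.ext (h.trans hr.symm)])
    have hadj : (funGraph f).Adj w (f ⟨w, by simp; omega⟩) := ⟨by simp; omega, rfl⟩
    refine ⟨_, fun h => hw (h.head (theta_adj.2 (Or.inl ⟨hadj, fun h => hj (Or.inr h)⟩))), hadj⟩
  have hper : ∃ w ∈ S, TransGen (funGraph f).Adj w w := by
    by_contra hno
    push Not at hno
    choose! g hgS hg using hstep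
    have hiter : ∀ k, g^[k] u ∈ S := by
      intro k
      induction k with
      | zero => exact hu
      | succ k ih => rw [Function.iterate_succ_apply']; exact hgS _ ih
    have hlt : ∀ i j, i < j → TransGen (funGraph f).Adj (g^[i] u) (g^[j] u) := by
      intro i j hij
      induction j, hij using Nat.le_induction with
      | base => rw [Function.iterate_succ_apply']; exact .single (hg _ (hiter i))
      | succ j _ ih => rw [Function.iterate_succ_apply']; exact ih.tail (hg _ (hiter j))
    obtain ⟨i, j, hne, heq⟩ := Finite.exists_ne_map_eq_of_infinite (fun k => g^[k] u)
    rcases lt_or_gt_of_ne hne with h | h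
    · exact hno _ (hiter i) (by simpa [← heq] using hlt i j h)
    · exact hno _ (hiter j) (by simpa [heq] using hlt j i h)
  obtain ⟨w, hwS, hw⟩ := hper
  obtain ⟨m, hm, hwm⟩ := exists_isCycleMax hw
  have hmw := transGen_back_of_periodic (funGraph_rightUnique f) hw hwm.to_reflTransGen
  exact hwS ((reflTransGen_theta_of_cycle hm hmw).trans
    (theta_reflTransGen_one_of_isJump hr m (Or.inr hm)))

theorem theta_mem_rootedTrees {n : ℕ} (hn : 2 ≤ n) (f : FunClass n) :
    theta (funGraph f) ∈ rootedTrees n := by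
  refine ⟨⟨1, by simp; omega⟩, rfl, isRootDirectedTree_of_reach ?_ ?_ ?_⟩
  · intro v h
    rcases theta_adj.1 h with ⟨h, -⟩ | ⟨h | h, -⟩
    · have := funGraph_adj_mem h
      simp at this
    · simp at h
      omega
    · have := h.bounds
      simp at this
  · intro u hu
    exact theta_existsUnique_adj f fun h => hu (Subtype.ext h)
  · exact fun u => theta_reflTransGen_one rfl u

end CayleyRank

namespace CayleyRank
open Relation

/-! ### The inverse of `Θ` -/

theorem rootedTrees_adj_bounds {n : ℕ} {T : Digraph (Vtx n)} (hT : T ∈ rootedTrees n)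
    {u v : Vtx n} (h : T.Adj u v) : 2 ≤ (u : ℕ) := by
  obtain ⟨r, hr, hT⟩ := hT
  have := Finset.mem_Icc.1 u.2
  by_contra hu
  have : u = r := Subtype.ext (by omega)
  subst this
  exact hT.not_adj_root v h

theorem rootedTrees_existsUnique_adj {n : ℕ} {T : Digraph (Vtx n)} (hT : T ∈ rootedTrees n)
    {u : Vtx n} (hu : (u : ℕ) ≠ 1) : ∃! v, T.Adj u v := by
  obtain ⟨r, hr, hT⟩ := hT
  exact hT.existsUnique_adj (by rintro rfl; exact hu hr)

theorem rootedTrees_rightUnique {n : ℕ} {T : Digraph (Vtx n)} (hT : T ∈ rootedTrees n) :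
    Relator.RightUnique T.Adj := by
  intro a b c hb hc
  have := rootedTrees_adj_bounds hT hb
  exact (rootedTrees_existsUnique_adj hT (by omega)).unique hb hc

theorem rootedTrees_irrefl {n : ℕ} {T : Digraph (Vtx n)} (hT : T ∈ rootedTrees n)
    (u : Vtx n) : ¬ TransGen T.Adj u u := by
  obtain ⟨r, hr, hT⟩ := hT
  exact hT.irrefl_transGen u

/-- A path maximum other than `n` was chosen as the largest vertex after its predecessor, and all
that follows it also follows the predecessor. -/
theorem IsPathMax.lt_of_transGen {n : ℕ} {T : Digraph (Vtx n)}
    (hT : T ∈ rootedTrees n) {p w : Vtx n} (hp : IsPathMax T p) (hw : TransGen T.Adj p w) :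
    w < p := by
  obtain ⟨t, ht, h⟩ := hp
  have hne : w ≠ p := by rintro rfl; exact rootedTrees_irrefl hT _ hw
  have hw2 := Finset.mem_Icc.1 w.2
  have hp2 := Finset.mem_Icc.1 p.2
  rcases h.cases_tail with rfl | ⟨q, -, hq⟩
  · exact lt_of_le_of_ne (Subtype.mk_le_mk.2 (by omega)) hne
  · by_cases hw1 : (w : ℕ) = 1
    · exact lt_of_le_of_ne (Subtype.mk_le_mk.2 (by omega)) hne
    · exact lt_of_le_of_ne (hq.2 ⟨hw1, hq.1.2.trans hw⟩) hne

theorem reflTransGen_of_nextMax {n : ℕ} {T : Digraph (Vtx n)} {u v : Vtx n}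
    (h : ReflTransGen (NextMax T) u v) : ReflTransGen T.Adj u v := by
  induction h with
  | refl => exact .refl
  | tail _ h ih => exact ih.trans h.1.2.to_reflTransGen

theorem IsPathMax.next {n : ℕ} {T : Digraph (Vtx n)} {u v : Vtx n}
    (hu : IsPathMax T u) (h : NextMax T u v) : IsPathMax T v := by
  obtain ⟨t, ht, h'⟩ := hu
  exact ⟨t, ht, h'.tail h⟩

theorem IsPathMax.ne_one {n : ℕ} (hn : 2 ≤ n) {T : Digraph (Vtx n)} {u : Vtx n}
    (hu : IsPathMax T u) : (u : ℕ) ≠ 1 := by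
  obtain ⟨t, ht, h⟩ := hu
  rcases h.cases_tail with rfl | ⟨q, -, hq⟩
  · omega
  · exact hq.1.1

/-- A path maximum lies before each smaller one. -/
theorem IsPathMax.transGen_of_lt {n : ℕ} {T : Digraph (Vtx n)}
    (hT : T ∈ rootedTrees n) {p q : Vtx n} (hp : IsPathMax T p) (hq : IsPathMax T q)
    (h : q < p) : TransGen T.Adj p q := by
  obtain ⟨t, ht, hp'⟩ := id hp
  obtain ⟨t', ht', hq'⟩ := id hq
  obtain rfl : t' = t := Subtype.ext (ht'.trans ht.symm)
  -- Both lie on the single path that starts at `n`, so one of them comes before the other; the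
  -- smaller one cannot come first.
  rcases ReflTransGen.total_of_right_unique (rootedTrees_rightUnique hT)
    (reflTransGen_of_nextMax hp') (reflTransGen_of_nextMax hq') with h' | h'
  · rcases reflTransGen_iff_eq_or_transGen.1 h' with rfl | h'
    · exact absurd h (lt_irrefl _)
    · exact h'
  · rcases reflTransGen_iff_eq_or_transGen.1 h' with rfl | h'
    · exact absurd h (lt_irrefl _)
    · exact absurd (hq.lt_of_transGen hT h') (lt_asymm h)

theorem exists_nextMax {n : ℕ} {T : Digraph (Vtx n)} {u w : Vtx n}
    (h : TransGen T.Adj u w) (hw : (w : ℕ) ≠ 1) : ∃ v, NextMax T u v :=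
  exists_isGreatest_of_nonempty (s := {w : Vtx n | (w : ℕ) ≠ 1 ∧ TransGen T.Adj u w}) ⟨w, hw, h⟩

/-- Since the order on the path is the decreasing order of the labels, the next path maximum can be
described without the path. In this form it has the shape of `IsPrevMax`. -/
theorem nextMax_iff_of_isPathMax {n : ℕ} (hn : 2 ≤ n) {T : Digraph (Vtx n)}
    (hT : T ∈ rootedTrees n) {u v : Vtx n} (hu : IsPathMax T u) :
    NextMax T u v ↔ IsGreatest {m | IsPathMax T m ∧ m < u} v := by
  have key : ∀ v, NextMax T u v → IsGreatest {m | IsPathMax T m ∧ m < u} v := by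
    intro v h
    refine ⟨⟨hu.next h, hu.lt_of_transGen hT h.1.2⟩, fun m hm => ?_⟩
    exact h.2 ⟨hm.1.ne_one hn, hu.transGen_of_lt hT hm.1 hm.2⟩
  refine ⟨key v, fun h => ?_⟩
  obtain ⟨w, hw⟩ := exists_nextMax (hu.transGen_of_lt hT h.1.1 h.1.2) (h.1.1.ne_one hn)
  rwa [h.unique (key w hw)]

theorem IsPathMax.nextMax_injective {n : ℕ} (hn : 2 ≤ n) {T : Digraph (Vtx n)}
    (hT : T ∈ rootedTrees n) {p q u : Vtx n} (hp : IsPathMax T p) (hq : IsPathMax T q)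
    (h : NextMax T p u) (h' : NextMax T q u) : p = q := by
  rw [nextMax_iff_of_isPathMax hn hT hp] at h
  rw [nextMax_iff_of_isPathMax hn hT hq] at h'
  rcases lt_trichotomy p q with hpq | hpq | hpq
  · exact absurd (h'.2 ⟨hp, hpq⟩) (not_le.2 h.1.2)
  · exact hpq
  · exact absurd (h.2 ⟨hq, hpq⟩) (not_le.2 h'.1.2)

theorem thetaInv_adj {n : ℕ} {T : Digraph (Vtx n)} {u v : Vtx n} :
    (thetaInv T).Adj u v ↔ (T.Adj u v ∧ ¬ IsPathMax T u) ∨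
      ∃ m, IsPathMax T m ∧ NextMax T m u ∧ T.Adj m v := Iff.rfl

theorem thetaInv_adj_of_nextMax {n : ℕ} (hn : 2 ≤ n) {T : Digraph (Vtx n)}
    (hT : T ∈ rootedTrees n) {m u v : Vtx n} (hm : IsPathMax T m) (h : NextMax T m u) :
    (thetaInv T).Adj u v ↔ T.Adj m v := by
  rw [thetaInv_adj]
  constructor
  · rintro (⟨-, h'⟩ | ⟨m', hm', h', hv⟩)
    · exact absurd (hm.next h) h'
    · rwa [hm.nextMax_injective hn hT hm' h h']
  · exact fun hv => Or.inr ⟨m, hm, h, hv⟩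

theorem thetaInv_adj_of_not_isPathMax {n : ℕ} {T : Digraph (Vtx n)} {u v : Vtx n}
    (hu : ¬ IsPathMax T u) : (thetaInv T).Adj u v ↔ T.Adj u v := by
  rw [thetaInv_adj]
  constructor
  · rintro (⟨h, -⟩ | ⟨m, hm, h, -⟩)
    · exact h
    · exact absurd (hm.next h) hu
  · exact fun h => Or.inl ⟨h, hu⟩

theorem IsPathMax.exists_nextMax_eq {n : ℕ} {T : Digraph (Vtx n)} {u : Vtx n}
    (hu : IsPathMax T u) (hun : (u : ℕ) ≠ n) : ∃ m, IsPathMax T m ∧ NextMax T m u := by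
  obtain ⟨t, ht, h⟩ := hu
  rcases h.cases_tail with rfl | ⟨q, hq, hqu⟩
  · exact absurd ht hun
  · exact ⟨q, ⟨t, ht, hq⟩, hqu⟩

theorem isPathMax_of_eq {n : ℕ} {T : Digraph (Vtx n)} {u : Vtx n} (hu : (u : ℕ) = n) :
    IsPathMax T u := ⟨u, hu, .refl⟩

theorem exists_funGraph_eq_thetaInv {n : ℕ} (hn : 2 ≤ n) {T : Digraph (Vtx n)}
    (hT : T ∈ rootedTrees n) : ∃ f : FunClass n, funGraph f = thetaInv T := by
  refine exists_funGraph_eq ?_ ?_ ?_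
  · intro u v h
    have hu2 := Finset.mem_Icc.1 u.2
    rcases thetaInv_adj.1 h with ⟨h, hu⟩ | ⟨m, hm, hmu, -⟩
    · have hun : (u : ℕ) ≠ n := fun h => hu (isPathMax_of_eq h)
      have := rootedTrees_adj_bounds hT h
      omega
    · have h1 : (u : ℕ) < m := hm.lt_of_transGen hT hmu.1.2
      have h2 := hmu.1.1
      have := Finset.mem_Icc.1 m.2
      omega
  · intro u hu2 hun
    by_cases hu : IsPathMax T u
    · obtain ⟨m, hm, hmu⟩ := hu.exists_nextMax_eq (by omega)
      obtain ⟨v, hv, -⟩ := rootedTrees_existsUnique_adj hT (hm.ne_one hn)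
      exact ⟨v, (thetaInv_adj_of_nextMax hn hT hm hmu).2 hv⟩
    · obtain ⟨v, hv, -⟩ := rootedTrees_existsUnique_adj hT (u := u) (by omega)
      exact ⟨v, (thetaInv_adj_of_not_isPathMax hu).2 hv⟩
  · intro u v w hv hw
    by_cases hu : IsPathMax T u
    · have hun : (u : ℕ) ≠ n := by
        intro hun
        rcases thetaInv_adj.1 hv with ⟨h, hu'⟩ | ⟨m, hm, hmu, -⟩
        · exact hu' hu
        · have h1 : (u : ℕ) < m := hm.lt_of_transGen hT hmu.1.2
          have := Finset.mem_Icc.1 m.2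
          omega
      obtain ⟨m, hm, hmu⟩ := hu.exists_nextMax_eq hun
      rw [thetaInv_adj_of_nextMax hn hT hm hmu] at hv hw
      exact rootedTrees_rightUnique hT hv hw
    · rw [thetaInv_adj_of_not_isPathMax hu] at hv hw
      exact rootedTrees_rightUnique hT hv hw

/-- Let `x` be the vertex after `q`. The segment of the path from `x` to `p` is closed to a cycle by
the new arc `p → x`. Its other vertices keep their arcs: a path maximum among them would exceed `p`,
which follows it, but `p` is the largest vertex after `q`. -/
theorem isCycleMax_thetaInv_of_nextMax {n : ℕ} (hn : 2 ≤ n) {T : Digraph (Vtx n)}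
    (hT : T ∈ rootedTrees n) {q p : Vtx n} (hq : IsPathMax T q) (hqp : NextMax T q p) :
    IsCycleMax (thetaInv T) p := by
  obtain ⟨f, hf⟩ := exists_funGraph_eq_thetaInv hn hT
  have hru : Relator.RightUnique (thetaInv T).Adj := hf ▸ funGraph_rightUnique f
  obtain ⟨x, hx, hxp⟩ := TransGen.head'_iff.1 hqp.1.2
  have hpx : (thetaInv T).Adj p x := (thetaInv_adj_of_nextMax hn hT hq hqp).2 hx
  have hle : ∀ w, ReflTransGen T.Adj x w → ReflTransGen T.Adj w p → w ≤ p := by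
    intro w hw hwp
    by_cases hw1 : (w : ℕ) = 1
    · have hp2 := Finset.mem_Icc.1 p.2
      exact Subtype.mk_le_mk.2 (by omega)
    · exact hqp.2 ⟨hw1, TransGen.head' hx hw⟩
  have hstep : ∀ w w', ReflTransGen T.Adj x w → w ≠ p → ReflTransGen T.Adj w p → T.Adj w w' →
      (thetaInv T).Adj w w' := by
    intro w w' hxw hne hwp h
    refine (thetaInv_adj_of_not_isPathMax fun hw => ?_).2 h
    rcases reflTransGen_iff_eq_or_transGen.1 hwp with rfl | h'
    · exact hne rfl
    · exact absurd (hle w hxw hwp) (not_le.2 (hw.lt_of_transGen hT h'))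
  have hreach : ∀ w, ReflTransGen T.Adj x w → ReflTransGen T.Adj w p →
      ReflTransGen (thetaInv T).Adj w p := by
    intro w hxw hwp
    induction hwp using ReflTransGen.head_induction_on with
    | refl => exact .refl
    | @head a c h h' ih =>
      by_cases hap : a = p
      · rw [hap]
      · exact (ih (hxw.tail h)).head (hstep a c hxw hap (h'.head h) h)
  refine ⟨TransGen.head' hpx (hreach x .refl hxp), fun w hw hback => ?_⟩
  clear hback
  -- The segment from `x` to `p` is closed under the arcs of `thetaInv T`, so the whole cycle lies
  -- in it and `p` is its maximum.
  have hclosed : ReflTransGen T.Adj x w ∧ ReflTransGen T.Adj w p := by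
    induction hw with
    | single h =>
      rw [← hru hpx h]
      exact ⟨.refl, hxp⟩
    | @tail b c _ h ih =>
      by_cases hbp : b = p
      · subst hbp
        rw [← hru hpx h]
        exact ⟨.refl, hxp⟩
      · rcases ih.2.cases_head with h' | ⟨d, hd, hdp⟩
        · exact absurd h' hbp
        · have := hstep b d ih.1 hbp ih.2 hd
          rw [hru h this]
          exact ⟨ih.1.tail hd, hdp⟩
  exact hle w hclosed.1 hclosed.2

/-- For the converse, a cycle without path maxima would already be a cycle of the tree. A path
maximum on the cycle is not `n`, which has no outgoing arc in `thetaInv T`, so it is a cycle maximum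
by the preceding lemma, and a cycle has only one maximum. -/
theorem isCycleMax_thetaInv_iff {n : ℕ} (hn : 2 ≤ n) {T : Digraph (Vtx n)}
    (hT : T ∈ rootedTrees n) {p : Vtx n} :
    IsCycleMax (thetaInv T) p ↔ IsPathMax T p ∧ (p : ℕ) ≠ n := by
  obtain ⟨f, hf⟩ := exists_funGraph_eq_thetaInv hn hT
  constructor
  · intro hp
    have hpn : (p : ℕ) ≠ n := by
      rw [← hf] at hp
      exact hp.bounds.2.ne
    refine ⟨?_, hpn⟩
    have hex : ∃ w, ReflTransGen (thetaInv T).Adj p w ∧ IsPathMax T w := by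
      by_contra hno
      push Not at hno
      have : ∀ w, TransGen (thetaInv T).Adj p w → TransGen T.Adj p w := by
        intro w hw
        induction hw with
        | single h => exact .single ((thetaInv_adj_of_not_isPathMax (hno p .refl)).1 h)
        | tail h' h ih =>
          exact ih.tail ((thetaInv_adj_of_not_isPathMax (hno _ h'.to_reflTransGen)).1 h)
      exact rootedTrees_irrefl hT p (this p hp.1)
    obtain ⟨w, hpw, hw⟩ := hex
    rcases reflTransGen_iff_eq_or_transGen.1 hpw with rfl | hpw
    · exact hw
    · have hwn : (w : ℕ) ≠ n := by
        have h1 := transGen_back_of_periodic (hf ▸ funGraph_rightUnique f) hp.1 hpw.to_reflTransGen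
        obtain ⟨x, hx, -⟩ := TransGen.head'_iff.1 h1
        rw [← hf] at hx
        exact (funGraph_adj_mem hx).2.ne
      obtain ⟨m, hm, hmw⟩ := hw.exists_nextMax_eq hwn
      have hwc := isCycleMax_thetaInv_of_nextMax hn hT hm hmw
      rw [← hf] at hp hwc hpw
      rwa [← hp.eq_of_transGen hwc hpw]
  · rintro ⟨hp, hpn⟩
    obtain ⟨m, hm, hmp⟩ := hp.exists_nextMax_eq hpn
    exact isCycleMax_thetaInv_of_nextMax hn hT hm hmp

theorem theta_thetaInv {n : ℕ} (hn : 2 ≤ n) {T : Digraph (Vtx n)} (hT : T ∈ rootedTrees n) :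
    theta (thetaInv T) = T := by
  obtain ⟨f, hf⟩ := exists_funGraph_eq_thetaInv hn hT
  have hjump : ∀ u, IsJump (thetaInv T) u ↔ IsPathMax T u := by
    intro u
    rw [IsJump, isCycleMax_thetaInv_iff hn hT]
    constructor
    · rintro (h | h)
      · exact isPathMax_of_eq h
      · exact h.1
    · intro h
      by_cases hu : (u : ℕ) = n
      · exact Or.inl hu
      · exact Or.inr ⟨h, hu⟩
  have hlt : ∀ u m : Vtx n, m < u → (m : ℕ) ≠ n := by
    intro u m h
    have h1 : (m : ℕ) < u := h
    have := Finset.mem_Icc.1 u.2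
    omega
  have hprev : ∀ u, IsPathMax T u → ∀ m, IsPrevMax (thetaInv T) u m ↔ NextMax T u m := by
    intro u hu m
    rw [nextMax_iff_of_isPathMax hn hT hu, IsPrevMax]
    have : {m' | IsCycleMax (thetaInv T) m' ∧ m' < u} = {m | IsPathMax T m ∧ m < u} := by
      ext m'
      simp only [Set.mem_ofPred_eq, isCycleMax_thetaInv_iff hn hT]
      exact ⟨fun h => ⟨h.1.1, h.2⟩, fun h => ⟨⟨h.1, hlt _ _ h.2⟩, h.2⟩⟩
    rw [this]
  have hle : ∀ u v, (theta (thetaInv T)).Adj u v → T.Adj u v := by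
    intro u v h
    rcases theta_adj.1 h with ⟨h, hc⟩ | ⟨hj, ⟨m, hm, h⟩ | ⟨hno, hv⟩⟩
    · by_cases hu : IsPathMax T u
      · rw [isCycleMax_thetaInv_iff hn hT, not_and, not_not] at hc
        rw [← hf] at h
        have := funGraph_adj_mem h
        have := hc hu
        omega
      · exact (thetaInv_adj_of_not_isPathMax hu).1 h
    · rw [hjump] at hj
      exact (thetaInv_adj_of_nextMax hn hT hj ((hprev u hj m).1 hm)).1 h
    · rw [hjump] at hj
      obtain ⟨w, hw, -⟩ := rootedTrees_existsUnique_adj hT (hj.ne_one hn)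
      have hw1 : (w : ℕ) = 1 := by
        by_contra hw1
        obtain ⟨m, hm⟩ := exists_nextMax (.single hw) hw1
        have hmu := hj.lt_of_transGen hT hm.1.2
        exact hno m ((isCycleMax_thetaInv_iff hn hT).2 ⟨hj.next hm, hlt _ _ hmu⟩) hmu
      rwa [Subtype.ext (hv.trans hw1.symm)]
  -- One inclusion is enough, because on either side exactly one arc leaves each vertex other than
  -- `1`.
  refine Digraph.ext (funext fun u => funext fun v => propext ⟨hle u v, fun h => ?_⟩)
  have hu : (u : ℕ) ≠ 1 := by
    have := rootedTrees_adj_bounds hT h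
    omega
  rw [← hf] at hle ⊢
  obtain ⟨w, hw, -⟩ := theta_existsUnique_adj f hu
  rwa [rootedTrees_rightUnique hT h (hle u w hw)]

theorem bijOn_theta {n : ℕ} (hn : 2 ≤ n) :
    Set.BijOn (fun f : FunClass n => theta (funGraph f)) Set.univ (rootedTrees n) := by
  refine ⟨fun f _ => theta_mem_rootedTrees hn f, fun f _ g _ h => ?_, fun T hT => ?_⟩
  · have := congrArg thetaInv h
    simp only [thetaInv_theta hn] at this
    exact funGraph_injective n this
  · obtain ⟨f, hf⟩ := exists_funGraph_eq_thetaInv hn hT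
    exact ⟨f, trivial, by simp only [hf, theta_thetaInv hn hT]⟩

end CayleyRank

namespace CayleyRank
open Relation

/-! ### Degrees and ordered set partitions -/

/-- The arc that leaves `u` in `Θ(G)` ends where the arc that leaves `w` in `G` ends, the vertex `1`
being given a loop. -/
def Redirects {n : ℕ} (G : Digraph (Vtx n)) (u w : Vtx n) : Prop :=
  (¬ IsJump G u ∧ u = w) ∨ (IsJump G u ∧
    (IsPrevMax G u w ∨ ((∀ m, IsCycleMax G m → ¬ m < u) ∧ (w : ℕ) = 1)))

theorem exists_redirects {n : ℕ} (hn : 2 ≤ n) (G : Digraph (Vtx n)) (u : Vtx n) :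
    ∃ w, Redirects G u w := by
  by_cases hj : IsJump G u
  · by_cases hex : ∃ m, IsCycleMax G m ∧ m < u
    · obtain ⟨m, hm⟩ := exists_isGreatest_of_nonempty (s := {m' | IsCycleMax G m' ∧ m' < u}) hex
      exact ⟨m, Or.inr ⟨hj, Or.inl hm⟩⟩
    · exact ⟨⟨1, by simp; omega⟩, Or.inr ⟨hj, Or.inr ⟨fun m hm h => hex ⟨m, hm, h⟩, rfl⟩⟩⟩
  · exact ⟨u, Or.inl ⟨hj, rfl⟩⟩

theorem IsJump.isCycleMax_of_lt {n : ℕ} {G : Digraph (Vtx n)} {u v : Vtx n} (hu : IsJump G u)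
    (h : u < v) : IsCycleMax G u := by
  rcases hu with hu | hu
  · have h1 : (u : ℕ) < v := h
    have := Finset.mem_Icc.1 v.2
    omega
  · exact hu

/-- For jump vertices `u < u'`, the vertex `u` is itself a cycle maximum below `u'`, so `u'` is
redirected to `u` or higher, and `u` to something lower. The vertices that are no jump vertices stay
fixed, and no jump vertex is redirected to them. -/
theorem Redirects.injective {n : ℕ} {f : FunClass n} {u u' w : Vtx n}
    (hu : (u : ℕ) ≠ 1) (hu' : (u' : ℕ) ≠ 1) (h : Redirects (funGraph f) u w)
    (h' : Redirects (funGraph f) u' w) : u = u' := by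
  have hlt : ∀ u u', Redirects (funGraph f) u w → Redirects (funGraph f) u' w →
      IsJump (funGraph f) u → IsJump (funGraph f) u' → ¬ u < u' := by
    rintro u u' (h | ⟨-, h⟩) (h' | ⟨-, h'⟩) hj hj' hlt
    · exact h.1 hj
    · exact h.1 hj
    · exact h'.1 hj'
    · have hc := hj.isCycleMax_of_lt hlt
      rcases h' with h' | ⟨h', -⟩
      · rcases h with h | ⟨-, h⟩
        · exact absurd (h'.2 ⟨hc, hlt⟩) (not_le.2 h.1.2)
        · have := h'.1.1.bounds
          omega
      · exact h' u hc hlt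
  have hmix : ∀ u u' : Vtx n, (u : ℕ) ≠ 1 → Redirects (funGraph f) u w → Redirects (funGraph f) u' w →
      ¬ IsJump (funGraph f) u → IsJump (funGraph f) u' → False := by
    rintro u u' hu1 (⟨-, rfl⟩ | ⟨h, -⟩) (⟨h', -⟩ | ⟨-, h' | ⟨-, h'⟩⟩) hj hj'
    · exact h' hj'
    · exact hj (Or.inr h'.1.1)
    · exact hu1 h'
    all_goals exact hj h
  by_cases hj : IsJump (funGraph f) u <;> by_cases hj' : IsJump (funGraph f) u'
  · exact le_antisymm (not_lt.1 (hlt u' u h' h hj' hj)) (not_lt.1 (hlt u u' h h' hj hj'))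
  · exact (hmix u' u hu' h' h hj' hj).elim
  · exact (hmix u u' hu h h' hj hj').elim
  · rcases h with ⟨-, rfl⟩ | ⟨h, -⟩
    · rcases h' with ⟨-, rfl⟩ | ⟨h', -⟩
      · rfl
      · exact absurd h' hj'
    · exact absurd h hj

theorem theta_adj_iff_redirects {n : ℕ} {f : FunClass n} {u v : Vtx n} (hu : (u : ℕ) ≠ 1) :
    (theta (funGraph f)).Adj u v ↔ ∃ w, Redirects (funGraph f) u w ∧
      ((funGraph f).Adj w v ∨ ((w : ℕ) = 1 ∧ (v : ℕ) = 1)) := by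
  rw [theta_adj]
  constructor
  · rintro (⟨h, hc⟩ | ⟨hj, ⟨m, hm, h⟩ | ⟨h, hv⟩⟩)
    · refine ⟨u, Or.inl ⟨?_, rfl⟩, Or.inl h⟩
      rintro (hj | hj)
      · have := funGraph_adj_mem h
        omega
      · exact hc hj
    · exact ⟨m, Or.inr ⟨hj, Or.inl hm⟩, Or.inl h⟩
    · have hn := Finset.mem_Icc.1 v.2
      exact ⟨⟨1, by simp; omega⟩, Or.inr ⟨hj, Or.inr ⟨h, rfl⟩⟩, Or.inr ⟨rfl, hv⟩⟩
  · rintro ⟨w, ⟨hj, rfl⟩ | ⟨hj, hw | ⟨hno, hw1⟩⟩, h | ⟨h1, hv⟩⟩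
    · exact Or.inl ⟨h, fun h => hj (Or.inr h)⟩
    · exact absurd h1 hu
    · exact Or.inr ⟨hj, Or.inl ⟨w, hw, h⟩⟩
    · have := hw.1.1.bounds
      omega
    · have := funGraph_adj_mem h
      omega
    · exact Or.inr ⟨hj, Or.inr ⟨hno, hv⟩⟩

theorem exists_redirects_to {n : ℕ} (hn : 2 ≤ n) {f : FunClass n} {w : Vtx n} (hw : (w : ℕ) ≠ n) :
    ∃ u : Vtx n, (u : ℕ) ≠ 1 ∧ Redirects (funGraph f) u w := by
  by_cases hc : IsCycleMax (funGraph f) w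
  · obtain ⟨u, hwu, hj, h⟩ := hc.exists_isPrevMax
    have h1 : (w : ℕ) < u := hwu
    have := hc.bounds
    exact ⟨u, by omega, Or.inr ⟨hj, Or.inl h⟩⟩
  · by_cases hw1 : (w : ℕ) = 1
    · obtain ⟨u, hu, hmin⟩ := exists_isLeast_of_nonempty (s := {x | IsJump (funGraph f) x})
        ⟨⟨n, by simp; omega⟩, Or.inl rfl⟩
      refine ⟨u, ?_, Or.inr ⟨hu, Or.inr ⟨fun m hm hlt => ?_, hw1⟩⟩⟩
      · rcases hu with hu | hu
        · omega
        · have := hu.bounds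
          omega
      · exact absurd (hmin (Or.inr hm)) (not_le.2 hlt)
    · refine ⟨w, hw1, Or.inl ⟨?_, rfl⟩⟩
      rintro (h | h)
      · exact hw h
      · exact hc h

/-- Redirection is a bijection from the vertices other than `1` onto those other than `n`, and it
preserves the heads of arcs once `1` is given a loop. The loop accounts for the arc into `1` that
`theta` adds. -/
theorem theta_ncard_in {n : ℕ} (hn : 2 ≤ n) (f : FunClass n) (i : Vtx n) :
    {u | (theta (funGraph f)).Adj u i}.ncard =
      {u | (funGraph f).Adj u i ∨ ((u : ℕ) = 1 ∧ (i : ℕ) = 1)}.ncard := by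
  have hne : ∀ u, (theta (funGraph f)).Adj u i → (u : ℕ) ≠ 1 := fun u h => by
    have := rootedTrees_adj_bounds (theta_mem_rootedTrees hn f) h
    omega
  choose ψ hψ using exists_redirects hn (funGraph f)
  have huniq : ∀ u w : Vtx n, (u : ℕ) ≠ 1 → Redirects (funGraph f) u w → ψ u = w := by
    intro u w hu h
    rcases h with ⟨hj, rfl⟩ | ⟨hj, h⟩ <;> rcases hψ u with ⟨hj', h'⟩ | ⟨hj', h'⟩
    · exact h'.symm
    · exact absurd hj' hj
    · exact absurd hj hj'
    · rcases h with h | ⟨h, hw⟩ <;> rcases h' with h' | ⟨h', hw'⟩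
      · exact h'.unique h
      · exact absurd h.1.2 (h' w h.1.1)
      · exact absurd h'.1.2 (h _ h'.1.1)
      · exact Subtype.ext (hw'.trans hw.symm)
  refine Set.ncard_congr (fun u _ => ψ u) ?_ ?_ ?_
  · intro u hu
    obtain ⟨w, hw, h⟩ := (theta_adj_iff_redirects (hne u hu)).1 hu
    rw [huniq u w (hne u hu) hw]
    exact h
  · intro u v hu hv h
    exact Redirects.injective (hne u hu) (hne v hv) (hψ u) (h ▸ hψ v)
  · intro w hw
    have hwn : (w : ℕ) ≠ n := by
      rcases hw with hw | hw
      · have := funGraph_adj_mem hw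
        omega
      · omega
    obtain ⟨u, hu, h⟩ := exists_redirects_to (f := f) hn hwn
    exact ⟨u, (theta_adj_iff_redirects hu).2 ⟨w, h, hw⟩, huniq u w hu h⟩

/-- The extra unit is the outgoing arc if `i` is not the root. The root has no outgoing arc, but its
in-degree has grown by one. -/
theorem theta_degree {n : ℕ} (hn : 2 ≤ n) (f : FunClass n) (i : Vtx n) :
    ((underlying (theta (funGraph f))).neighborSet i).ncard =
      {u | (funGraph f).Adj u i}.ncard + 1 := by
  have hT := theta_mem_rootedTrees hn f
  have hne : ∀ u v, (theta (funGraph f)).Adj u v → u ≠ v := by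
    rintro u v h rfl
    exact rootedTrees_irrefl hT u (.single h)
  have hset : (underlying (theta (funGraph f))).neighborSet i =
      {u | (theta (funGraph f)).Adj u i} ∪ {v | (theta (funGraph f)).Adj i v} := by
    ext v
    rw [SimpleGraph.mem_neighborSet, underlying, SimpleGraph.fromRel_adj]
    constructor
    · rintro ⟨-, h | h⟩
      · exact Or.inr h
      · exact Or.inl h
    · rintro (h | h)
      · exact ⟨(hne _ _ h).symm, Or.inr h⟩
      · exact ⟨hne _ _ h, Or.inl h⟩
  have hdisj : Disjoint {u | (theta (funGraph f)).Adj u i} {v | (theta (funGraph f)).Adj i v} :=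
    Set.disjoint_left.2 fun v h h' =>
      rootedTrees_irrefl hT v (TransGen.tail (b := i) (.single h) h')
  rw [hset, Set.ncard_union_eq hdisj, theta_ncard_in hn]
  by_cases hi : (i : ℕ) = 1
  · have h0 : {v | (theta (funGraph f)).Adj i v} = ∅ := by
      refine Set.eq_empty_of_forall_notMem fun v h => ?_
      have := rootedTrees_adj_bounds hT h
      omega
    have h1 : {u | (funGraph f).Adj u i ∨ ((u : ℕ) = 1 ∧ (i : ℕ) = 1)} =
        insert i {u | (funGraph f).Adj u i} := by
      ext u
      simp only [Set.mem_ofPred_eq, Set.mem_insert_iff]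
      constructor
      · rintro (h | h)
        · exact Or.inr h
        · exact Or.inl (Subtype.ext (h.1.trans hi.symm))
      · rintro (rfl | h)
        · exact Or.inr ⟨hi, hi⟩
        · exact Or.inl h
    rw [h0, h1, Set.ncard_insert_of_notMem, Set.ncard_empty]
    intro h
    have := funGraph_adj_mem (show (funGraph f).Adj i i from h)
    omega
  · have h1 : {u | (funGraph f).Adj u i ∨ ((u : ℕ) = 1 ∧ (i : ℕ) = 1)} =
        {u | (funGraph f).Adj u i} := by
      ext u
      simp [hi]
    obtain ⟨v, hv, hv'⟩ := rootedTrees_existsUnique_adj hT hi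
    have h2 : {v | (theta (funGraph f)).Adj i v} = {v} := by
      ext w
      exact ⟨fun h => hv' w h, fun h => by rw [Set.mem_singleton_iff.1 h]; exact hv⟩
    rw [h1, h2, Set.ncard_singleton]

/-! ### Trees with given degrees and the fibres of their functions -/

theorem coe_mem_treePartition {n : ℕ} {T : Digraph (Vtx n)} {u i : Vtx n} :
    (u : ℕ) ∈ treePartition T i ↔ (thetaInv T).Adj u i := by
  simp [treePartition]

theorem partitionGraph_treePartition {n : ℕ} (T : Digraph (Vtx n)) :
    partitionGraph (treePartition T) = thetaInv T :=
  Digraph.ext (funext fun _ => funext fun _ => propext coe_mem_treePartition)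

theorem card_treePartition {n : ℕ} (T : Digraph (Vtx n)) (i : Vtx n) :
    (treePartition T i).card = {u | (thetaInv T).Adj u i}.ncard := by
  classical
  rw [treePartition, Finset.card_image_of_injective _ Subtype.val_injective,
    ← Set.ncard_coe_finset]
  simp

theorem mem_treePartition_bounds {n : ℕ} {T : Digraph (Vtx n)} {x : ℕ} {i : Vtx n}
    (h : x ∈ treePartition T i) : x ∈ Finset.Icc 1 n := by
  simp only [treePartition, Finset.mem_image] at h
  obtain ⟨v, -, rfl⟩ := h
  exact v.2

theorem treePartition_theta {n : ℕ} (hn : 2 ≤ n) {f : FunClass n} {p : Vtx n → Finset ℕ}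
    (hp : partitionGraph p = funGraph f) (hb : ∀ i, p i ⊆ Finset.Icc 1 n) :
    treePartition (theta (funGraph f)) = p := by
  funext i
  ext x
  constructor
  · intro h
    have hx := mem_treePartition_bounds h
    have h2 := (coe_mem_treePartition (u := ⟨x, hx⟩)).1 h
    rw [thetaInv_theta hn, ← hp] at h2
    exact h2
  · intro h
    have hx := hb i h
    refine (coe_mem_treePartition (u := ⟨x, hx⟩)).2 ?_
    rw [thetaInv_theta hn, ← hp]
    exact h

theorem exists_funGraph_eq_partitionGraph {n : ℕ} {s : Vtx n → ℕ} {p : Vtx n → Finset ℕ}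
    (hp : p ∈ setPartitions s) : ∃ f : FunClass n, funGraph f = partitionGraph p := by
  obtain ⟨hdisj, hun, -⟩ := hp
  have hmem : ∀ x, x ∈ Finset.Ico 2 n ↔ ∃ i, x ∈ p i := fun x => by
    rw [← hun]
    simp
  refine exists_funGraph_eq ?_ ?_ ?_
  · intro u v h
    simpa using (hmem u).2 ⟨v, h⟩
  · intro u h1 h2
    exact (hmem u).1 (by simp [h1, h2])
  · intro u v w hv hw
    by_contra hne
    exact Finset.disjoint_left.1 (hdisj hne) hv hw

theorem theta_partitionGraph_mem {n : ℕ} (hn : 2 ≤ n) {s : Vtx n → ℕ} {p : Vtx n → Finset ℕ}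
    (hp : p ∈ setPartitions s) : theta (partitionGraph p) ∈ treesWithDegrees s ∧
      treePartition (theta (partitionGraph p)) = p := by
  obtain ⟨f, hf⟩ := exists_funGraph_eq_partitionGraph hp
  have hb : ∀ i, p i ⊆ Finset.Icc 1 n := by
    intro i x hx
    have : x ∈ Finset.Ico 2 n := by
      rw [← hp.2.1]
      exact Finset.mem_biUnion.2 ⟨i, Finset.mem_univ i, hx⟩
    simp at this ⊢
    omega
  have h := treePartition_theta hn hf.symm hb
  rw [← hf]
  refine ⟨⟨theta_mem_rootedTrees hn f, fun i => ?_⟩, h⟩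
  rw [theta_degree hn, ← hp.2.2 i, ← h, card_treePartition, thetaInv_theta hn]

theorem treePartition_mem {n : ℕ} (hn : 2 ≤ n) {s : Vtx n → ℕ} {T : Digraph (Vtx n)}
    (hT : T ∈ treesWithDegrees s) : treePartition T ∈ setPartitions s := by
  obtain ⟨f, hf⟩ := exists_funGraph_eq_thetaInv hn hT.1
  refine ⟨fun i j hij => Finset.disjoint_left.2 fun x hx hx' => hij ?_, ?_, fun i => ?_⟩
  · have hb := mem_treePartition_bounds hx
    have h1 := (coe_mem_treePartition (u := ⟨x, hb⟩)).1 hx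
    have h2 := (coe_mem_treePartition (u := ⟨x, hb⟩)).1 hx'
    rw [← hf] at h1 h2
    exact funGraph_rightUnique f h1 h2
  · ext x
    simp only [Finset.mem_biUnion, Finset.mem_univ, true_and]
    constructor
    · rintro ⟨i, hx⟩
      have hb := mem_treePartition_bounds hx
      have h1 := (coe_mem_treePartition (u := ⟨x, hb⟩)).1 hx
      rw [← hf] at h1
      exact h1.1
    · intro hx
      have hb : x ∈ Finset.Icc 1 n := by simp at hx ⊢; omega
      refine ⟨f ⟨x, hx⟩, (coe_mem_treePartition (u := ⟨x, hb⟩)).2 ?_⟩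
      rw [← hf]
      exact ⟨hx, rfl⟩
  · rw [card_treePartition, ← hT.2 i, ← theta_thetaInv hn hT.1, ← hf, theta_degree hn,
      thetaInv_theta hn]

theorem theta_partitionGraph_treePartition {n : ℕ} (hn : 2 ≤ n) {s : Vtx n → ℕ}
    {T : Digraph (Vtx n)} (hT : T ∈ treesWithDegrees s) :
    theta (partitionGraph (treePartition T)) = T := by
  rw [partitionGraph_treePartition, theta_thetaInv hn hT.1]

theorem bijOn_treePartition {n : ℕ} (hn : 2 ≤ n) (s : Vtx n → ℕ) :
    Set.BijOn treePartition (treesWithDegrees s) (setPartitions s) :=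
  Set.InvOn.bijOn (f' := fun p => theta (partitionGraph p))
    ⟨fun _ hT => theta_partitionGraph_treePartition hn hT,
      fun _ hp => (theta_partitionGraph_mem hn hp).2⟩
    (fun _ hT => treePartition_mem hn hT) (fun _ hp => (theta_partitionGraph_mem hn hp).1)

end CayleyRank

namespace CayleyRank

/-! ### Ranks in a finite set -/

theorem rankIn_lt {D : Finset ℕ} {x y : ℕ} (hy : y ∈ D) (h : x < y) : rankIn D x < rankIn D y :=
  Finset.card_lt_card ⟨fun z hz => by simp at hz ⊢; exact ⟨hz.1, hz.2.trans h.le⟩,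
    fun hs => by
      have := hs (Finset.mem_filter.2 ⟨hy, le_rfl⟩)
      simp at this
      omega⟩

theorem rankIn_lt_iff {D : Finset ℕ} {x y : ℕ} (hx : x ∈ D) (hy : y ∈ D) :
    rankIn D x < rankIn D y ↔ x < y := by
  refine ⟨fun h => ?_, rankIn_lt hy⟩
  rcases lt_trichotomy x y with h' | rfl | h'
  · exact h'
  · exact absurd h (lt_irrefl _)
  · exact absurd (rankIn_lt hx h') (lt_asymm h)

theorem rankIn_injOn (D : Finset ℕ) : Set.InjOn (rankIn D) D := by
  intro x hx y hy h
  rcases lt_trichotomy x y with h' | h' | h'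
  · exact absurd h (rankIn_lt hy h').ne
  · exact h'
  · exact absurd h (rankIn_lt hx h').ne'

theorem rankIn_le_card (D : Finset ℕ) (x : ℕ) : rankIn D x ≤ D.card :=
  Finset.card_le_card (Finset.filter_subset _ _)

theorem rankIn_pos {D : Finset ℕ} {x : ℕ} (hx : x ∈ D) : 1 ≤ rankIn D x :=
  Finset.card_pos.2 ⟨x, by simp [hx]⟩

theorem exists_rankIn_eq {D : Finset ℕ} {r : ℕ} (h1 : 1 ≤ r) (h2 : r ≤ D.card) :
    ∃ x ∈ D, rankIn D x = r := by
  have hsub : D.image (rankIn D) ⊆ Finset.Icc 1 D.card := by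
    intro r hr
    obtain ⟨x, hx, rfl⟩ := Finset.mem_image.1 hr
    exact Finset.mem_Icc.2 ⟨rankIn_pos hx, rankIn_le_card D x⟩
  have heq := Finset.eq_of_subset_of_card_le hsub
    (by rw [Finset.card_image_of_injOn (rankIn_injOn D)]; simp)
  have : r ∈ D.image (rankIn D) := by
    rw [heq]
    exact Finset.mem_Icc.2 ⟨h1, h2⟩
  simpa using this

theorem mem_rankSeq_iff {D B : Finset ℕ} (hB : B ⊆ D) {x : ℕ} (hx : x ∈ D) :
    rankIn D x ∈ (B.sort (· ≥ ·)).map (rankIn D) ↔ x ∈ B := by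
  simp only [List.mem_map, Finset.mem_sort]
  constructor
  · rintro ⟨y, hy, h⟩
    rwa [← rankIn_injOn D (hB hy) hx h]
  · exact fun h => ⟨x, h, rfl⟩

theorem rankSeq_mem_decFun {D B : Finset ℕ} (hB : B ⊆ D) :
    (B.sort (· ≥ ·)).map (rankIn D) ∈ decFun D.card B.card := by
  refine ⟨by simp, ?_, ?_⟩
  · rw [List.pairwise_map]
    refine List.Pairwise.imp_of_mem ?_ (Finset.sortedGT_sort B).pairwise
    intro a b ha _ hab
    exact rankIn_lt (hB ((Finset.mem_sort _).1 ha)) hab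
  · intro r hr
    obtain ⟨x, hx, rfl⟩ := List.mem_map.1 hr
    exact ⟨rankIn_pos (hB ((Finset.mem_sort _).1 hx)), rankIn_le_card D x⟩

/-- Both lists are strictly decreasing and have the same entries, because every number from `1` to
`|D|` is the rank of an element. -/
theorem rankSeq_filter {D : Finset ℕ} {b : ℕ} {l : List ℕ} (hl : l ∈ decFun D.card b) :
    ((D.filter fun x => rankIn D x ∈ l).sort (· ≥ ·)).map (rankIn D) = l := by
  refine List.Pairwise.eq_of_mem_iff (rankSeq_mem_decFun (Finset.filter_subset _ D)).2.1 hl.2.1 ?_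
  intro r
  simp only [List.mem_map, Finset.mem_sort, Finset.mem_filter]
  constructor
  · rintro ⟨x, hx, rfl⟩
    exact hx.2
  · intro hr
    obtain ⟨x, hx, rfl⟩ := exists_rankIn_eq (hl.2.2 r hr).1 (hl.2.2 r hr).2
    exact ⟨x, ⟨hx, hr⟩, rfl⟩

theorem card_filter_rankIn {D : Finset ℕ} {b : ℕ} {l : List ℕ} (hl : l ∈ decFun D.card b) :
    (D.filter fun x => rankIn D x ∈ l).card = b := by
  have := congrArg List.length (rankSeq_filter hl)
  simpa [hl.1] using this

/-! ### Codes of lists of blocks -/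

theorem encodeBlocks_mem (Bs : List (Finset ℕ)) : ∀ D : Finset ℕ, (∀ B ∈ Bs, B ⊆ D) →
    Bs.Pairwise Disjoint →
    encodeBlocks D Bs ∈ decFunProd (shapeOfSizes D.card (Bs.map Finset.card)) := by
  induction Bs with
  | nil => intro D _ _; rfl
  | cons B Bs ih =>
    intro D hD hdisj
    rw [List.pairwise_cons] at hdisj
    have hB := hD B (by simp)
    refine ⟨_, rankSeq_mem_decFun hB, _, ?_, rfl⟩
    rw [← Finset.card_sdiff_of_subset hB]
    refine ih (D \ B) (fun C hC x hx => ?_) hdisj.2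
    exact Finset.mem_sdiff.2 ⟨hD C (by simp [hC]) hx,
      fun h => Finset.disjoint_left.1 (hdisj.1 C hC) h hx⟩

theorem decodeBlocks_encodeBlocks (Bs : List (Finset ℕ)) : ∀ D : Finset ℕ, (∀ B ∈ Bs, B ⊆ D) →
    Bs.Pairwise Disjoint → decodeBlocks D (Bs.map Finset.card) (encodeBlocks D Bs) = Bs := by
  induction Bs with
  | nil => intro D _ _; rfl
  | cons B Bs ih =>
    intro D hD hdisj
    rw [List.pairwise_cons] at hdisj
    have hB := hD B (by simp)
    have hlen : ((B.sort (· ≥ ·)).map (rankIn D)).length = B.card := by simp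
    have hfilter : (D.filter fun x => rankIn D x ∈ (B.sort (· ≥ ·)).map (rankIn D)) = B := by
      ext x
      rw [Finset.mem_filter]
      exact ⟨fun h => (mem_rankSeq_iff hB h.1).1 h.2,
        fun h => ⟨hB h, (mem_rankSeq_iff hB (hB h)).2 h⟩⟩
    simp only [encodeBlocks, List.map_cons, decodeBlocks]
    rw [List.take_left' hlen, List.drop_left' hlen, hfilter, ih (D \ B) _ hdisj.2]
    intro C hC x hx
    exact Finset.mem_sdiff.2 ⟨hD C (by simp [hC]) hx,
      fun h => Finset.disjoint_left.1 (hdisj.1 C hC) h hx⟩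

/-- The first `b` ranks select exactly `b` elements of `D`, so what remains has the size for which
the rest of the word was made, and the induction hypothesis applies to it. -/
theorem decodeBlocks_spec (bs : List ℕ) : ∀ (D : Finset ℕ) (w : List ℕ),
    w ∈ decFunProd (shapeOfSizes D.card bs) →
    (decodeBlocks D bs w).map Finset.card = bs ∧ (∀ B ∈ decodeBlocks D bs w, B ⊆ D) ∧
      (decodeBlocks D bs w).Pairwise Disjoint ∧ encodeBlocks D (decodeBlocks D bs w) = w := by
  induction bs with
  | nil =>
    rintro D w rfl
    simp [decodeBlocks, encodeBlocks]
  | cons b bs ih =>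
    rintro D _ ⟨l, hl, w, hw, rfl⟩
    simp only [decodeBlocks]
    rw [List.take_left' hl.1, List.drop_left' hl.1]
    set B := D.filter fun x => rankIn D x ∈ l with hBdef
    have hB : B ⊆ D := Finset.filter_subset _ _
    have hcard : B.card = b := card_filter_rankIn hl
    have hD : (D \ B).card = D.card - b := by rw [Finset.card_sdiff_of_subset hB, hcard]
    rw [← hD] at hw
    obtain ⟨h1, h2, h3, h4⟩ := ih _ _ hw
    refine ⟨by simp [h1, hcard], ?_, ?_, ?_⟩
    · intro C hC
      rcases List.mem_cons.1 hC with rfl | hC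
      · exact hB
      · exact (h2 C hC).trans Finset.sdiff_subset
    · refine List.pairwise_cons.2 ⟨fun C hC => ?_, h3⟩
      exact Finset.disjoint_left.2 fun x hx hx' => (Finset.mem_sdiff.1 (h2 C hC hx')).2 hx
    · rw [encodeBlocks, h4, hBdef, rankSeq_filter hl]

/-! ### The code of an ordered set partition -/

theorem mem_blockOrder {n : ℕ} {s : Vtx n → ℕ} {v : Vtx n} : v ∈ blockOrder s ↔ 1 < s v := by
  simp only [blockOrder, List.mem_map, Finset.mem_sort, Finset.mem_image, Finset.mem_filter,
    Finset.mem_univ, true_and]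
  constructor
  · rintro ⟨_, ⟨w, hw, rfl⟩, rfl⟩
    exact hw
  · exact fun h => ⟨_, ⟨v, h, rfl⟩, rfl⟩

theorem nodup_blockOrder {n : ℕ} (s : Vtx n → ℕ) : (blockOrder s).Nodup := by
  refine List.Nodup.map_on ?_ (Finset.sort_nodup _ _)
  intro x hx y hy h
  simp only [Finset.mem_sort, Finset.mem_image, Finset.mem_filter, Finset.mem_univ,
    true_and] at hx hy
  obtain ⟨v, -, rfl⟩ := hx
  obtain ⟨w, -, rfl⟩ := hy
  simp only [ofLex_toLex] at h
  rw [h]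

theorem map_lookup_zip {α β : Type*} [BEq α] [LawfulBEq α] (d : β) (l : List α) :
    ∀ Bs : List β, l.Nodup → l.length = Bs.length →
      l.map (fun i => ((l.zip Bs).lookup i).getD d) = Bs := by
  induction l with
  | nil => intro Bs _ h; simpa [eq_comm] using h
  | cons a l ih =>
    rintro (_ | ⟨B, Bs⟩) hnd hlen
    · simp at hlen
    · rw [List.nodup_cons] at hnd
      simp only [List.zip_cons_cons, List.map_cons, List.lookup_cons_self, Option.getD_some,
        List.cons.injEq, true_and]
      rw [← ih Bs hnd.2 (by simpa using hlen)]
      refine List.map_congr_left fun i hi => ?_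
      have hne : (i == a) = false := by
        rw [beq_eq_false_iff_ne]
        rintro rfl
        exact hnd.1 hi
      rw [ih Bs hnd.2 (by simpa using hlen), List.lookup_cons, hne]

theorem lookup_zip_eq_none {α β : Type*} [BEq α] [LawfulBEq α] {l : List α} {Bs : List β} {i : α}
    (hi : i ∉ l) : (l.zip Bs).lookup i = none := by
  rw [List.lookup_eq_none_iff]
  rintro ⟨a, b⟩ h
  simp only [bne_iff_ne, ne_eq]
  rintro rfl
  exact hi (List.of_mem_zip h).1

theorem sizes_eq_map_card {n : ℕ} {s : Vtx n → ℕ} {p : Vtx n → Finset ℕ}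
    (hp : ∀ k, (p k).card + 1 = s k) :
    (blockOrder s).map (fun v => s v - 1) = ((blockOrder s).map p).map Finset.card := by
  rw [List.map_map]
  refine List.map_congr_left fun v _ => ?_
  simp [← hp v]

theorem eq_empty_of_notMem_blockOrder {n : ℕ} {s : Vtx n → ℕ} {p : Vtx n → Finset ℕ}
    (hp : ∀ k, (p k).card + 1 = s k) {v : Vtx n} (hv : v ∉ blockOrder s) : p v = ∅ := by
  rw [mem_blockOrder] at hv
  have := hp v
  exact Finset.card_eq_zero.1 (by omega)

theorem setPartitions_blocks {n : ℕ} {s : Vtx n → ℕ} {p : Vtx n → Finset ℕ}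
    (hp : p ∈ setPartitions s) : (∀ B ∈ (blockOrder s).map p, B ⊆ Finset.Ico 2 n) ∧
      ((blockOrder s).map p).Pairwise Disjoint := by
  constructor
  · intro B hB
    obtain ⟨v, -, rfl⟩ := List.mem_map.1 hB
    rw [← hp.2.1]
    exact Finset.subset_biUnion_of_mem p (Finset.mem_univ v)
  · rw [List.pairwise_map]
    exact (nodup_blockOrder s).imp fun h => hp.1 h

theorem encode_mem {n : ℕ} {s : Vtx n → ℕ} {p : Vtx n → Finset ℕ} (hp : p ∈ setPartitions s) :
    encode s p ∈ decFunProd (shape s) := by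
  have := encodeBlocks_mem _ _ (setPartitions_blocks hp).1 (setPartitions_blocks hp).2
  rwa [← sizes_eq_map_card hp.2.2, Nat.card_Ico] at this

theorem decode_encode {n : ℕ} {s : Vtx n → ℕ} {p : Vtx n → Finset ℕ} (hp : p ∈ setPartitions s) :
    decode s (encode s p) = p := by
  have h := decodeBlocks_encodeBlocks _ _ (setPartitions_blocks hp).1 (setPartitions_blocks hp).2
  rw [← sizes_eq_map_card hp.2.2] at h
  funext i
  rw [decode, encode, h]
  by_cases hi : i ∈ blockOrder s
  · have := map_lookup_zip (∅ : Finset ℕ) (blockOrder s) ((blockOrder s).map p)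
      (nodup_blockOrder s) (by simp)
    rw [List.map_inj_left] at this
    exact this i hi
  · rw [lookup_zip_eq_none hi, eq_empty_of_notMem_blockOrder hp.2.2 hi]
    rfl

theorem map_decode {n : ℕ} {s : Vtx n → ℕ} {w : List ℕ} (hw : w ∈ decFunProd (shape s)) :
    (blockOrder s).map (decode s w) = decodeBlocks (Finset.Ico 2 n)
      ((blockOrder s).map fun v => s v - 1) w := by
  rw [shape, ← Nat.card_Ico] at hw
  have h := (decodeBlocks_spec _ _ _ hw).1
  exact map_lookup_zip (∅ : Finset ℕ) _ _ (nodup_blockOrder s)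
    (by simpa using (congrArg List.length h).symm)

theorem decode_of_notMem {n : ℕ} {s : Vtx n → ℕ} {w : List ℕ} {v : Vtx n}
    (hv : v ∉ blockOrder s) : decode s w v = ∅ := by
  rw [decode, lookup_zip_eq_none hv]
  rfl

theorem encode_decode {n : ℕ} {s : Vtx n → ℕ} {w : List ℕ} (hw : w ∈ decFunProd (shape s)) :
    encode s (decode s w) = w := by
  rw [encode, map_decode hw]
  rw [shape, ← Nat.card_Ico] at hw
  exact (decodeBlocks_spec _ _ _ hw).2.2.2

theorem decode_mem {n : ℕ} {s : Vtx n → ℕ} (h1 : ∀ i, 1 ≤ s i) (h2 : ∑ i, s i + 2 = 2 * n)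
    {w : List ℕ} (hw : w ∈ decFunProd (shape s)) : decode s w ∈ setPartitions s := by
  have hmap := map_decode hw
  rw [shape, ← Nat.card_Ico] at hw
  obtain ⟨hc, hs, hd, -⟩ := decodeBlocks_spec _ _ _ hw
  rw [← hmap] at hc hs hd
  have hcard : ∀ k, (decode s w k).card + 1 = s k := by
    intro k
    by_cases hk : k ∈ blockOrder s
    · rw [List.map_map, List.map_inj_left] at hc
      have := hc k hk
      have := h1 k
      simp only [Function.comp_apply] at *
      omega
    · rw [decode_of_notMem hk]
      rw [mem_blockOrder] at hk
      have := h1 k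
      simp only [Finset.card_empty]
      omega
  have hdisj : Pairwise fun i j => Disjoint (decode s w i) (decode s w j) := by
    intro i j hij
    by_cases hi : i ∈ blockOrder s
    · by_cases hj : j ∈ blockOrder s
      · rw [List.pairwise_map] at hd
        have : Std.Symm fun a b => Disjoint (decode s w a) (decode s w b) := ⟨fun _ _ h => h.symm⟩
        exact List.Pairwise.forall hd hi hj hij
      · rw [decode_of_notMem hj]
        exact Finset.disjoint_empty_right _
    · rw [decode_of_notMem hi]
      exact Finset.disjoint_empty_left _
  refine ⟨hdisj, ?_, hcard⟩
  refine Finset.eq_of_subset_of_card_le (Finset.biUnion_subset.2 fun i _ => ?_) ?_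
  · by_cases hi : i ∈ blockOrder s
    · exact hs _ (List.mem_map_of_mem hi)
    · rw [decode_of_notMem hi]
      exact Finset.empty_subset _
  -- This is where the sum of the degrees enters: disjoint blocks with `n - 2` elements in all must
  -- exhaust `{2, …, n-1}`.
  · rw [Finset.card_biUnion fun i _ j _ hij => hdisj hij, Nat.card_Ico]
    have : ∑ i, s i = ∑ i, (decode s w i).card + n := by
      rw [Finset.sum_congr rfl fun i _ => (hcard i).symm, Finset.sum_add_distrib]
      simp
    omega

theorem bijOn_encode {n : ℕ} {s : Vtx n → ℕ} (h1 : ∀ i, 1 ≤ s i) (h2 : ∑ i, s i + 2 = 2 * n) :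
    Set.BijOn (encode s) (setPartitions s) (decFunProd (shape s)) :=
  Set.InvOn.bijOn (f' := decode s) ⟨fun _ hp => decode_encode hp, fun _ hw => encode_decode hw⟩
    (fun _ hp => encode_mem hp) (fun _ hw => decode_mem h1 h2 hw)

end CayleyRank

namespace CayleyRank

/-! ### Lexicographic ranks -/

theorem cons_mem_decFun {a b x : ℕ} {xs : List ℕ} (h : x :: xs ∈ decFun a b) :
    b = xs.length + 1 ∧ 1 ≤ x ∧ x ≤ a ∧ xs ∈ decFun (x - 1) xs.length := by
  obtain ⟨h1, h2, h3⟩ := h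
  rw [List.pairwise_cons] at h2
  have hx := h3 x (by simp)
  refine ⟨h1.symm, hx.1, hx.2, rfl, h2.2, fun y hy => ?_⟩
  have := h2.1 y hy
  have := h3 y (by simp [hy])
  omega

theorem choose_pred_add {x k : ℕ} (hx : 1 ≤ x) :
    (x - 1).choose (k + 1) + (x - 1).choose k = x.choose (k + 1) := by
  obtain ⟨y, rfl⟩ := Nat.exists_eq_add_of_le' hx
  rw [Nat.choose_succ_succ, Nat.add_sub_cancel, add_comm]

/-- By induction the tail contributes less than `C(x-1, k)`, so with Pascal's rule the sum is below
`C(x, k+1)`, which is at most `C(a, b)`. -/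
theorem decFunFormula_lt {l : List ℕ} : ∀ {a b : ℕ}, l ∈ decFun a b →
    decFunFormula l < a.choose b := by
  induction l with
  | nil =>
    rintro a b ⟨rfl, -, -⟩
    simp [decFunFormula]
  | cons x xs ih =>
    intro a b h
    obtain ⟨rfl, h1, h2, h3⟩ := cons_mem_decFun h
    have := ih h3
    have := choose_pred_add (k := xs.length) h1
    have := Nat.choose_le_choose (xs.length + 1) h2
    rw [decFunFormula]
    omega

/-- If the first entries satisfy `x < y`, the entire value of the smaller sequence is below `C(x,
k+1)`, and this is at most the first summand `C(y-1, k+1)` of the larger one. Otherwise the tails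
decide. -/
theorem decFunFormula_lt_of_lt {l : List ℕ} : ∀ {a b : ℕ} {l' : List ℕ}, l ∈ decFun a b →
    l' ∈ decFun a b → l < l' → decFunFormula l < decFunFormula l' := by
  induction l with
  | nil =>
    rintro a b l' ⟨rfl, -, -⟩ ⟨h, -, -⟩ hlt
    simp only [List.length_nil, List.length_eq_zero_iff] at h
    subst h
    exact absurd hlt (List.lt_irrefl _)
  | cons x xs ih =>
    rintro a b (_ | ⟨y, ys⟩) h h' hlt
    · exact absurd hlt (List.not_lt_nil _)
    · obtain ⟨rfl, h1, h2, h3⟩ := cons_mem_decFun h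
      obtain ⟨hb, h1', h2', h3'⟩ := cons_mem_decFun h'
      have hlen : xs.length = ys.length := by omega
      rcases List.cons_lt_cons_iff.1 hlt with hxy | ⟨rfl, htail⟩
      · have := decFunFormula_lt h3
        have := choose_pred_add (k := xs.length) h1
        have := Nat.choose_le_choose (xs.length + 1) (show x ≤ y - 1 by omega)
        rw [decFunFormula, decFunFormula, ← hlen]
        omega
      · rw [← hlen] at h3'
        have := ih h3 h3' htail
        rw [decFunFormula, decFunFormula, ← hlen]
        omega

theorem append_lt_append_iff {l : List ℕ} : ∀ {l' w w' : List ℕ}, l.length = l'.length →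
    (l ++ w < l' ++ w' ↔ l < l' ∨ l = l' ∧ w < w') := by
  induction l with
  | nil =>
    intro l' w w' h
    obtain rfl : l' = [] := by simpa [eq_comm] using h
    simp
  | cons x xs ih =>
    rintro (_ | ⟨y, ys⟩) w w' h
    · simp at h
    · simp only [List.cons_append, List.cons_lt_cons_iff, ih (by simpa using h), List.cons.injEq]
      tauto

theorem decFunProdFormula_append {a b : ℕ} {ps : List (ℕ × ℕ)} {l w : List ℕ}
    (hl : l.length = b) : decFunProdFormula ((a, b) :: ps) (l ++ w) =
      decFunFormula l * chooseProd ps + decFunProdFormula ps w := by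
  rw [decFunProdFormula, List.take_left' hl, List.drop_left' hl]

theorem chooseProd_cons (a b : ℕ) (ps : List (ℕ × ℕ)) :
    chooseProd ((a, b) :: ps) = a.choose b * chooseProd ps := by
  simp [chooseProd]

theorem decFunProdFormula_lt (ps : List (ℕ × ℕ)) : ∀ {w : List ℕ}, w ∈ decFunProd ps →
    decFunProdFormula ps w < chooseProd ps := by
  induction ps with
  | nil => intro w _; simp [decFunProdFormula, chooseProd]
  | cons q ps ih =>
    obtain ⟨a, b⟩ := q
    rintro _ ⟨l, hl, w, hw, rfl⟩
    rw [decFunProdFormula_append hl.1, chooseProd_cons]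
    have h1 := decFunFormula_lt hl
    have h2 := ih hw
    calc _ < decFunFormula l * chooseProd ps + chooseProd ps := by omega
      _ = (decFunFormula l + 1) * chooseProd ps := by ring
      _ ≤ _ := Nat.mul_le_mul_right _ h1

theorem decFunProdFormula_lt_of_lt (ps : List (ℕ × ℕ)) : ∀ {w w' : List ℕ}, w ∈ decFunProd ps →
    w' ∈ decFunProd ps → w < w' → decFunProdFormula ps w < decFunProdFormula ps w' := by
  induction ps with
  | nil =>
    rintro _ _ rfl rfl h
    exact absurd h (List.lt_irrefl _)
  | cons q ps ih =>
    obtain ⟨a, b⟩ := q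
    rintro _ _ ⟨l, hl, w, hw, rfl⟩ ⟨l', hl', w', hw', rfl⟩ hlt
    rw [decFunProdFormula_append hl.1, decFunProdFormula_append hl'.1]
    rcases (append_lt_append_iff (hl.1.trans hl'.1.symm)).1 hlt with h | ⟨rfl, h⟩
    · have h1 : decFunFormula l + 1 ≤ decFunFormula l' := decFunFormula_lt_of_lt hl hl' h
      have h2 := decFunProdFormula_lt ps hw
      have h3 := Nat.mul_le_mul_right (chooseProd ps) h1
      rw [add_mul, one_mul] at h3
      omega
    · have := ih hw hw' h
      omega

/-! ### Greedy unranking, and the rank formula -/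

theorem lt_choose_add (m k : ℕ) : m < (m + k + 1).choose (k + 1) := by
  induction m with
  | zero => simp
  | succ m ih =>
    have h : m + 1 + k + 1 = (m + k + 1) + 1 := by ring
    rw [h, Nat.choose_succ_succ']
    have := Nat.choose_pos (show k ≤ m + k + 1 by omega)
    omega

/-- One step of the greedy procedure. -/
theorem decFunUnrank_succ {k m y : ℕ} (h1 : y.choose (k + 1) ≤ m)
    (h2 : m < (y + 1).choose (k + 1)) :
    decFunUnrank (k + 1) m = (y + 1) :: decFunUnrank k (m - y.choose (k + 1)) := by
  have hy : y ≤ m + k := by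
    by_contra hcon
    obtain ⟨z, rfl⟩ := Nat.exists_eq_add_of_le (show m + k + 1 ≤ y by omega)
    have := lt_choose_add m k
    have := Nat.choose_le_choose (k + 1) (show m + k + 1 ≤ m + k + 1 + z by omega)
    omega
  have : Nat.findGreatest (fun y => y.choose (k + 1) ≤ m) (m + k) = y := by
    rw [Nat.findGreatest_eq_iff]
    refine ⟨hy, fun _ => h1, fun n hn _ h => ?_⟩
    have := Nat.choose_le_choose (k + 1) (show y + 1 ≤ n by omega)
    omega
  rw [decFunUnrank, this]

theorem exists_choose_le_lt (k m : ℕ) :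
    ∃ y, y.choose (k + 1) ≤ m ∧ m < (y + 1).choose (k + 1) := by
  classical
  have hex : ∃ y, m < (y + 1).choose (k + 1) := ⟨m + k, lt_choose_add m k⟩
  refine ⟨Nat.find hex, ?_, Nat.find_spec hex⟩
  rcases h : Nat.find hex with _ | y
  · simp
  · exact not_lt.1 (Nat.find_min hex (m := y) (by omega))

/-- Since `y` is the largest possible choice, `m < C(y+1, k+1)`, and Pascal's rule bounds the
remainder by `C(y, k)`. So the remaining entries are at most `y` and the sequence decreases. -/
theorem decFunUnrank_spec (k : ℕ) : ∀ {a m : ℕ}, m < a.choose k →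
    decFunUnrank k m ∈ decFun a k ∧ decFunFormula (decFunUnrank k m) = m := by
  induction k with
  | zero =>
    intro a m h
    have : m = 0 := by simpa using h
    subst this
    simp [decFunUnrank, decFun, decFunFormula]
  | succ k ih =>
    intro a m h
    obtain ⟨y, h1, h2⟩ := exists_choose_le_lt k m
    rw [decFunUnrank_succ h1 h2]
    have hya : y < a := by
      by_contra hcon
      have := Nat.choose_le_choose (k + 1) (not_lt.1 hcon)
      omega
    rw [Nat.choose_succ_succ] at h2
    obtain ⟨⟨h3, h4, h5⟩, h6⟩ := ih (a := y) (m := m - y.choose (k + 1)) (by simp at *; omega)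
    refine ⟨⟨by simp [h3], List.pairwise_cons.2 ⟨fun x hx => ?_, h4⟩, fun x hx => ?_⟩, ?_⟩
    · have := h5 x hx
      omega
    · rcases List.mem_cons.1 hx with rfl | hx
      · omega
      · have := h5 x hx
        omega
    · rw [decFunFormula, h3, h6, Nat.add_sub_cancel]
      omega

theorem decFunProdUnrank_spec (ps : List (ℕ × ℕ)) : ∀ {r : ℕ}, r < chooseProd ps →
    decFunProdUnrank ps r ∈ decFunProd ps ∧ decFunProdFormula ps (decFunProdUnrank ps r) = r := by
  induction ps with
  | nil =>
    intro r h
    have : r = 0 := by simpa [chooseProd] using h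
    subst this
    exact ⟨rfl, rfl⟩
  | cons q ps ih =>
    obtain ⟨a, b⟩ := q
    intro r h
    rw [chooseProd_cons] at h
    have hpos : 0 < chooseProd ps := Nat.pos_of_ne_zero fun h0 => by simp [h0] at h
    obtain ⟨h1, h2⟩ := decFunUnrank_spec b (Nat.div_lt_of_lt_mul (by rwa [mul_comm] at h))
    obtain ⟨h3, h4⟩ := ih (Nat.mod_lt r hpos)
    rw [decFunProdUnrank]
    refine ⟨⟨_, h1, _, h3, rfl⟩, ?_⟩
    rw [decFunProdFormula_append h1.1, h2, h4]
    exact Nat.div_add_mod' r _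

theorem bijOn_decFunProdFormula (ps : List (ℕ × ℕ)) :
    Set.BijOn (decFunProdFormula ps) (decFunProd ps) (Set.Iio (chooseProd ps)) := by
  refine ⟨fun w hw => decFunProdFormula_lt ps hw, fun w hw w' hw' h => ?_, fun r hr =>
    ⟨_, (decFunProdUnrank_spec ps hr).1, (decFunProdUnrank_spec ps hr).2⟩⟩
  rcases lt_trichotomy w w' with hlt | heq | hlt
  · exact absurd h (decFunProdFormula_lt_of_lt ps hw hw' hlt).ne
  · exact heq
  · exact absurd h (decFunProdFormula_lt_of_lt ps hw' hw hlt).ne'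

/-- A strictly increasing bijection onto an initial interval maps the elements before `w` onto the
numbers below the value of `w`; counting both sides gives the claim. -/
theorem lexRank_eq_formula {ps : List (ℕ × ℕ)} {w : List ℕ} (hw : w ∈ decFunProd ps) :
    lexRank (decFunProd ps) w = decFunProdFormula ps w := by
  have hbij := bijOn_decFunProdFormula ps
  have hset : decFunProdFormula ps '' {w' ∈ decFunProd ps | w' < w} =
      Set.Iio (decFunProdFormula ps w) := by
    ext r
    constructor
    · rintro ⟨w', ⟨hw', hlt⟩, rfl⟩
      exact decFunProdFormula_lt_of_lt ps hw' hw hlt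
    · intro hr
      obtain ⟨w', hw', rfl⟩ := hbij.surjOn (lt_trans hr (hbij.mapsTo hw) : r < chooseProd ps)
      refine ⟨w', ⟨hw', ?_⟩, rfl⟩
      rcases lt_trichotomy w' w with hlt | rfl | hlt
      · exact hlt
      · exact absurd (Set.mem_Iio.1 hr) (lt_irrefl _)
      · exact absurd (decFunProdFormula_lt_of_lt ps hw hw' hlt) (lt_asymm (Set.mem_Iio.1 hr))
  rw [lexRank, ← (hbij.injOn.mono fun w' h => h.1 : Set.InjOn _ {w' ∈ decFunProd ps | w' < w}).ncard_image, hset]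
  rw [← Finset.coe_Iio, Set.ncard_coe_finset, Nat.card_Iio]

theorem bijOn_lexRank (ps : List (ℕ × ℕ)) :
    Set.BijOn (lexRank (decFunProd ps)) (decFunProd ps) (Set.Iio (chooseProd ps)) :=
  (bijOn_decFunProdFormula ps).congr fun _ hw => (lexRank_eq_formula hw).symm

/-! ### Ranking and unranking of trees -/

theorem two_le_of_degrees {n : ℕ} {s : Vtx n → ℕ} (h1 : ∀ i, 1 ≤ s i)
    (h2 : ∑ i, s i + 2 = 2 * n) : 2 ≤ n := by
  have : ∑ _i : Vtx n, 1 ≤ ∑ i, s i := Finset.sum_le_sum fun i _ => h1 i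
  rw [Finset.sum_const, Finset.card_univ, Fintype.card_coe, Nat.card_Icc] at this
  simp only [smul_eq_mul, mul_one] at this
  omega

theorem ncard_treesWithDegrees {n : ℕ} {s : Vtx n → ℕ} (h1 : ∀ i, 1 ≤ s i)
    (h2 : ∑ i, s i + 2 = 2 * n) : (treesWithDegrees s).ncard = chooseProd (shape s) := by
  have hbij := ((bijOn_decFunProdFormula (shape s)).comp (bijOn_encode h1 h2)).comp
    (bijOn_treePartition (two_le_of_degrees h1 h2) s)
  rw [← hbij.injOn.ncard_image, hbij.image_eq, ← Finset.coe_Iio,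
    Set.ncard_coe_finset, Nat.card_Iio]

theorem rankTree_eq_formula {n : ℕ} (hn : 2 ≤ n) {s : Vtx n → ℕ} {T : Digraph (Vtx n)}
    (hT : T ∈ treesWithDegrees s) :
    rankTree s T = decFunProdFormula (shape s) (encode s (treePartition T)) :=
  lexRank_eq_formula (encode_mem (treePartition_mem hn hT))

theorem bijOn_rankTree {n : ℕ} {s : Vtx n → ℕ} (h1 : ∀ i, 1 ≤ s i)
    (h2 : ∑ i, s i + 2 = 2 * n) :
    Set.BijOn (rankTree s) (treesWithDegrees s) (Set.Iio (treesWithDegrees s).ncard) := by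
  rw [ncard_treesWithDegrees h1 h2]
  exact ((bijOn_lexRank (shape s)).comp (bijOn_encode h1 h2)).comp
    (bijOn_treePartition (two_le_of_degrees h1 h2) s)

theorem invOn_unrankTree_rankTree {n : ℕ} {s : Vtx n → ℕ} (h1 : ∀ i, 1 ≤ s i)
    (h2 : ∑ i, s i + 2 = 2 * n) : Set.InvOn (unrankTree s) (rankTree s) (treesWithDegrees s)
      (Set.Iio (treesWithDegrees s).ncard) := by
  have hn := two_le_of_degrees h1 h2
  have hright : Set.RightInvOn (unrankTree s) (rankTree s)
      (Set.Iio (treesWithDegrees s).ncard) := by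
    intro r hr
    rw [ncard_treesWithDegrees h1 h2] at hr
    obtain ⟨hw, hr⟩ := decFunProdUnrank_spec (shape s) hr
    obtain ⟨hT, hp⟩ := theta_partitionGraph_mem hn (decode_mem h1 h2 hw)
    rw [unrankTree, rankTree_eq_formula hn hT, hp, encode_decode hw, hr]
  -- A right inverse of an injective map is also a left inverse.
  refine ⟨fun T hT => ?_, hright⟩
  have hmem := (bijOn_rankTree h1 h2).mapsTo hT
  refine (bijOn_rankTree h1 h2).injOn ?_ hT (hright hmem)
  rw [ncard_treesWithDegrees h1 h2] at hmem
  exact (theta_partitionGraph_mem hn (decode_mem h1 h2 (decFunProdUnrank_spec _ hmem).1)).1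

theorem bijOn_unrankTree {n : ℕ} {s : Vtx n → ℕ} (h1 : ∀ i, 1 ≤ s i)
    (h2 : ∑ i, s i + 2 = 2 * n) :
    Set.BijOn (unrankTree s) (Set.Iio (treesWithDegrees s).ncard) (treesWithDegrees s) :=
  Set.BijOn.symm (invOn_unrankTree_rankTree h1 h2).symm (bijOn_rankTree h1 h2)

end CayleyRank

namespace CayleyRank

/-! ### Verification of programs -/

theorem bitLen_mono {x y : ℕ} (h : x ≤ y) : bitLen x ≤ bitLen y :=
  Nat.add_le_add_right (Nat.log_mono_right h) 1

theorem bitLen_le_of_lt_two_pow {x k : ℕ} (hk : 1 ≤ k) (h : x < 2 ^ k) : bitLen x ≤ k := by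
  have := Nat.log_lt_of_lt_pow' (b := 2) (by omega) h
  rw [bitLen]
  omega

theorem lt_two_pow_bitLen (x : ℕ) : x < 2 ^ bitLen x := Nat.lt_pow_succ_log_self (by norm_num) x

theorem one_le_bitLen (x : ℕ) : 1 ≤ bitLen x := by simp [bitLen]

/-- Started in state `σ`, the program halts at cost at most `c` in a state that satisfies `R`. -/
def Tri (P : Program) (σ : MState) (c : ℕ) (R : MState → Prop) : Prop :=
  ∃ τ d, Runs P σ τ d ∧ d ≤ c ∧ R τ

theorem Tri.mono {P : Program} {σ : MState} {c c' : ℕ} {R R' : MState → Prop}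
    (h : Tri P σ c R) (hc : c ≤ c') (hR : ∀ τ, R τ → R' τ) : Tri P σ c' R' := by
  obtain ⟨τ, d, h1, h2, h3⟩ := h
  exact ⟨τ, d, h1, h2.trans hc, hR τ h3⟩

theorem Tri.seq {P Q : Program} {σ : MState} {c d : ℕ} {R : MState → Prop}
    (h : Tri P σ c fun τ => Tri Q τ d R) : Tri (.seq P Q) σ (c + d) R := by
  obtain ⟨τ, c', h1, h2, υ, d', h3, h4, h5⟩ := h
  exact ⟨υ, _, h1.seq h3, Nat.add_le_add h2 h4, h5⟩

/-- The registers that are written by a program. -/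
def Program.writes : Program → List ℕ
  | .skip => []
  | .const d _ => [d]
  | .arith _ d _ _ => [d]
  | .load d _ => [d]
  | .store _ _ => []
  | .seq P Q => P.writes ++ Q.writes
  | .ifLt _ _ P Q => P.writes ++ Q.writes
  | .whileLt _ _ P => P.writes

theorem Runs.reg_eq {P : Program} {σ τ : MState} {c : ℕ} (h : Runs P σ τ c) :
    ∀ d, d ∉ P.writes → τ.reg d = σ.reg d := by
  induction h with
  | skip => exact fun _ _ => rfl
  | const d k σ => exact fun i hi => Function.update_of_ne (by simpa [Program.writes] using hi) _ _
  | arith o d x y σ =>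
    exact fun i hi => Function.update_of_ne (by simpa [Program.writes] using hi) _ _
  | load d a σ => exact fun i hi => Function.update_of_ne (by simpa [Program.writes] using hi) _ _
  | store => exact fun _ _ => rfl
  | seq _ _ ih1 ih2 =>
    intro i hi
    simp only [Program.writes, List.mem_append, not_or] at hi
    rw [ih2 i hi.2, ih1 i hi.1]
  | ifTrue _ _ ih =>
    intro i hi
    simp only [Program.writes, List.mem_append, not_or] at hi
    exact ih i hi.1
  | ifFalse _ _ ih =>
    intro i hi
    simp only [Program.writes, List.mem_append, not_or] at hi
    exact ih i hi.2
  | whileTrue _ _ _ ih1 ih2 =>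
    intro i hi
    rw [ih2 i hi, ih1 i hi]
  | whileFalse => exact fun _ _ => rfl

/-- The states agree on the registers that `P` does not write. -/
def SameOff (P : Program) (σ τ : MState) : Prop := ∀ d, d ∉ P.writes → τ.reg d = σ.reg d

/-- Spares each specification the mention of unchanged registers: whether a register is written by a
concrete program is decidable. -/
theorem Tri.frame {P : Program} {σ : MState} {c : ℕ} {R : MState → Prop} (h : Tri P σ c R) :
    Tri P σ c fun τ => R τ ∧ SameOff P σ τ := by
  obtain ⟨τ, d, h1, h2, h3⟩ := h
  exact ⟨τ, d, h1, h2, h3, h1.reg_eq⟩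

/-- A loop with a known number of passes. -/
theorem Tri.while_count {x y : ℕ} {P : Program} {σ₀ : MState} (I : ℕ → MState → Prop) (N : ℕ)
    (cost : ℕ → ℕ) (g : ℕ) (h0 : I 0 σ₀)
    (hstep : ∀ i < N, ∀ σ, SameOff P σ₀ σ → I i σ → σ.reg x < σ.reg y ∧
      bitLen (σ.reg x) + bitLen (σ.reg y) ≤ g ∧ Tri P σ (cost i) (I (i + 1)))
    (hend : ∀ σ, SameOff P σ₀ σ → I N σ → ¬ σ.reg x < σ.reg y ∧
      bitLen (σ.reg x) + bitLen (σ.reg y) ≤ g) :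
    Tri (.whileLt x y P) σ₀ (∑ i ∈ Finset.range N, (cost i + g) + g)
      fun τ => I N τ ∧ SameOff P σ₀ τ := by
  have key : ∀ k i σ, k + i = N → SameOff P σ₀ σ → I i σ →
      Tri (.whileLt x y P) σ (∑ j ∈ Finset.range k, (cost (i + j) + g) + g)
        fun τ => I N τ ∧ SameOff P σ₀ τ := by
    intro k
    induction k with
    | zero =>
      intro i σ hi hs hI
      obtain rfl : i = N := by omega
      obtain ⟨h1, h2⟩ := hend σ hs hI
      exact ⟨σ, _, .whileFalse h1, by simpa using h2, hI, hs⟩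
    | succ k ih =>
      intro i σ hi hs hI
      obtain ⟨h1, h2, τ, d, h3, h4, h5⟩ := hstep i (by omega) σ hs hI
      have hs' : SameOff P σ₀ τ := fun r hr => (h3.reg_eq r hr).trans (hs r hr)
      obtain ⟨υ, e, h6, h7, h8⟩ := ih (i + 1) τ (by omega) hs' h5
      refine ⟨υ, _, .whileTrue h1 h3 h6, ?_, h8⟩
      rw [Finset.sum_range_succ']
      simp only [add_zero]
      have : ∑ j ∈ Finset.range k, (cost (i + (j + 1)) + g) =
          ∑ j ∈ Finset.range k, (cost (i + 1 + j) + g) :=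
        Finset.sum_congr rfl fun j _ => by rw [add_right_comm, add_assoc]
      omega
  simpa using key N 0 σ₀ rfl (fun _ _ => rfl) h0

/-- A loop with a decreasing variant. -/
theorem Tri.while_variant {x y : ℕ} {P : Program} {σ₀ : MState} (I : ℕ → MState → Prop) (N : ℕ)
    (c g : ℕ) (h0 : I N σ₀)
    (hstep : ∀ k σ, SameOff P σ₀ σ → I k σ → bitLen (σ.reg x) + bitLen (σ.reg y) ≤ g ∧
      (σ.reg x < σ.reg y → Tri P σ c fun τ => ∃ j < k, I j τ)) :
    Tri (.whileLt x y P) σ₀ (N * (c + g) + g)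
      fun τ => (∃ k, I k τ) ∧ ¬ τ.reg x < τ.reg y ∧ SameOff P σ₀ τ := by
  have key : ∀ k σ, SameOff P σ₀ σ → I k σ → Tri (.whileLt x y P) σ (k * (c + g) + g)
      fun τ => (∃ k, I k τ) ∧ ¬ τ.reg x < τ.reg y ∧ SameOff P σ₀ τ := by
    intro k
    induction k using Nat.strong_induction_on with
    | _ k ih =>
      intro σ hs hI
      obtain ⟨h1, h2⟩ := hstep k σ hs hI
      by_cases hlt : σ.reg x < σ.reg y
      · obtain ⟨τ, d, h3, h4, j, hj, h5⟩ := h2 hlt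
        have hs' : SameOff P σ₀ τ := fun r hr => (h3.reg_eq r hr).trans (hs r hr)
        obtain ⟨υ, e, h6, h7, h8⟩ := ih j hj τ hs' h5
        refine ⟨υ, _, .whileTrue hlt h3 h6, ?_, h8⟩
        have := Nat.mul_le_mul_right (c + g) (show j + 1 ≤ k from hj)
        rw [add_mul, one_mul] at this
        omega
      · exact ⟨σ, _, .whileFalse hlt, by omega, ⟨k, hI⟩, hlt, hs⟩
  exact key N σ₀ (fun _ _ => rfl) h0

/-- A bound for the number of instructions that a program without loops executes. -/
def Program.steps : Program → ℕ
  | .seq P Q => P.steps + Q.steps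
  | .ifLt _ _ P Q => P.steps + Q.steps + 1
  | _ => 1

/-- The verification condition of a program without loops: all numbers that occur are at most `B`,
and the final state satisfies `R`. -/
def vc (B : ℕ) : Program → (MState → Prop) → MState → Prop
  | .skip, R, σ => R σ
  | .const d k, R, σ => k ≤ B ∧ R (σ.setReg d k)
  | .arith o d x y, R, σ => σ.reg x ≤ B ∧ σ.reg y ≤ B ∧
      R (σ.setReg d (o.eval (σ.reg x) (σ.reg y)))
  | .load d a, R, σ => σ.reg a ≤ B ∧ σ.mem (σ.reg a) ≤ B ∧ R (σ.setReg d (σ.mem (σ.reg a)))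
  | .store a x, R, σ => σ.reg a ≤ B ∧ σ.reg x ≤ B ∧ R (σ.setMem (σ.reg a) (σ.reg x))
  | .seq P Q, R, σ => vc B P (fun τ => vc B Q R τ) σ
  | .ifLt x y P Q, R, σ => σ.reg x ≤ B ∧ σ.reg y ≤ B ∧
      (σ.reg x < σ.reg y → vc B P R σ) ∧ (¬ σ.reg x < σ.reg y → vc B Q R σ)
  | .whileLt _ _ _, _, _ => False

/-- Each instruction handles at most two numbers, both at most `B`, hence costs at most `2 * bitLen
B`. -/
theorem Tri.of_vc {B : ℕ} {P : Program} : ∀ {R : MState → Prop} {σ : MState}, vc B P R σ →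
    Tri P σ (P.steps * (2 * bitLen B)) R := by
  have hB := one_le_bitLen B
  have h2 : ∀ {x y : ℕ}, x ≤ B → y ≤ B → bitLen x + bitLen y ≤ 1 * (2 * bitLen B) := by
    intro x y hx hy
    have := bitLen_mono hx
    have := bitLen_mono hy
    omega
  induction P with
  | skip => exact fun h => ⟨_, _, .skip _, by simp [Program.steps]; omega, h⟩
  | const d k =>
    exact fun h => ⟨_, _, .const d k _, by have := bitLen_mono h.1; simp [Program.steps]; omega, h.2⟩
  | arith o d x y => exact fun h => ⟨_, _, .arith o d x y _, h2 h.1 h.2.1, h.2.2⟩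
  | load d a => exact fun h => ⟨_, _, .load d a _, h2 h.1 h.2.1, h.2.2⟩
  | store a x => exact fun h => ⟨_, _, .store a x _, h2 h.1 h.2.1, h.2.2⟩
  | seq P Q ihP ihQ =>
    intro R σ h
    rw [Program.steps, add_mul]
    exact Tri.seq ((ihP h).mono le_rfl fun τ hτ => ihQ hτ)
  | ifLt x y P Q ihP ihQ =>
    intro R σ h
    obtain ⟨h3, h4, h5, h6⟩ := h
    have h7 := h2 h3 h4
    rw [Program.steps, add_mul, add_mul]
    by_cases hlt : σ.reg x < σ.reg y
    · obtain ⟨τ, d, h8, h9, h10⟩ := ihP (h5 hlt)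
      exact ⟨τ, _, .ifTrue hlt h8, by omega, h10⟩
    · obtain ⟨τ, d, h8, h9, h10⟩ := ihQ (h6 hlt)
      exact ⟨τ, _, .ifFalse hlt h8, by omega, h10⟩
  | whileLt => exact fun h => h.elim

theorem Tri.ifLt {x y B c : ℕ} {P Q : Program} {σ : MState} {R : MState → Prop}
    (hx : σ.reg x ≤ B) (hy : σ.reg y ≤ B) (hP : σ.reg x < σ.reg y → Tri P σ c R)
    (hQ : ¬ σ.reg x < σ.reg y → Tri Q σ c R) : Tri (.ifLt x y P Q) σ (2 * bitLen B + c) R := by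
  have h1 := bitLen_mono hx
  have h2 := bitLen_mono hy
  by_cases hlt : σ.reg x < σ.reg y
  · obtain ⟨τ, d, h8, h9, h10⟩ := hP hlt
    exact ⟨τ, _, .ifTrue hlt h8, by omega, h10⟩
  · obtain ⟨τ, d, h8, h9, h10⟩ := hQ hlt
    exact ⟨τ, _, .ifFalse hlt h8, by omega, h10⟩

theorem setReg_reg (σ : MState) (d x i : ℕ) :
    (σ.setReg d x).reg i = if i = d then x else σ.reg i := by
  simp [MState.setReg, Function.update_apply]

theorem setReg_mem (σ : MState) (d x : ℕ) : (σ.setReg d x).mem = σ.mem := rfl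

theorem setMem_reg (σ : MState) (d x : ℕ) : (σ.setMem d x).reg = σ.reg := rfl

theorem setMem_mem (σ : MState) (d x : ℕ) : (σ.setMem d x).mem = Function.update σ.mem d x := rfl

end CayleyRank

namespace CayleyRank
open Relation

/-! ### The program for `Θ⁻¹` -/

/-- Follow the path from register `8` to the vertex `1`; register `9` is raised to the largest
vertex on it. -/
def pathMaxBody : Program :=
  .seq (.ifLt 9 8 (.arith .add 9 8 2) .skip) (.seq (.arith .add 7 0 8) (.load 8 7))

/-- Register `6` holds the vertex after the current path maximum. The walk leaves the next maximum
`m` in register `9`; the old head of the arc of `m` is saved to register `10` before register `6` is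
written in its place, and becomes the new register `6`. -/
def thetaInvBody : Program :=
  .seq (.seq (.arith .add 8 6 2) (.arith .add 9 6 2))
    (.seq (.whileLt 3 8 pathMaxBody)
      (.seq (.arith .add 7 0 9) (.seq (.load 10 7) (.seq (.store 7 6) (.arith .add 6 10 2)))))

def thetaInvProg : Program :=
  .seq (.seq (.const 3 1) (.seq (.arith .add 7 0 0) (.load 6 7))) (.whileLt 3 6 thetaInvBody)

/-- Arithmetic facts about a state: the parameters that stay fixed. -/
structure Consts (n : ℕ) (σ : MState) : Prop where
  reg0 : σ.reg 0 = n
  reg2 : σ.reg 2 = 0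
  reg3 : σ.reg 3 = 1

theorem Consts.of_sameOff {n : ℕ} {P : Program} {σ τ : MState} (h : Consts n σ)
    (hs : SameOff P σ τ) (h0 : 0 ∉ P.writes := by decide) (h2 : 2 ∉ P.writes := by decide)
    (h3 : 3 ∉ P.writes := by decide) : Consts n τ :=
  ⟨(hs 0 h0).trans h.reg0, (hs 2 h2).trans h.reg2, (hs 3 h3).trans h.reg3⟩

theorem guard_le {x y B : ℕ} (hx : x ≤ B) (hy : y ≤ B) :
    bitLen x + bitLen y ≤ 2 * bitLen B := by
  have := bitLen_mono hx
  have := bitLen_mono hy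
  omega

/-- Every vertex of the path is bounded by register `9` or still lies ahead. When the walk stands at
`1`, nothing else lies ahead, so register `9` is the maximum. -/
theorem pathMax_spec {n : ℕ} {T : Digraph (Vtx n)} (hT : T ∈ rootedTrees n) (hn : 2 ≤ n)
    {σ₀ : MState} (hc : Consts n σ₀) (x : Vtx n) (h8 : σ₀.reg 8 = x) (h9 : σ₀.reg 9 = x)
    (hx1 : (x : ℕ) ≠ 1)
    (ht : ∀ w : Vtx n, ReflTransGen T.Adj x w → (w : ℕ) ≠ 1 →
      ∃ v : Vtx n, T.Adj w v ∧ σ₀.mem (n + w) = v) :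
    Tri (.whileLt 3 8 pathMaxBody) σ₀ (n * (5 * (2 * bitLen (4 * n)) + 2 * bitLen (4 * n)) +
      2 * bitLen (4 * n)) fun τ => SameOff pathMaxBody σ₀ τ ∧ τ.mem = σ₀.mem ∧
        ∃ m : Vtx n, τ.reg 9 = m ∧
          IsGreatest {w : Vtx n | (w : ℕ) ≠ 1 ∧ ReflTransGen T.Adj x w} m := by
  classical
  -- The variant is the number of vertices that come strictly after the current one, at most `n`.
  let I : ℕ → MState → Prop := fun k σ => σ.mem = σ₀.mem ∧ ∃ y m : Vtx n, σ.reg 8 = y ∧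
    σ.reg 9 = m ∧ (m : ℕ) ≠ 1 ∧ ReflTransGen T.Adj x m ∧ ReflTransGen T.Adj x y ∧
    (∀ w : Vtx n, (w : ℕ) ≠ 1 → ReflTransGen T.Adj x w → w ≤ m ∨ ReflTransGen T.Adj y w) ∧
    ((Finset.univ : Finset (Vtx n)).filter fun w => TransGen T.Adj y w).card ≤ k
  refine Tri.mono (Tri.while_variant I n _ _ ?_ ?_) le_rfl ?_
  · refine ⟨rfl, x, x, h8, h9, hx1, .refl, .refl, fun w _ h => Or.inr h, ?_⟩
    refine (Finset.card_le_univ _).trans ?_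
    simp
  · rintro k σ hs ⟨hmem, y, m, hy, hm, hm1, hxm, hxy, hw, hk⟩
    have hc := hc.of_sameOff hs
    have hyn := Finset.mem_Icc.1 y.2
    have hmn := Finset.mem_Icc.1 m.2
    refine ⟨guard_le (by rw [hc.reg3]; omega) (by rw [hy]; omega), fun hlt => ?_⟩
    rw [hc.reg3, hy] at hlt
    obtain ⟨v, hyv, hv⟩ := ht y hxy (by omega)
    have hvn := Finset.mem_Icc.1 v.2
    have hlt' : ((Finset.univ : Finset (Vtx n)).filter fun w => TransGen T.Adj v w).card <
        ((Finset.univ : Finset (Vtx n)).filter fun w => TransGen T.Adj y w).card := by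
      refine Finset.card_lt_card ⟨fun w hw => ?_, fun hsub => ?_⟩
      · simp only [Finset.mem_filter, Finset.mem_univ, true_and] at hw ⊢
        exact hw.head hyv
      · have := hsub (Finset.mem_filter.2 ⟨Finset.mem_univ v, .single hyv⟩)
        simp only [Finset.mem_filter, Finset.mem_univ, true_and] at this
        exact rootedTrees_irrefl hT v this
    have hreach : ∀ w : Vtx n, (w : ℕ) ≠ 1 → ReflTransGen T.Adj x w →
        w ≤ m ∨ w = y ∨ ReflTransGen T.Adj v w := by
      intro w hw1 hxw
      rcases hw w hw1 hxw with h | h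
      · exact Or.inl h
      · rcases h.cases_head with h | ⟨z, hz, hzw⟩
        · exact Or.inr (Or.inl h.symm)
        · rw [rootedTrees_rightUnique hT hz hyv] at hzw
          exact Or.inr (Or.inr hzw)
    refine Tri.of_vc (B := 4 * n) (P := pathMaxBody) ?_
    simp only [pathMaxBody, vc, setReg_reg, setReg_mem, ArithOp.eval, hc.reg0, hc.reg2, hy, hm,
      hmem, hv, Nat.reduceEqDiff, if_true, if_false, add_zero]
    refine ⟨by omega, by omega, fun hmy => ⟨by omega, by omega, by omega, by omega, by omega,
      by omega, ?_⟩, fun hmy => ⟨by omega, by omega, by omega, by omega, ?_⟩⟩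
    · refine ⟨_, hlt'.trans_le hk, by simp only [setReg_mem, hmem], v, y, by simp [setReg_reg],
        by simp [setReg_reg], by omega, hxy, hxy.tail hyv, fun w hw1 hxw => ?_, le_rfl⟩
      rcases hreach w hw1 hxw with h | rfl | h
      · exact Or.inl (h.trans (Subtype.mk_le_mk.2 hmy.le))
      · exact Or.inl le_rfl
      · exact Or.inr h
    · refine ⟨_, hlt'.trans_le hk, by simp only [setReg_mem, hmem], v, m, by simp [setReg_reg],
        by simp [setReg_reg, hm], hm1, hxm, hxy.tail hyv, fun w hw1 hxw => ?_, le_rfl⟩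
      rcases hreach w hw1 hxw with h | rfl | h
      · exact Or.inl h
      · exact Or.inl (Subtype.mk_le_mk.2 (not_lt.1 hmy))
      · exact Or.inr h
  · rintro τ ⟨⟨k, hmem, y, m, hy, hm, hm1, hxm, hxy, hw, -⟩, hlt, hs⟩
    refine ⟨hs, hmem, m, hm, ⟨hm1, hxm⟩, fun w hw' => ?_⟩
    rcases hw w hw'.1 hw'.2 with h | h
    · exact h
    · exfalso
      have hyn := Finset.mem_Icc.1 y.2
      rw [(hc.of_sameOff hs).reg3, hy] at hlt
      rcases h.cases_head with rfl | ⟨z, hz, -⟩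
      · exact hw'.1 (by omega)
      · have := rootedTrees_adj_bounds hT hz
        omega

/-- Overwriting the table in place is safe: the walk after a path maximum `u` meets only vertices
below `u`, while the cells changed so far belong to path maxima that are at least `u`. There are at
most `n` walks of at most `n` steps. -/
theorem thetaInvProg_spec {n : ℕ} {T : Digraph (Vtx n)} (hT : T ∈ rootedTrees n) (hn : 2 ≤ n)
    {σ₀ : MState} (h0 : σ₀.reg 0 = n) (h2 : σ₀.reg 2 = 0)
    (ht : ∀ w v : Vtx n, T.Adj w v → σ₀.mem (n + w) = v) :
    Tri thetaInvProg σ₀ (30 * (n * n * (2 * bitLen (4 * n)))) fun τ => Consts n τ ∧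
      SameOff thetaInvProg σ₀ τ ∧ (∀ i ≤ n, τ.mem i = σ₀.mem i) ∧
      ∀ u v : Vtx n, (thetaInv T).Adj u v → τ.mem (n + u) = v := by
  set W := 2 * bitLen (4 * n) with hW
  have hnV : n ∈ Finset.Icc 1 n := by simp; omega
  obtain ⟨x₀, hx₀, -⟩ := rootedTrees_existsUnique_adj hT (u := ⟨n, hnV⟩) (by simp; omega)
  have hx₀n := Finset.mem_Icc.1 x₀.2
  have htop := ht _ _ hx₀
  simp only at htop
  -- The vertex `u` is the current path maximum and serves as the variant. Cell `n + n` is never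
  -- changed: `n` has no arc in `thetaInv T`, and its label is not needed later.
  let I : ℕ → MState → Prop := fun k σ => (∀ i ≤ n, σ.mem i = σ₀.mem i) ∧ ∃ u x : Vtx n,
    (u : ℕ) ≤ k ∧ IsPathMax T u ∧ T.Adj u x ∧ σ.reg 6 = x ∧
    (∀ w v : Vtx n, T.Adj w v → (IsPathMax T w → (w : ℕ) ≠ n → w < u) → σ.mem (n + w) = v) ∧
    (∀ w v : Vtx n, IsPathMax T w → (w : ℕ) ≠ n → u ≤ w → (thetaInv T).Adj w v →
      σ.mem (n + w) = v)
  have hinit : Tri (.seq (.const 3 1) (.seq (.arith .add 7 0 0) (.load 6 7))) σ₀ (3 * W)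
      fun τ => Consts n τ ∧ I n τ := by
    refine Tri.of_vc (B := 4 * n)
      (P := .seq (.const 3 1) (.seq (.arith .add 7 0 0) (.load 6 7))) ?_
    simp only [vc, setReg_reg, setReg_mem, ArithOp.eval, h0, Nat.reduceEqDiff, if_true, if_false,
      htop, OfNat.zero_ne_ofNat]
    refine ⟨by omega, by omega, by omega, by omega, by omega, ⟨by simp [setReg_reg, h0],
      by simp [setReg_reg, h2], by simp [setReg_reg]⟩, fun _ _ => rfl, ⟨n, hnV⟩, x₀, le_rfl,
      isPathMax_of_eq rfl, hx₀, by simp [setReg_reg], fun w v h _ => ht w v h, ?_⟩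
    intro w v _ hwn hle _
    have h1 : n ≤ (w : ℕ) := hle
    have := Finset.mem_Icc.1 w.2
    omega
  refine Tri.mono (Tri.seq (c := 3 * W) (d := n * ((2 * W + (n * (5 * W + W) + W + 4 * W)) + W) + W)
    (Tri.mono hinit.frame le_rfl ?_)) ?_ fun _ h => h
  · rintro σ₁ ⟨⟨hc₁, hI₁⟩, hs₁⟩
    refine Tri.mono (Tri.while_variant I n _ _ hI₁ ?_) le_rfl ?_
    · rintro k σ hs ⟨hlow, u, x, huk, hu, hux, h6, hmem1, hmem2⟩
      have hc := hc₁.of_sameOff hs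
      have hxn := Finset.mem_Icc.1 x.2
      have hun := Finset.mem_Icc.1 u.2
      refine ⟨guard_le (by rw [hc.reg3]; omega) (by rw [h6]; omega), fun hlt => ?_⟩
      rw [hc.reg3, h6] at hlt
      have hux' : ∀ w, ReflTransGen T.Adj x w ↔ TransGen T.Adj u w := fun w =>
        ⟨fun h => TransGen.head' hux h, fun h => by
          obtain ⟨y, hy, hyw⟩ := TransGen.head'_iff.1 h
          rwa [rootedTrees_rightUnique hT hux hy]⟩
      refine Tri.seq (Tri.mono (Tri.of_vc (B := 4 * n)
        (R := fun τ => Consts n τ ∧ τ.reg 8 = x ∧ τ.reg 9 = x ∧ τ.reg 6 = x ∧ τ.mem = σ.mem)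
        (P := .seq (.arith .add 8 6 2) (.arith .add 9 6 2)) ?_) le_rfl ?_)
      · simp only [vc, setReg_reg, setReg_mem, ArithOp.eval, hc.reg2, h6, Nat.reduceEqDiff,
          if_true, if_false, add_zero, and_true]
        exact ⟨by omega, by omega, by omega, by omega, ⟨by simp [setReg_reg, hc.reg0],
          by simp [setReg_reg, hc.reg2], by simp [setReg_reg, hc.reg3]⟩⟩
      · rintro σ' ⟨hc', h8', h9', h6', hmem'⟩
        refine Tri.seq (Tri.mono (pathMax_spec hT hn hc' x h8' h9' (by omega) ?_) le_rfl ?_)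
        -- Vertices on the walk lie after `u`, hence are smaller than `u`, and their cells still
        -- hold the arcs of `T`.
        · intro w hw hw1
          obtain ⟨v, hv, -⟩ := rootedTrees_existsUnique_adj hT hw1
          refine ⟨v, hv, ?_⟩
          rw [hmem']
          exact hmem1 w v hv fun _ _ => hu.lt_of_transGen hT ((hux' w).1 hw)
        · rintro τ ⟨hsτ, hmemτ, m, h9, hm⟩
          have hcτ := hc'.of_sameOff hsτ
          have h6τ : τ.reg 6 = x := (hsτ 6 (by decide)).trans h6'
          have hmn := Finset.mem_Icc.1 m.2
          have hmax : NextMax T u m := by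
            refine ⟨⟨hm.1.1, (hux' m).1 hm.1.2⟩, fun w hw => hm.2 ⟨hw.1, (hux' w).2 hw.2⟩⟩
          have hmu := hu.lt_of_transGen hT hmax.1.2
          have hmu' : (m : ℕ) < u := hmu
          obtain ⟨y, hy, -⟩ := rootedTrees_existsUnique_adj hT hm.1.1
          have hyn := Finset.mem_Icc.1 y.2
          have hmemm := hmem1 m y hy fun _ _ => hmu
          refine Tri.of_vc (B := 4 * n) (P := .seq (.arith .add 7 0 9) (.seq (.load 10 7)
            (.seq (.store 7 6) (.arith .add 6 10 2)))) ?_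
          simp only [vc, setReg_reg, setReg_mem, setMem_reg, ArithOp.eval, hcτ.reg0,
            hcτ.reg2, h6τ, h9, Nat.reduceEqDiff, if_true, if_false, add_zero, hmemτ, hmem', hmemm]
          refine ⟨by omega, by omega, by omega, by omega, by omega, by omega, by omega, by omega,
            m, by omega, fun i hi => ?_, m, y, le_rfl, hu.next hmax, hy, by simp [setReg_reg],
            fun w v hwv hw => ?_, fun w v hw hwn hmw hwv => ?_⟩
          · rw [setReg_mem, setMem_mem, setReg_mem, setReg_mem, hmemτ, hmem',
              Function.update_of_ne (by omega)]
            exact hlow i hi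
          · have hwm : w ≠ m := by
              rintro rfl
              exact lt_irrefl _ (hw (hu.next hmax) (by omega))
            have hwm' : (w : ℕ) ≠ m := fun h => hwm (Subtype.ext h)
            rw [setReg_mem, setMem_mem, setReg_mem, setReg_mem, hmemτ, hmem',
              Function.update_of_ne (by omega)]
            exact hmem1 w v hwv fun h1 h2 => (hw h1 h2).trans hmu
          · by_cases hwm : w = m
            · subst hwm
              rw [setReg_mem, setMem_mem, Function.update_self]
              rw [thetaInv_adj_of_nextMax hn hT hu hmax] at hwv
              rw [rootedTrees_rightUnique hT hwv hux]
            · have hwm' : (w : ℕ) ≠ m := fun h => hwm (Subtype.ext h)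
              rw [setReg_mem, setMem_mem, setReg_mem, setReg_mem, hmemτ, hmem',
                Function.update_of_ne (by omega)]
              refine hmem2 w v hw hwn ?_ hwv
              by_contra hcon
              have := hm.2 ⟨hw.ne_one hn, (hux' w).2 (hu.transGen_of_lt hT hw (not_le.1 hcon))⟩
              exact hwm (le_antisymm this hmw)
    · rintro τ ⟨⟨k, hlow, u, x, huk, hu, hux, h6, hmem1, hmem2⟩, hlt, hs⟩
      refine ⟨hc₁.of_sameOff hs, fun d hd => ?_, hlow, fun w v hwv => ?_⟩
      · simp only [thetaInvProg, Program.writes, List.mem_append, not_or] at hd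
        exact (hs d hd.2).trans (hs₁ d (by simpa [Program.writes] using hd.1))
      · have hx1 : (x : ℕ) = 1 := by
          have := Finset.mem_Icc.1 x.2
          rw [(hc₁.of_sameOff hs).reg3, h6] at hlt
          omega
        by_cases hw : IsPathMax T w
        · by_cases hwn : (w : ℕ) = n
          · exfalso
            obtain ⟨f, hf⟩ := exists_funGraph_eq_thetaInv hn hT
            rw [← hf] at hwv
            have := funGraph_adj_mem hwv
            omega
          · refine hmem2 w v hw hwn ?_ hwv
            by_contra hcon
            obtain ⟨y, hy, hyw⟩ := TransGen.head'_iff.1 (hu.transGen_of_lt hT hw (not_le.1 hcon))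
            rw [rootedTrees_rightUnique hT hy hux] at hyw
            rcases hyw.cases_head with rfl | ⟨z, hz, -⟩
            · exact hw.ne_one hn hx1
            · have := rootedTrees_adj_bounds hT hz
              omega
        · exact hmem1 w v ((thetaInv_adj_of_not_isPathMax hw).1 hwv) fun h => absurd h hw
  · have h1 : W ≤ n * W := Nat.le_mul_of_pos_left _ (by omega)
    have h2 : n * W ≤ n * n * W := by
      rw [mul_assoc]
      exact Nat.le_mul_of_pos_left _ (by omega)
    nlinarith

end CayleyRank

namespace CayleyRank

/-! ### The program for binomial coefficients -/

/-- The update of the running binomial coefficient when a scan goes down from `y` to `y - 1`. Both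
factors involved are small and the division is exact. -/
theorem choose_mul_pred_div {y k : ℕ} (hy : 1 ≤ y) :
    y.choose k * (y - k) / y = (y - 1).choose k := by
  obtain ⟨z, rfl⟩ := Nat.exists_eq_add_of_le' hy
  rw [← Nat.choose_mul_succ_eq, Nat.add_sub_cancel, Nat.mul_div_cancel _ (by omega)]

theorem choose_mul_succ_div (m i : ℕ) :
    (m + i).choose i * (m + i + 1) / (i + 1) = (m + i + 1).choose (i + 1) := by
  rw [mul_comm, Nat.add_one_mul_choose_eq, Nat.mul_div_cancel _ (by omega)]

/-- The common bound for a block of size `b`: at most `b` factors come from the binomial coefficient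
and one more from the multiplication that precedes each division. -/
theorem choose_mul_le {n b y k z : ℕ} (hn : 1 ≤ n) (hy : y ≤ 4 * n) (hk : k ≤ b)
    (hz : z ≤ 4 * n) : y.choose k * z ≤ (4 * n) ^ (b + 1) := by
  rw [pow_succ]
  refine Nat.mul_le_mul ?_ hz
  calc y.choose k ≤ y ^ k := Nat.choose_le_pow y k
    _ ≤ (4 * n) ^ k := Nat.pow_le_pow_left hy k
    _ ≤ (4 * n) ^ b := Nat.pow_le_pow_right (by omega) hk

theorem choose_le_bound {n b y k : ℕ} (hn : 1 ≤ n) (hy : y ≤ 4 * n) (hk : k ≤ b) :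
    y.choose k ≤ (4 * n) ^ (b + 1) := by
  simpa using choose_mul_le hn hy hk (show 1 ≤ 4 * n by omega)

theorem le_bound {n b x : ℕ} (hx : x ≤ 4 * n) : x ≤ (4 * n) ^ (b + 1) :=
  hx.trans (Nat.le_self_pow (by omega) _)

/-- Before pass `i`, register `20` holds `i`, register `21` holds `a - b + i` and register `19`
holds `C(a - b + i, i)`. -/
def binomBody : Program :=
  .seq (.arith .add 20 20 3) (.seq (.arith .add 21 21 3)
    (.seq (.arith .mul 19 19 21) (.arith .div 19 19 20)))

def binomInit : Program := .seq (.const 19 1) (.seq (.const 20 0) (.arith .sub 21 11 18))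

/-- Register `19` is set to the binomial coefficient of registers `11` and `18`. -/
def binomProg : Program := .seq binomInit (.whileLt 20 18 binomBody)

/-- Running through `C(a-b+i, i)` makes every division exact and keeps every intermediate number
within `(4n)^(b+1)`. -/
theorem binomProg_spec {n a b W : ℕ} (hn : 1 ≤ n) {σ₀ : MState} (hc : Consts n σ₀)
    (ha : σ₀.reg 11 = a) (hb : σ₀.reg 18 = b) (hba : b ≤ a) (han : a ≤ n)
    (hW : W = 2 * bitLen ((4 * n) ^ (b + 1))) :
    Tri binomProg σ₀ (3 * W + (b * (4 * W + W) + W)) fun τ => SameOff binomProg σ₀ τ ∧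
      τ.mem = σ₀.mem ∧ τ.reg 19 = a.choose b := by
  subst hW
  set W := 2 * bitLen ((4 * n) ^ (b + 1)) with hW
  have h1 := le_bound (n := n) (b := b) (show 1 ≤ 4 * n by omega)
  have h0 := le_bound (n := n) (b := b) (show 0 ≤ 4 * n by omega)
  have hale := le_bound (n := n) (b := b) (show a ≤ 4 * n by omega)
  have hble := le_bound (n := n) (b := b) (show b ≤ 4 * n by omega)
  refine Tri.mono (Tri.frame (P := binomProg) (R := fun τ => τ.mem = σ₀.mem ∧
    τ.reg 19 = a.choose b) ?_) le_rfl fun τ h => ⟨h.2, h.1⟩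
  refine Tri.seq (Tri.mono (Tri.of_vc (B := (4 * n) ^ (b + 1)) (P := binomInit)
    (R := fun τ => Consts n τ ∧ τ.reg 11 = a ∧ τ.reg 18 = b ∧ τ.reg 19 = 1 ∧ τ.reg 20 = 0 ∧
      τ.reg 21 = a - b ∧ τ.mem = σ₀.mem) ?_) le_rfl ?_)
  · simp only [binomInit, vc, setReg_reg, setReg_mem, ArithOp.eval, ha, hb, Nat.reduceEqDiff,
      if_true, if_false, and_true]
    exact ⟨h1, h0, hale, hble, by simp [setReg_reg, hc.reg0], by simp [setReg_reg, hc.reg2],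
      by simp [setReg_reg, hc.reg3]⟩
  · rintro σ₁ ⟨hc₁, ha₁, hb₁, h19, h20, h21, hm₁⟩
    refine Tri.mono (Tri.while_count (fun i σ => σ.mem = σ₀.mem ∧
      σ.reg 19 = (a - b + i).choose i ∧ σ.reg 20 = i ∧ σ.reg 21 = a - b + i) b (fun _ => 4 * W) W
      ⟨hm₁, by simp [h19], h20, by simp [h21]⟩ ?_ ?_) ?_ ?_
    · rintro i hi σ hs ⟨hm, h19, h20, h21⟩
      have hc := hc₁.of_sameOff hs
      have hb : σ.reg 18 = b := (hs 18 (by decide)).trans hb₁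
      have hile := le_bound (n := n) (b := b) (show i ≤ 4 * n by omega)
      refine ⟨by rw [h20, hb]; exact hi, guard_le (by rw [h20]; exact hile)
        (by rw [hb]; exact hble), ?_⟩
      refine Tri.of_vc (B := (4 * n) ^ (b + 1)) (P := binomBody) ?_
      simp only [binomBody, vc, setReg_reg, setReg_mem, ArithOp.eval, h19, h20, h21, hc.reg3,
        Nat.reduceEqDiff, if_true, if_false, choose_mul_succ_div, hm, true_and]
      exact ⟨hile, h1, le_bound (by omega), h1, choose_le_bound hn (by omega) (by omega),
        le_bound (by omega), choose_mul_le hn (by omega) (by omega) (by omega),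
        le_bound (by omega), by ring_nf, by ring⟩
    · rintro σ hs ⟨hm, h19, h20, h21⟩
      have hb : σ.reg 18 = b := (hs 18 (by decide)).trans hb₁
      rw [h20, hb]
      exact ⟨lt_irrefl _, guard_le hble hble⟩
    · simp
    · rintro τ ⟨⟨hm, h19, -⟩, -⟩
      rw [Nat.sub_add_cancel hba] at h19
      exact ⟨hm, h19⟩

/-! ### The program that ranks a block -/

theorem rankIn_eq_pred_add (D : Finset ℕ) {x : ℕ} (hx : 1 ≤ x) :
    rankIn D x = rankIn D (x - 1) + if x ∈ D then 1 else 0 := by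
  have h : D.filter (fun y => y ≤ x) =
      D.filter (fun y => y ≤ x - 1) ∪ if x ∈ D then {x} else ∅ := by
    ext y
    by_cases hxD : x ∈ D
    · simp only [Finset.mem_filter, hxD, if_true, Finset.mem_union, Finset.mem_singleton]
      constructor
      · rintro ⟨h1, h2⟩
        rcases h2.lt_or_eq with h | h
        · exact Or.inl ⟨h1, by omega⟩
        · exact Or.inr h
      · rintro (⟨h1, h2⟩ | rfl)
        · exact ⟨h1, by omega⟩
        · exact ⟨hxD, le_rfl⟩
    · simp only [Finset.mem_filter, hxD, if_false, Finset.mem_union, Finset.notMem_empty, or_false]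
      refine and_congr_right fun h1 => ?_
      have : y ≠ x := by rintro rfl; exact hxD h1
      omega
  rw [rankIn, h, Finset.card_union_of_disjoint, rankIn]
  · split_ifs <;> simp
  · split_ifs
    · simp only [Finset.disjoint_singleton_right, Finset.mem_filter, not_and]
      omega
    · exact Finset.disjoint_empty_right _

/-- The contribution of the elements of `B` up to `x` to the rank of the block `B` of `D`. -/
def partialRank (D B : Finset ℕ) (x : ℕ) : ℕ :=
  decFunFormula (((B.filter fun y => y ≤ x).sort (· ≥ ·)).map (rankIn D))

theorem partialRank_of_notMem {D B : Finset ℕ} {x : ℕ} (hx : 1 ≤ x) (h : x ∉ B) :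
    partialRank D B x = partialRank D B (x - 1) := by
  have : B.filter (fun y => y ≤ x) = B.filter fun y => y ≤ x - 1 := by
    refine Finset.filter_congr fun y hy => ?_
    have : y ≠ x := by rintro rfl; exact h hy
    omega
  rw [partialRank, this, partialRank]

/-- The new largest element `x` becomes the head of the decreasing list, and its lower index is the
length of that list, `rankIn B x`. -/
theorem partialRank_of_mem {D B : Finset ℕ} {x : ℕ} (hx : 1 ≤ x) (h : x ∈ B) :
    partialRank D B x = (rankIn D x - 1).choose (rankIn B x) + partialRank D B (x - 1) := by
  have hsort : (B.filter fun y => y ≤ x).sort (· ≥ ·) =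
      x :: (B.filter fun y => y ≤ x - 1).sort (· ≥ ·) := by
    refine List.Pairwise.eq_of_mem_iff (Finset.sortedGT_sort _).pairwise
      (List.pairwise_cons.2 ⟨fun y hy => ?_, (Finset.sortedGT_sort _).pairwise⟩) fun y => ?_
    · simp only [Finset.mem_sort, Finset.mem_filter] at hy
      omega
    · simp only [Finset.mem_sort, Finset.mem_filter, List.mem_cons]
      constructor
      · rintro ⟨h1, h2⟩
        rcases h2.lt_or_eq with h | h
        · exact Or.inr ⟨h1, by omega⟩
        · exact Or.inl h
      · rintro (rfl | ⟨h1, h2⟩)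
        · exact ⟨h, le_rfl⟩
        · exact ⟨h1, by omega⟩
  have hlen : (B.filter fun y => y ≤ x - 1).card + 1 = rankIn B x := by
    rw [rankIn_eq_pred_add B hx, if_pos h, rankIn]
  rw [partialRank, hsort, List.map_cons, decFunFormula, List.length_map, Finset.length_sort, hlen,
    partialRank]

/-- `mem[n + z]` is the label `f z` for `z ∈ D` and `0` for the other inner vertices `z`. -/
def LabelMem (n : ℕ) (f : ℕ → ℕ) (D : Finset ℕ) (M : ℕ → ℕ) : Prop :=
  ∀ z ∈ Finset.Ico 2 n, M (n + z) = if z ∈ D then f z else 0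

/-- Register `16` is set to a number that is `0` if and only if registers `x` and `y` agree. -/
def distProg (x y : ℕ) : Program :=
  .seq (.arith .sub 16 x y) (.seq (.arith .sub 17 y x) (.arith .add 16 16 17))

/-- Register `26` runs down through the vertices `x`. Registers `25` and `24` hold the ranks `Y` and
`k` of `x` in `D` and in `B`, register `22` holds `C(Y, k)`, and register `23` accumulates the rank
of the block. Register `28` becomes `C(Y-1, k)`: this is the summand due to `x` if `x ∈ B`, when
subtracting it leaves `C(Y-1, k-1)`; otherwise it is the new coefficient. Elements of `B` get label
`0` and are skipped from then on. -/
def rankBlockBody : Program :=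
  .seq (.arith .add 7 0 26) (.seq (.load 27 7) (.seq
    (.ifLt 2 27
      (.seq (.arith .sub 28 25 24) (.seq (.arith .mul 28 22 28) (.seq (.arith .div 28 28 25)
        (.seq (distProg 27 13) (.seq
          (.ifLt 2 16 (.arith .add 22 28 2)
            (.seq (.arith .add 23 23 28) (.seq (.arith .sub 22 22 28)
              (.seq (.arith .sub 24 24 3) (.store 7 2)))))
          (.arith .sub 25 25 3))))))
      .skip)
    (.arith .sub 26 26 3)))

/-- The state of the loop that ranks a block, when `x` is the next vertex. -/
structure RankInv (n : ℕ) (f : ℕ → ℕ) (D B : Finset ℕ) (total : ℕ) (M : ℕ → ℕ) (x : ℕ)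
    (σ : MState) : Prop where
  low : ∀ i ≤ n, σ.mem i = M i
  labels : ∀ z ∈ Finset.Ico 2 n, σ.mem (n + z) = if z ∈ D ∧ ¬ (z ∈ B ∧ x < z) then f z else 0
  reg26 : σ.reg 26 = x
  reg25 : σ.reg 25 = rankIn D x
  reg24 : σ.reg 24 = rankIn B x
  reg22 : σ.reg 22 = (rankIn D x).choose (rankIn B x)
  reg23 : σ.reg 23 + partialRank D B x = total

/-- The accumulator together with the contribution of the elements not yet visited stays constant.
No sorting is needed, because the scan meets the elements of the block in decreasing order. -/
theorem rankBlockLoop_spec {n b v W : ℕ} (hn : 2 ≤ n) {f : ℕ → ℕ} {D B : Finset ℕ}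
    (hD : D ⊆ Finset.Ico 2 n) (hB : B = D.filter fun x => f x = v) (hb : B.card = b)
    (hf : ∀ x ∈ D, 1 ≤ f x ∧ f x ≤ n) (hv : v ≤ n)
    {σ₀ : MState} (hc : Consts n σ₀) (h13 : σ₀.reg 13 = v)
    (h22 : σ₀.reg 22 = D.card.choose b) (h23 : σ₀.reg 23 = 0) (h24 : σ₀.reg 24 = b)
    (h25 : σ₀.reg 25 = D.card) (h26 : σ₀.reg 26 = n - 1) (hM : LabelMem n f D σ₀.mem)
    (hW : W = 2 * bitLen ((4 * n) ^ (b + 1))) :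
    Tri (.whileLt 3 26 rankBlockBody) σ₀ ((n - 2) * (18 * W + W) + W) fun τ =>
      SameOff rankBlockBody σ₀ τ ∧ (∀ i ≤ n, τ.mem i = σ₀.mem i) ∧ LabelMem n f (D \ B) τ.mem ∧
      τ.reg 23 = decFunFormula ((B.sort (· ≥ ·)).map (rankIn D)) := by
  subst hW
  set W := 2 * bitLen ((4 * n) ^ (b + 1)) with hW
  have hsmall : ∀ {x : ℕ}, x ≤ 4 * n → x ≤ (4 * n) ^ (b + 1) := fun h => le_bound h
  have hDn : D.card ≤ n := by
    refine (Finset.card_le_card hD).trans ?_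
    rw [Nat.card_Ico]
    omega
  have hbn : b ≤ n := by
    rw [← hb]
    refine (Finset.card_le_card ?_).trans hDn
    rw [hB]
    exact Finset.filter_subset _ _
  have hBD : B ⊆ D := by rw [hB]; exact Finset.filter_subset _ _
  have hfull : ∀ E : Finset ℕ, E ⊆ D → E.filter (fun y => y ≤ n - 1) = E := by
    intro E hE
    refine Finset.filter_true_of_mem fun y hy => ?_
    have := Finset.mem_Ico.1 (hD (hE hy))
    omega
  have hempty : ∀ E : Finset ℕ, E ⊆ D → E.filter (fun y => y ≤ 1) = ∅ := by
    intro E hE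
    refine Finset.filter_false_of_mem fun y hy => ?_
    have := Finset.mem_Ico.1 (hD (hE hy))
    omega
  let total := decFunFormula ((B.sort (· ≥ ·)).map (rankIn D))
  have htotal : total ≤ (4 * n) ^ (b + 1) := by
    have h1 := decFunFormula_lt (rankSeq_mem_decFun hBD)
    rw [hb] at h1
    exact h1.le.trans (choose_le_bound (by omega) (by omega) le_rfl)
  let I : ℕ → MState → Prop := fun i σ => RankInv n f D B total σ₀.mem (n - 1 - i) σ
  refine Tri.mono (Tri.while_count I (n - 2) (fun _ => 18 * W) W ?_ ?_ ?_) ?_ ?_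
  · refine ⟨fun _ _ => rfl, fun z hz => ?_, by simpa using h26, ?_, ?_, ?_, ?_⟩
    · rw [hM z hz]
      have := Finset.mem_Ico.1 hz
      have h : ¬ (z ∈ B ∧ n - 1 - 0 < z) := by omega
      simp only [h, not_false_eq_true, and_true]
    · simp only [Nat.sub_zero, rankIn, hfull D subset_rfl, h25]
    · simp only [Nat.sub_zero, rankIn, hfull B hBD, h24, hb]
    · simp only [Nat.sub_zero, rankIn, hfull B hBD, hfull D subset_rfl, h22, hb]
    · simp only [Nat.sub_zero, h23, zero_add, partialRank, hfull B hBD, total]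
  · rintro i hi σ hs ⟨hlow, hmem, h26, h25, h24, h22, h23⟩
    have hc := hc.of_sameOff hs
    have h13 : σ.reg 13 = v := (hs 13 (by decide)).trans h13
    have hi1 : n - 1 - (i + 1) = n - 1 - i - 1 := by omega
    simp only [I, hi1]
    set x := n - 1 - i with hx
    have hxI : x ∈ Finset.Ico 2 n := by simp; omega
    have hx2 := Finset.mem_Ico.1 hxI
    refine ⟨by rw [hc.reg3, h26]; omega, guard_le (by rw [hc.reg3]; exact hsmall (by omega))
      (by rw [h26]; exact hsmall (by omega)), ?_⟩
    refine Tri.of_vc (B := (4 * n) ^ (b + 1)) (P := rankBlockBody) ?_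
    have hYD := rankIn_eq_pred_add D (show 1 ≤ x by omega)
    have hYB := rankIn_eq_pred_add B (show 1 ≤ x by omega)
    have hYn := (rankIn_le_card D x).trans hDn
    have hkb := (rankIn_le_card B x).trans hb.le
    have hmx : σ.mem (n + x) = if x ∈ D then f x else 0 := by
      rw [hmem x hxI]
      simp
    have hmem' : ∀ z ∈ Finset.Ico 2 n, z ≠ x → σ.mem (n + z) =
        if z ∈ D ∧ ¬ (z ∈ B ∧ x - 1 < z) then f z else 0 := by
      intro z hz hne
      rw [hmem z hz]
      have : x - 1 < z ↔ x < z := by omega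
      simp only [this]
    have hacc : σ.reg 23 ≤ (4 * n) ^ (b + 1) := (by omega : σ.reg 23 ≤ total).trans htotal
    have hC := choose_le_bound (n := n) (y := rankIn D x) (k := rankIn B x) (by omega) (by omega) hkb
    have hC' := choose_le_bound (n := n) (y := rankIn D x - 1) (k := rankIn B x) (by omega)
      (by omega) hkb
    have hCm := choose_mul_le (n := n) (y := rankIn D x) (k := rankIn B x)
      (z := rankIn D x - rankIn B x) (by omega) (by omega) hkb (by omega)
    by_cases hxD : x ∈ D
    · rw [if_pos hxD] at hYD hmx
      obtain ⟨hf1, hfn⟩ := hf x hxD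
      have hY1 : 1 ≤ rankIn D x := rankIn_pos hxD
      have hd := choose_mul_pred_div (k := rankIn B x) hY1
      simp only [rankBlockBody, distProg, vc, setReg_reg, setReg_mem, setMem_reg, ArithOp.eval,
        hc.reg0, hc.reg2, hc.reg3, h13, h22, h24, h25, h26, hmx, hd, Nat.reduceEqDiff,
        if_true, if_false]
      by_cases hxB : x ∈ B
      · rw [if_pos hxB] at hYB
        have hfv : f x = v := by rw [hB] at hxB; exact (Finset.mem_filter.1 hxB).2
        have hpr := partialRank_of_mem (D := D) (show 1 ≤ x by omega) hxB
        have hch := choose_pred_add (k := rankIn B (x - 1)) hY1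
        rw [← hYB] at hch
        repeat' first | refine And.intro ?_ ?_ | intro _
        all_goals first | exact hC | exact hC' | exact hCm | exact hacc | omega |
          exact hsmall (by omega) | skip
        refine ⟨fun j hj => ?_, fun z hz => ?_, ?_, ?_, ?_, ?_, ?_⟩
        · simp only [setReg_mem, setMem_mem]
          rw [Function.update_of_ne (by omega)]
          exact hlow j hj
        · simp only [setReg_mem, setMem_mem]
          by_cases hzx : z = x
          · subst hzx
            rw [Function.update_self, if_neg]
            rintro ⟨-, h⟩
            exact h ⟨hxB, by omega⟩
          · rw [Function.update_of_ne (by omega)]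
            exact hmem' z hz hzx
        all_goals simp only [setReg_reg, setMem_reg, Nat.reduceEqDiff, if_true, if_false, h22,
          h24, h25, h26]
        · omega
        · omega
        · rw [← hch, Nat.add_sub_cancel_left]
          congr 1
          omega
        · omega
      · rw [if_neg hxB] at hYB
        have hfv : f x ≠ v := fun h => hxB (by rw [hB]; exact Finset.mem_filter.2 ⟨hxD, h⟩)
        have hpr := partialRank_of_notMem (D := D) (show 1 ≤ x by omega) hxB
        repeat' first | refine And.intro ?_ ?_ | intro _
        all_goals first | exact hC | exact hC' | exact hCm | exact hacc | omega |
          exact hsmall (by omega) | skip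
        refine ⟨hlow, fun z hz => ?_, ?_, ?_, ?_, ?_, ?_⟩
        · simp only [setReg_mem]
          by_cases hzx : z = x
          · subst hzx
            simp only [hmx, hxD, hxB, false_and, not_false_eq_true, and_true, if_true]
          · exact hmem' z hz hzx
        all_goals simp only [setReg_reg, Nat.reduceEqDiff, if_true, if_false,
          h24, h25, h26]
        · omega
        · omega
        · rw [show rankIn D (x - 1) = rankIn D x - 1 by omega, hYB]
          rfl
        · omega
    · have hxB : x ∉ B := fun h => hxD (hBD h)
      rw [if_neg hxD] at hYD hmx
      rw [if_neg hxB] at hYB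
      have hpr := partialRank_of_notMem (D := D) (show 1 ≤ x by omega) hxB
      simp only [rankBlockBody, vc, setReg_reg, setReg_mem, ArithOp.eval, hc.reg0, hc.reg2,
        hc.reg3, h26, hmx, Nat.reduceEqDiff, if_true, if_false]
      repeat' first | refine And.intro ?_ ?_ | intro _
      all_goals first | omega | exact hsmall (by omega) | skip
      refine ⟨hlow, fun z hz => ?_, ?_, ?_, ?_, ?_, ?_⟩
      · simp only [setReg_mem]
        by_cases hzx : z = x
        · subst hzx
          simp only [hmx, hxD, false_and, if_false]
        · exact hmem' z hz hzx
      all_goals simp only [setReg_reg, Nat.reduceEqDiff, if_true, if_false, h22, h24, h25, h26]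
      · omega
      · omega
      · rw [hYD, hYB, add_zero, add_zero]
      · omega
  · rintro σ hs ⟨-, -, h26, -⟩
    rw [(hc.of_sameOff hs).reg3, h26]
    exact ⟨by omega, guard_le (hsmall (by omega)) (hsmall (by omega))⟩
  · simp
  · rintro τ ⟨⟨hlow, hmem, h26, h25, h24, h22, h23⟩, hs⟩
    -- The scan stops at `1`, below all elements of `D`; nothing more is contributed and all labels
    -- of `B` are erased.
    have h1 : n - 1 - (n - 2) = 1 := by omega
    rw [h1] at hmem h23
    refine ⟨hs, hlow, fun z hz => ?_, ?_⟩
    · rw [hmem z hz]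
      have := Finset.mem_Ico.1 hz
      have h : 1 < z := by omega
      simp only [h, and_true, Finset.mem_sdiff]
    · simpa [partialRank, hempty B hBD, decFunFormula] using h23

end CayleyRank

/-! ### Ranking one block, and its cost -/

namespace CayleyRank

def rankBlockInit : Program :=
  .seq (.arith .add 22 19 2) (.seq (.const 23 0) (.seq (.arith .add 24 18 2)
    (.seq (.arith .add 25 11 2) (.arith .sub 26 0 3))))

/-- One step of Horner's rule: register `4` is multiplied by the number of choices for this block,
and the rank of the block is added. -/
def rankBlockFinish : Program :=
  .seq (.arith .mul 4 4 19) (.seq (.arith .add 4 4 23) (.arith .sub 11 11 18))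

/-- Process the block with label register `13` and size one less than register `12`. -/
def rankBlock : Program :=
  .seq (.arith .sub 18 12 3) (.seq binomProg (.seq rankBlockInit
    (.seq (.whileLt 3 26 rankBlockBody) rankBlockFinish)))

theorem bitLen_pow_le (m k : ℕ) (hk : 1 ≤ k) : bitLen (m ^ k) ≤ k * bitLen m := by
  refine bitLen_le_of_lt_two_pow (Nat.mul_pos hk (one_le_bitLen m)) ?_
  rw [mul_comm, pow_mul]
  exact Nat.pow_lt_pow_left (lt_two_pow_bitLen m) (by omega)

/-- The scan makes `O(n)` operations on numbers of `O((b+1) log n)` bits, and the Horner step a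
bounded number on numbers of `O(n log n)` bits; both fit into `O(n (b+1) log n)`. -/
theorem rankBlock_spec {n b v : ℕ} (hn : 2 ≤ n) {f : ℕ → ℕ} {D B : Finset ℕ}
    (hD : D ⊆ Finset.Ico 2 n) (hB : B = D.filter fun x => f x = v) (hb : B.card = b)
    (hf : ∀ x ∈ D, 1 ≤ f x ∧ f x ≤ n) (hv : v ≤ n)
    {σ₀ : MState} (hc : Consts n σ₀) (h11 : σ₀.reg 11 = D.card) (h12 : σ₀.reg 12 = b + 1)
    (h13 : σ₀.reg 13 = v) (hM : LabelMem n f D σ₀.mem)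
    (hbig : σ₀.reg 4 * D.card.choose b + decFunFormula ((B.sort (· ≥ ·)).map (rankIn D)) ≤
      (4 * n) ^ n) :
    Tri rankBlock σ₀ (60 * (n * ((b + 1) * (2 * bitLen (4 * n))))) fun τ =>
      SameOff rankBlock σ₀ τ ∧ (∀ i ≤ n, τ.mem i = σ₀.mem i) ∧ LabelMem n f (D \ B) τ.mem ∧
      τ.reg 4 = σ₀.reg 4 * D.card.choose b +
        decFunFormula ((B.sort (· ≥ ·)).map (rankIn D)) ∧
      τ.reg 11 = (D \ B).card := by
  have hBD : B ⊆ D := by rw [hB]; exact Finset.filter_subset _ _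
  have hDn : D.card + 2 ≤ n := by
    have := Finset.card_le_card hD
    rw [Nat.card_Ico] at this
    omega
  have hba : b ≤ D.card := hb ▸ Finset.card_le_card hBD
  set total := decFunFormula ((B.sort (· ≥ ·)).map (rankIn D)) with htot
  set W := 2 * bitLen ((4 * n) ^ (b + 1)) with hW
  set V := 2 * bitLen ((4 * n) ^ n) with hV
  have hsmall : ∀ {x : ℕ}, x ≤ 4 * n → x ≤ (4 * n) ^ (b + 1) := fun h => le_bound h
  have hCpos : 1 ≤ D.card.choose b := Nat.choose_pos hba
  have hCle : D.card.choose b ≤ (4 * n) ^ n :=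
    (choose_le_bound (by omega) (by omega) le_rfl).trans
      (Nat.pow_le_pow_right (by omega) (by omega))
  have hR : σ₀.reg 4 ≤ (4 * n) ^ n :=
    (Nat.le_mul_of_pos_right _ hCpos).trans ((Nat.le_add_right _ _).trans hbig)
  have hCW := choose_le_bound (n := n) (y := D.card) (by omega) (by omega) (le_refl b)
  refine Tri.mono (Tri.frame (c := 1 * W + ((3 * W + (b * (4 * W + W) + W)) + (5 * W +
    (((n - 2) * (18 * W + W) + W) + 3 * V)))) (R := fun τ => (∀ i ≤ n, τ.mem i = σ₀.mem i) ∧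
      LabelMem n f (D \ B) τ.mem ∧ τ.reg 4 = σ₀.reg 4 * D.card.choose b + total ∧
      τ.reg 11 = (D \ B).card) ?_) ?_ fun τ h => ⟨h.2, h.1⟩
  · refine Tri.seq (Tri.mono (Tri.of_vc (B := (4 * n) ^ (b + 1)) (P := .arith .sub 18 12 3)
      (R := fun τ => τ = σ₀.setReg 18 b) ?_) le_rfl ?_)
    · simp only [vc, ArithOp.eval, h12, hc.reg3, Nat.add_sub_cancel, and_true]
      exact ⟨hsmall (by omega), hsmall (by omega)⟩
    · rintro _ rfl
      have hc1 : Consts n (σ₀.setReg 18 b) := ⟨by simp [setReg_reg, hc.reg0],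
        by simp [setReg_reg, hc.reg2], by simp [setReg_reg, hc.reg3]⟩
      refine Tri.seq (Tri.mono (binomProg_spec (a := D.card) (b := b) (by omega) hc1
        (by simp [setReg_reg, h11]) (by simp [setReg_reg]) hba (by omega) hW) le_rfl ?_)
      rintro σ₁ ⟨hs₁, hm₁, h19⟩
      have hc2 := hc1.of_sameOff hs₁
      have e11 : σ₁.reg 11 = D.card := by rw [hs₁ 11 (by decide)]; simp [setReg_reg, h11]
      have e13 : σ₁.reg 13 = v := by rw [hs₁ 13 (by decide)]; simp [setReg_reg, h13]
      have e18 : σ₁.reg 18 = b := by rw [hs₁ 18 (by decide)]; simp [setReg_reg]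
      have e4 : σ₁.reg 4 = σ₀.reg 4 := by rw [hs₁ 4 (by decide)]; simp [setReg_reg]
      refine Tri.seq (Tri.mono (Tri.frame (Tri.of_vc (B := (4 * n) ^ (b + 1))
        (P := rankBlockInit) (R := fun τ => τ.mem = σ₁.mem ∧ τ.reg 22 = D.card.choose b ∧
          τ.reg 23 = 0 ∧ τ.reg 24 = b ∧ τ.reg 25 = D.card ∧ τ.reg 26 = n - 1) ?_)) le_rfl ?_)
      · simp only [rankBlockInit, vc, setReg_reg, setReg_mem, ArithOp.eval, hc2.reg0, hc2.reg2,
          hc2.reg3, e11, e18, h19, Nat.reduceEqDiff, if_true, if_false, add_zero, and_true]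
        exact ⟨hCW, hsmall (by omega), hsmall (by omega), hsmall (by omega), hsmall (by omega),
          hsmall (by omega), hsmall (by omega), hsmall (by omega), hsmall (by omega)⟩
      · rintro σ₂ ⟨⟨hm₂, h22, h23, h24, h25, h26⟩, hs₂⟩
        have hM2 : LabelMem n f D σ₂.mem := by rw [hm₂, hm₁]; exact hM
        refine Tri.seq (Tri.mono (rankBlockLoop_spec hn hD hB hb hf hv (hc2.of_sameOff hs₂)
          ((hs₂ 13 (by decide)).trans e13) h22 h23 h24 h25 h26 hM2 hW) le_rfl ?_)
        rintro σ₃ ⟨hs₃, hlow, hlab, hacc⟩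
        have e4' : σ₃.reg 4 = σ₀.reg 4 :=
          (hs₃ 4 (by decide)).trans ((hs₂ 4 (by decide)).trans e4)
        have e11' : σ₃.reg 11 = D.card :=
          (hs₃ 11 (by decide)).trans ((hs₂ 11 (by decide)).trans e11)
        have e18' : σ₃.reg 18 = b :=
          (hs₃ 18 (by decide)).trans ((hs₂ 18 (by decide)).trans e18)
        have e19' : σ₃.reg 19 = D.card.choose b :=
          (hs₃ 19 (by decide)).trans ((hs₂ 19 (by decide)).trans h19)
        refine Tri.of_vc (B := (4 * n) ^ n) (P := rankBlockFinish) ?_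
        have hn' : ∀ {x : ℕ}, x ≤ n → x ≤ (4 * n) ^ n := fun h =>
          (show _ ≤ 4 * n by omega).trans (Nat.le_self_pow (by omega) _)
        simp only [rankBlockFinish, vc, setReg_reg, setReg_mem, ArithOp.eval, e4', e11', e18', e19',
          hacc, Nat.reduceEqDiff, if_true, if_false]
        refine ⟨hR, hCle, (Nat.le_add_right _ _).trans hbig, (Nat.le_add_left _ _).trans hbig,
          hn' (by omega), hn' (by omega), fun i hi => ?_, hlab, rfl, ?_⟩
        · rw [hlow i hi, hm₂, hm₁, setReg_mem]
        · rw [Finset.card_sdiff_of_subset hBD, hb]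
  · have h1 := bitLen_pow_le (4 * n) (b + 1) (by omega)
    have h2 := bitLen_pow_le (4 * n) n (by omega)
    set Z := 2 * bitLen (4 * n) with hZ
    have h3 : W ≤ (b + 1) * Z := by rw [hW, hZ]; nlinarith
    have h4 : V ≤ n * Z := by rw [hV, hZ]; nlinarith
    have h5 : n * Z ≤ n * ((b + 1) * Z) :=
      Nat.mul_le_mul_left _ (Nat.le_mul_of_pos_left _ (by omega))
    have h6 : n * W ≤ n * ((b + 1) * Z) := Nat.mul_le_mul_left _ h3
    have h7 : b * W ≤ n * W := Nat.mul_le_mul_right _ (by omega)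
    have h8 : (n - 2) * W ≤ n * W := Nat.mul_le_mul_right _ (by omega)
    have h9 : W ≤ n * W := Nat.le_mul_of_pos_left _ (by omega)
    have e1 : b * (4 * W + W) = 5 * (b * W) := by ring
    have e2 : (n - 2) * (18 * W + W) = 19 * ((n - 2) * W) := by ring
    rw [e1, e2]
    omega

/-! ### The blocks that remain -/

/-- The blocks that are not smaller than `(z, v)` in the order by size and index. -/
def restBlocks {n : ℕ} (s : Vtx n → ℕ) (z v : ℕ) : List (Vtx n) :=
  (blockOrder s).filter fun u => z < s u ∨ (s u = z ∧ v ≤ (u : ℕ))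

theorem pairwise_blockOrder {n : ℕ} (s : Vtx n → ℕ) :
    (blockOrder s).Pairwise fun u w => toLex (s u, u) < toLex (s w, w) := by
  rw [blockOrder, List.pairwise_map]
  refine List.Pairwise.imp_of_mem ?_ (Finset.sortedLT_sort _).pairwise
  intro a b ha hb hab
  simp only [Finset.mem_sort, Finset.mem_image, Finset.mem_filter, Finset.mem_univ,
    true_and] at ha hb
  obtain ⟨u, -, rfl⟩ := ha
  obtain ⟨w, -, rfl⟩ := hb
  exact hab

theorem mem_restBlocks {n : ℕ} {s : Vtx n → ℕ} {z v : ℕ} {u : Vtx n} :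
    u ∈ restBlocks s z v ↔ 1 < s u ∧ (z < s u ∨ (s u = z ∧ v ≤ (u : ℕ))) := by
  simp [restBlocks, mem_blockOrder]

/-- Together with the next two lemmas, this shows that trying the degrees `z` in increasing order,
and for each `z` all vertices in increasing order, meets the blocks in the order of `blockOrder`.
Here `v` is the least remaining block; both lists are strictly sorted and have the same members. -/
theorem restBlocks_eq_cons {n : ℕ} {s : Vtx n → ℕ} {z : ℕ} {v : Vtx n} (hz : 2 ≤ z)
    (hv : s v = z) : restBlocks s z v = v :: restBlocks s z (v + 1) := by
  have hp : ∀ z v, (restBlocks s z v).Pairwise fun u w => toLex (s u, u) < toLex (s w, w) :=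
    fun z v => (pairwise_blockOrder s).filter _
  have : Std.Antisymm fun u w : Vtx n => toLex (s u, u) < toLex (s w, w) :=
    ⟨fun _ _ h h' => absurd h (lt_asymm h')⟩
  have : Std.Irrefl fun u w : Vtx n => toLex (s u, u) < toLex (s w, w) := ⟨fun _ => lt_irrefl _⟩
  refine List.Pairwise.eq_of_mem_iff (hp z v) (List.pairwise_cons.2 ⟨fun u hu => ?_, hp z (v + 1)⟩)
    fun u => ?_
  · rw [mem_restBlocks] at hu
    rw [Prod.Lex.toLex_lt_toLex]
    rcases hu.2 with h | ⟨h, h'⟩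
    · exact Or.inl (by simpa [hv] using h)
    · exact Or.inr ⟨hv.trans h.symm, Subtype.mk_lt_mk.2 (by omega)⟩
  · rw [List.mem_cons, mem_restBlocks, mem_restBlocks]
    constructor
    · rintro ⟨h1, h2 | ⟨h2, h3⟩⟩
      · exact Or.inr ⟨h1, Or.inl h2⟩
      · by_cases huv : u = v
        · exact Or.inl huv
        · have : (u : ℕ) ≠ v := fun h => huv (Subtype.ext h)
          exact Or.inr ⟨h1, Or.inr ⟨h2, by omega⟩⟩
    · rintro (rfl | ⟨h1, h2 | ⟨h2, h3⟩⟩)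
      · exact ⟨by omega, Or.inr ⟨hv, le_rfl⟩⟩
      · exact ⟨h1, Or.inl h2⟩
      · exact ⟨h1, Or.inr ⟨h2, by omega⟩⟩

theorem restBlocks_succ_of_ne {n : ℕ} {s : Vtx n → ℕ} {z : ℕ} {v : Vtx n} (hv : s v ≠ z) :
    restBlocks s z v = restBlocks s z (v + 1) := by
  refine List.filter_congr fun u _ => ?_
  by_cases huv : u = v
  · subst huv
    simp [hv]
  · have : (u : ℕ) ≠ v := fun h => huv (Subtype.ext h)
    have : (v : ℕ) ≤ u ↔ (v : ℕ) + 1 ≤ u := by omega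
    simp [this]

theorem restBlocks_succ {n : ℕ} (s : Vtx n → ℕ) (z : ℕ) :
    restBlocks s z (n + 1) = restBlocks s (z + 1) 1 := by
  refine List.filter_congr fun u _ => ?_
  have := Finset.mem_Icc.1 u.2
  simp only [decide_eq_decide]
  omega

theorem restBlocks_two {n : ℕ} (s : Vtx n → ℕ) : restBlocks s 2 1 = blockOrder s := by
  refine List.filter_eq_self.2 fun u hu => ?_
  have := Finset.mem_Icc.1 u.2
  have := mem_blockOrder.1 hu
  simp only [decide_eq_true_eq]
  omega

theorem restBlocks_eq_nil {n : ℕ} {s : Vtx n → ℕ} {z v : ℕ} (h : ∀ u, s u < z) :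
    restBlocks s z v = [] := by
  refine List.filter_eq_nil_iff.2 fun u _ => ?_
  have := h u
  simp only [decide_eq_true_eq]
  omega

theorem nodup_restBlocks {n : ℕ} (s : Vtx n → ℕ) (z v : ℕ) : (restBlocks s z v).Nodup :=
  (nodup_blockOrder s).filter _

/-- The factorials telescope: `C(a, b) * (a-b)!` is at most `a!`. With the next lemma, this is the
reason why ranks have only `O(n log n)` bits. -/
theorem chooseProd_shapeOfSizes_le (bs : List ℕ) : ∀ a : ℕ,
    chooseProd (shapeOfSizes a bs) ≤ a.factorial := by
  induction bs with
  | nil => intro a; simpa [shapeOfSizes, chooseProd] using Nat.one_le_iff_ne_zero.2 a.factorial_ne_zero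
  | cons b bs ih =>
    intro a
    rw [shapeOfSizes, chooseProd_cons]
    by_cases hb : b ≤ a
    · refine (Nat.mul_le_mul_left _ (ih _)).trans ?_
      rw [← Nat.choose_mul_factorial_mul_factorial hb]
      refine Nat.mul_le_mul_right _ (Nat.le_mul_of_pos_right _ (Nat.factorial_pos b))
    · rw [Nat.choose_eq_zero_of_lt (by omega), zero_mul]
      exact Nat.zero_le _

theorem chooseProd_shape_le {n : ℕ} (hn : 1 ≤ n) (s : Vtx n → ℕ) :
    chooseProd (shape s) ≤ (4 * n) ^ n := by
  refine (chooseProd_shapeOfSizes_le _ _).trans ((Nat.factorial_le_pow _).trans ?_)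
  exact (Nat.pow_le_pow_left (by omega) _).trans (Nat.pow_le_pow_right (by omega) (by omega))

/-- The cost of a double loop in which the weight `X * g i` is charged once for each `i`. -/
theorem sum_sum_cost_le {m n A X : ℕ} (g h : ℕ → ℕ) (hh : Set.InjOn h (Finset.range m)) :
    ∑ j ∈ Finset.range m, ∑ i ∈ Finset.range n, (A + if g i = h j then X * g i else 0) ≤
      m * (n * A) + X * ∑ i ∈ Finset.range n, g i := by
  simp only [Finset.sum_add_distrib, Finset.sum_const, Finset.card_range, smul_eq_mul]
  refine Nat.add_le_add_left ?_ _
  rw [Finset.sum_comm, Finset.mul_sum]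
  refine Finset.sum_le_sum fun i _ => ?_
  rw [← Finset.sum_filter, Finset.sum_const, smul_eq_mul]
  refine (Nat.mul_le_mul_right _ (?_ : _ ≤ 1)).trans (one_mul _).le
  refine Finset.card_le_one.2 fun j hj k hk => ?_
  simp only [Finset.mem_filter] at hj hk
  exact hh (by simpa using hj.1) (by simpa using hk.1) (hj.2.symm.trans hk.2)

end CayleyRank

namespace CayleyRank

/-! ### The ranking program -/

/-- `f` gives the index of the block that contains an inner vertex. -/
def IsLabelling {n : ℕ} (p : Vtx n → Finset ℕ) (f : ℕ → ℕ) : Prop :=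
  ∀ x ∈ Finset.Ico 2 n, ∃ v : Vtx n, f x = v ∧ x ∈ p v

theorem IsLabelling.mem_iff {n : ℕ} {s : Vtx n → ℕ} {p : Vtx n → Finset ℕ} {f : ℕ → ℕ}
    (hf : IsLabelling p f) (hp : p ∈ setPartitions s) {x : ℕ} {v : Vtx n} :
    x ∈ p v ↔ x ∈ Finset.Ico 2 n ∧ f x = v := by
  constructor
  · intro h
    have hx : x ∈ Finset.Ico 2 n := by
      rw [← hp.2.1]
      exact Finset.mem_biUnion.2 ⟨v, Finset.mem_univ v, h⟩
    obtain ⟨u, hu, hxu⟩ := hf x hx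
    obtain rfl : u = v := by
      by_contra hne
      exact Finset.disjoint_left.1 (hp.1 hne) hxu h
    exact ⟨hx, hu⟩
  · rintro ⟨hx, h⟩
    obtain ⟨u, hu, hxu⟩ := hf x hx
    obtain rfl : u = v := Subtype.ext (hu.symm.trans h)
    exact hxu

/-- The inner vertices whose label belongs to a list. -/
def labelSupport {n : ℕ} (f : ℕ → ℕ) (rest : List (Vtx n)) : Finset ℕ :=
  (Finset.Ico 2 n).filter fun x => f x ∈ rest.map Subtype.val

theorem labelSupport_cons {n : ℕ} {s : Vtx n → ℕ} {p : Vtx n → Finset ℕ} {f : ℕ → ℕ}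
    (hf : IsLabelling p f) (hp : p ∈ setPartitions s) {v : Vtx n} {rest : List (Vtx n)}
    (hnd : (v :: rest).Nodup) :
    (labelSupport f (v :: rest)).filter (fun x => f x = v) = p v ∧
      labelSupport f (v :: rest) \ p v = labelSupport f rest := by
  constructor
  · ext x
    rw [Finset.mem_filter, hf.mem_iff hp, labelSupport, Finset.mem_filter]
    constructor
    · rintro ⟨⟨h1, -⟩, h2⟩
      exact ⟨h1, h2⟩
    · rintro ⟨h1, h2⟩
      exact ⟨⟨h1, by simp [h2]⟩, h2⟩
  · ext x
    rw [Finset.mem_sdiff, hf.mem_iff hp, labelSupport, labelSupport, Finset.mem_filter,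
      Finset.mem_filter, List.map_cons, List.mem_cons]
    constructor
    · rintro ⟨⟨h1, h2⟩, h3⟩
      exact ⟨h1, h2.resolve_left fun h => h3 ⟨h1, h⟩⟩
    · rintro ⟨h1, h2⟩
      refine ⟨⟨h1, Or.inr h2⟩, fun h => ?_⟩
      rw [h.2] at h2
      obtain ⟨u, hu, huv⟩ := List.mem_map.1 h2
      rw [Subtype.ext huv] at hu
      exact (List.nodup_cons.1 hnd).1 hu

theorem labelSupport_blockOrder {n : ℕ} {s : Vtx n → ℕ} {p : Vtx n → Finset ℕ} {f : ℕ → ℕ}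
    (hf : IsLabelling p f) (hp : p ∈ setPartitions s) :
    labelSupport f (blockOrder s) = Finset.Ico 2 n := by
  refine Finset.filter_true_of_mem fun x hx => ?_
  obtain ⟨v, hv, hxv⟩ := hf x hx
  rw [hv]
  refine List.mem_map_of_mem (mem_blockOrder.2 ?_)
  have := Finset.card_pos.2 ⟨x, hxv⟩
  have := hp.2.2 v
  omega

theorem encodeBlocks_rest_mem {n : ℕ} {s : Vtx n → ℕ} {p : Vtx n → Finset ℕ} {f : ℕ → ℕ}
    (hf : IsLabelling p f) (hp : p ∈ setPartitions s) {rest : List (Vtx n)} (hnd : rest.Nodup) :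
    encodeBlocks (labelSupport f rest) (rest.map p) ∈
      decFunProd (shapeOfSizes (labelSupport f rest).card (rest.map fun v => s v - 1)) := by
  have hmap : rest.map (fun v => s v - 1) = (rest.map p).map Finset.card := by
    rw [List.map_map]
    refine List.map_congr_left fun v _ => ?_
    simp [← hp.2.2 v]
  rw [hmap]
  refine encodeBlocks_mem _ _ (fun B hB x hx => ?_) ?_
  · obtain ⟨v, hv, rfl⟩ := List.mem_map.1 hB
    have := (hf.mem_iff hp).1 hx
    exact Finset.mem_filter.2 ⟨this.1, this.2 ▸ List.mem_map_of_mem hv⟩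
  · rw [List.pairwise_map]
    exact hnd.imp fun h => hp.1 h

/-- The state of the ranking program when the blocks in `rest` remain to be processed. -/
structure RankState {n : ℕ} (s : Vtx n → ℕ) (p : Vtx n → Finset ℕ) (f : ℕ → ℕ) (total : ℕ)
    (rest : List (Vtx n)) (σ : MState) : Prop where
  low : ∀ v : Vtx n, σ.mem v = s v
  reg11 : σ.reg 11 = (labelSupport f rest).card
  labels : LabelMem n f (labelSupport f rest) σ.mem
  value : σ.reg 4 * chooseProd (shapeOfSizes (labelSupport f rest).card
      (rest.map fun v => s v - 1)) +
    decFunProdFormula (shapeOfSizes (labelSupport f rest).card (rest.map fun v => s v - 1))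
      (encodeBlocks (labelSupport f rest) (rest.map p)) = total

/-- The invariant of Horner's rule: register `4` times the number of words for the remaining blocks,
plus the rank of their code, is always the total rank. -/
theorem rankBlock_state {n : ℕ} (hn : 2 ≤ n) {s : Vtx n → ℕ} {p : Vtx n → Finset ℕ} {f : ℕ → ℕ}
    (hf : IsLabelling p f) (hp : p ∈ setPartitions s) {total : ℕ} (htotal : total ≤ (4 * n) ^ n)
    {v : Vtx n} {rest : List (Vtx n)} (hnd : (v :: rest).Nodup) {σ : MState} (hc : Consts n σ)
    (h12 : σ.reg 12 = s v) (h13 : σ.reg 13 = v) (h : RankState s p f total (v :: rest) σ) :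
    Tri rankBlock σ (60 * (n * (s v * (2 * bitLen (4 * n))))) fun τ =>
      SameOff rankBlock σ τ ∧ RankState s p f total rest τ := by
  obtain ⟨hfilter, hsdiff⟩ := labelSupport_cons hf hp hnd
  set D := labelSupport f (v :: rest) with hD
  have hDsub : D ⊆ Finset.Ico 2 n := Finset.filter_subset _ _
  have hpD : p v ⊆ D := by rw [← hfilter]; exact Finset.filter_subset _ _
  have hcard : (p v).card + 1 = s v := hp.2.2 v
  have hsv : s v - 1 = (p v).card := by omega
  have hDcard : D.card - (p v).card = (labelSupport f rest).card := by
    rw [← hsdiff, Finset.card_sdiff_of_subset hpD]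
  have hval := h.value
  rw [List.map_cons, List.map_cons, shapeOfSizes, chooseProd_cons, encodeBlocks,
    ← hD, hsdiff, hsv, decFunProdFormula_append (by simp), hDcard] at hval
  have hlt := decFunProdFormula_lt _ (encodeBlocks_rest_mem hf hp (List.nodup_cons.1 hnd).2)
  set F := decFunProdFormula (shapeOfSizes (labelSupport f rest).card
    (rest.map fun v => s v - 1)) (encodeBlocks (labelSupport f rest) (rest.map p)) with hF
  set CP := chooseProd (shapeOfSizes (labelSupport f rest).card
    (rest.map fun v => s v - 1)) with hCP
  have hvn := Finset.mem_Icc.1 v.2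
  have hval' : (σ.reg 4 * D.card.choose (p v).card +
      decFunFormula (((p v).sort (· ≥ ·)).map (rankIn D))) * CP + F = total := by
    rw [← hval]
    ring
  have hlabel : ∀ x ∈ D, 1 ≤ f x ∧ f x ≤ n := by
    intro x hx
    obtain ⟨u, hu, -⟩ := hf x (hDsub hx)
    rw [hu]
    exact Finset.mem_Icc.1 u.2
  -- The factor `CP` is positive because it exceeds `F`, so the new value of register `4` is at most
  -- the total rank.
  have hbig := (Nat.le_mul_of_pos_right (σ.reg 4 * D.card.choose (p v).card +
    decFunFormula (((p v).sort (· ≥ ·)).map (rankIn D))) (by omega : 0 < CP)).trans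
    ((Nat.le_add_right _ F).trans (hval'.le.trans htotal))
  rw [← hcard] at h12 ⊢
  refine Tri.mono (rankBlock_spec hn hDsub hfilter.symm rfl hlabel hvn.2 hc h.reg11 h12 h13
    h.labels hbig) le_rfl ?_
  rintro τ ⟨hs, hlow, hlab, h4, h11⟩
  rw [hsdiff] at hlab h11
  refine ⟨hs, fun u => ?_, h11, hlab, ?_⟩
  · rw [hlow u (Finset.mem_Icc.1 u.2).2, h.low u]
  · rw [h4]
    exact hval'

/-- Register `12` holds the degree in question and register `13` the vertex. A block is processed
when the vertex has that degree, so that trying all pairs takes the place of sorting. -/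
def rankInner : Program :=
  .seq (.seq (.load 15 13) (distProg 15 12))
    (.seq (.ifLt 2 16 .skip rankBlock) (.arith .add 13 13 3))

def rankOuter : Program :=
  .seq (.const 13 1) (.seq (.whileLt 13 14 rankInner) (.arith .add 12 12 3))

def rankInit : Program :=
  .seq (.arith .add 14 0 3) (.seq (.arith .sub 11 0 3) (.seq (.arith .sub 11 11 3) (.const 12 2)))

/-- The ranking program. -/
def rankProg : Program :=
  .seq thetaInvProg (.seq rankInit (.seq (.whileLt 12 0 rankOuter) (.arith .add 0 4 2)))

/-- The degree of vertex `i`, and `0` outside of the vertex set. -/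
def degreeOf {n : ℕ} (s : Vtx n → ℕ) (i : ℕ) : ℕ :=
  if h : i ∈ Finset.Icc 1 n then s ⟨i, h⟩ else 0

theorem degreeOf_coe {n : ℕ} (s : Vtx n → ℕ) (v : Vtx n) : degreeOf s v = s v := by
  rw [degreeOf, dif_pos v.2]

theorem sum_degreeOf {n : ℕ} (s : Vtx n → ℕ) :
    ∑ i ∈ Finset.range n, degreeOf s (i + 1) = ∑ v, s v := by
  rw [Finset.sum_congr rfl fun v _ => (degreeOf_coe s v).symm,
    Finset.sum_coe_sort (Finset.Icc 1 n) (degreeOf s), Finset.range_eq_Ico,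
    Finset.sum_Ico_add' (degreeOf s) 0 n 1, zero_add]
  rfl

theorem rankInner_spec {n : ℕ} (hn : 2 ≤ n) {s : Vtx n → ℕ} (hsn : ∀ v, s v < n)
    {p : Vtx n → Finset ℕ} {f : ℕ → ℕ}
    (hf : IsLabelling p f) (hp : p ∈ setPartitions s) {total : ℕ} (htotal : total ≤ (4 * n) ^ n)
    {z : ℕ} (hz : 2 ≤ z) (hzn : z < n) {v : Vtx n} {σ : MState} (hc : Consts n σ)
    (h12 : σ.reg 12 = z) (h13 : σ.reg 13 = v) (h : RankState s p f total (restBlocks s z v) σ) :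
    Tri rankInner σ (7 * (2 * bitLen (4 * n)) +
        if degreeOf s v = z then 60 * n * (2 * bitLen (4 * n)) * degreeOf s v else 0) fun τ =>
      τ.reg 13 = v + 1 ∧ RankState s p f total (restBlocks s z (v + 1)) τ := by
  set W := 2 * bitLen (4 * n) with hW
  have hvn := Finset.mem_Icc.1 v.2
  have hv := hsn v
  rw [degreeOf_coe]
  have hfin : ∀ τ rest, RankState s p f total rest τ → Consts n τ → τ.reg 13 = v →
      Tri (.arith .add 13 13 3) τ (1 * W) fun τ => τ.reg 13 = v + 1 ∧
        RankState s p f total rest τ := by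
    intro τ rest h hc h13
    refine Tri.of_vc (B := 4 * n) (P := .arith .add 13 13 3) ?_
    simp only [vc, ArithOp.eval, h13, hc.reg3]
    refine ⟨by omega, by omega, by simp [setReg_reg], h.low, ?_, h.labels, ?_⟩
    · simpa [setReg_reg] using h.reg11
    · simpa [setReg_reg] using h.value
  refine Tri.mono (Tri.seq (c := 4 * W) (d := (1 * W + (W + if s v = z then
    60 * n * W * s v else 0)) + 1 * W) (Tri.mono (Tri.frame (Tri.of_vc (B := 4 * n)
    (P := .seq (.load 15 13) (distProg 15 12))
    (R := fun τ => τ.reg 16 = (s v - z) + (z - s v) ∧ τ.mem = σ.mem) ?_)) le_rfl ?_)) (by omega)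
    fun _ h => h
  · simp only [distProg, vc, setReg_reg, setReg_mem, ArithOp.eval, h12, h13, h.low v,
      Nat.reduceEqDiff, if_true, if_false, and_true]
    refine ⟨?_, ?_, ?_, ?_, ?_, ?_, ?_, ?_⟩ <;> omega
  · rintro τ ⟨⟨h16, hmem⟩, hs⟩
    have hcτ := hc.of_sameOff hs
    have h12τ := (hs 12 (by decide)).trans h12
    have h13τ := (hs 13 (by decide)).trans h13
    have hst : RankState s p f total (restBlocks s z v) τ := by
      refine ⟨fun u => by rw [hmem, h.low], ?_, by rw [hmem]; exact h.labels, ?_⟩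
      · rw [hs 11 (by decide), h.reg11]
      · rw [hs 4 (by decide), h.value]
    refine Tri.seq (Tri.ifLt (B := 4 * n)
      (c := W + if s v = z then 60 * n * W * s v else 0) (by rw [hcτ.reg2]; omega) (by rw [h16]; omega) ?_ ?_ |>.mono
      (by omega) fun _ h => h)
    · intro hlt
      rw [hcτ.reg2, h16] at hlt
      have hne : s v ≠ z := by omega
      rw [restBlocks_succ_of_ne hne] at hst
      exact ⟨τ, 1, .skip τ, by have := one_le_bitLen (4 * n); omega, hfin τ _ hst hcτ h13τ⟩
    · intro hlt
      rw [hcτ.reg2, h16] at hlt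
      have heq : s v = z := by omega
      have hnd := nodup_restBlocks s z v
      rw [restBlocks_eq_cons hz heq] at hst hnd
      rw [if_pos heq]
      refine Tri.mono (rankBlock_state hn hf hp htotal hnd hcτ (h12τ.trans heq.symm) h13τ hst)
        ((le_of_eq (by ring)).trans (Nat.le_add_left _ _)) ?_
      rintro υ ⟨hsυ, hstυ⟩
      exact hfin υ _ hstυ (hcτ.of_sameOff hsυ) ((hsυ 13 (by decide)).trans h13τ)

theorem RankState.congr {n : ℕ} {s : Vtx n → ℕ} {p : Vtx n → Finset ℕ} {f : ℕ → ℕ} {total : ℕ}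
    {rest : List (Vtx n)} {σ τ : MState} (h : RankState s p f total rest σ)
    (hmem : τ.mem = σ.mem) (h4 : τ.reg 4 = σ.reg 4) (h11 : τ.reg 11 = σ.reg 11) :
    RankState s p f total rest τ :=
  ⟨fun u => by rw [hmem, h.low], h11.trans h.reg11, by rw [hmem]; exact h.labels,
    by rw [h4, h.value]⟩

/-- The cost of one pass of the outer loop, in which blocks of size `z - 1` are processed. -/
def outerCost {n : ℕ} (s : Vtx n → ℕ) (W z : ℕ) (idx : ℕ → ℕ) : ℕ :=
  ∑ i ∈ Finset.range n, (8 * W + if degreeOf s (idx i) = z then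
    60 * n * W * degreeOf s (idx i) else 0) + 3 * W

theorem rankOuter_spec {n : ℕ} (hn : 2 ≤ n) {s : Vtx n → ℕ} (hsn : ∀ v, s v < n)
    {p : Vtx n → Finset ℕ} {f : ℕ → ℕ}
    (hf : IsLabelling p f) (hp : p ∈ setPartitions s) {total : ℕ} (htotal : total ≤ (4 * n) ^ n)
    {z : ℕ} (hz : 2 ≤ z) (hzn : z < n) {σ : MState} (hc : Consts n σ) (h14 : σ.reg 14 = n + 1)
    (h12 : σ.reg 12 = z) (h : RankState s p f total (restBlocks s z 1) σ) :
    Tri rankOuter σ (outerCost s (2 * bitLen (4 * n)) z fun i => i + 1) fun τ =>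
      τ.reg 12 = z + 1 ∧ RankState s p f total (restBlocks s (z + 1) 1) τ := by
  set W := 2 * bitLen (4 * n) with hW
  refine Tri.mono (Tri.seq (c := 1 * W) (d := (∑ i ∈ Finset.range n, ((7 * W +
    if degreeOf s (i + 1) = z then 60 * n * W * degreeOf s (i + 1) else 0) + W) + W) + 1 * W)
    (Tri.mono (Tri.frame (Tri.of_vc (B := 4 * n) (P := .const 13 1)
    (R := fun τ => τ.reg 13 = 1 ∧ τ.mem = σ.mem) ?_)) le_rfl ?_)) ?_ fun _ h => h
  · simp only [vc, setReg_reg, setReg_mem, if_true, and_true]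
    omega
  · rintro σ₁ ⟨⟨h13, hmem⟩, hs₁⟩
    have hc₁ := hc.of_sameOff hs₁
    have h14₁ := (hs₁ 14 (by decide)).trans h14
    have h12₁ := (hs₁ 12 (by decide)).trans h12
    refine Tri.seq (Tri.mono (Tri.while_count (fun i τ => τ.reg 13 = i + 1 ∧
      RankState s p f total (restBlocks s z (i + 1)) τ) n (fun i => 7 * W +
        if degreeOf s (i + 1) = z then 60 * n * W * degreeOf s (i + 1) else 0) W
      ⟨h13, h.congr hmem (hs₁ 4 (by decide)) (hs₁ 11 (by decide))⟩ ?_ ?_) le_rfl ?_)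
    · rintro i hi τ hs ⟨h13, hst⟩
      have h14 := (hs 14 (by decide)).trans h14₁
      have h12 := (hs 12 (by decide)).trans h12₁
      rw [h13, h14]
      refine ⟨by omega, guard_le (by omega) (by omega), ?_⟩
      exact rankInner_spec hn hsn hf hp htotal hz hzn (v := ⟨i + 1, by simp; omega⟩)
        (hc₁.of_sameOff hs) h12 h13 hst
    · rintro τ hs ⟨h13, -⟩
      have h14 := (hs 14 (by decide)).trans h14₁
      rw [h13, h14]
      exact ⟨lt_irrefl _, guard_le (by omega) (by omega)⟩
    · rintro τ ⟨⟨h13, hst⟩, hs⟩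
      have h12 := (hs 12 (by decide)).trans h12₁
      rw [restBlocks_succ] at hst
      refine Tri.of_vc (B := 4 * n) (P := .arith .add 12 12 3) ?_
      simp only [vc, ArithOp.eval, h12, (hc₁.of_sameOff hs).reg3]
      exact ⟨by omega, by omega, by simp [setReg_reg], hst.congr rfl (by simp [setReg_reg])
        (by simp [setReg_reg])⟩
  · rw [outerCost]
    refine le_of_eq ?_
    have : ∀ i, 7 * W + (if degreeOf s (i + 1) = z then 60 * n * W * degreeOf s (i + 1) else 0) +
      W = 8 * W + if degreeOf s (i + 1) = z then 60 * n * W * degreeOf s (i + 1) else 0 :=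
      fun i => by ring
    simp only [this]
    ring

/-- A vertex has only one degree, so each block is paid for once, and the blocks cost at most `60 *
n * W` times the sum of the degrees, which is below `2 * n`. Trying all pairs of a degree and a
vertex costs `O(n² W)`. -/
theorem sum_outerCost_le {n : ℕ} (hn : 2 ≤ n) {s : Vtx n → ℕ} (h2 : ∑ i, s i + 2 = 2 * n)
    (W : ℕ) {h idx : ℕ → ℕ} (hh : Set.InjOn h (Finset.range (n - 2)))
    (hidx : ∑ i ∈ Finset.range n, degreeOf s (idx i) = ∑ v, s v) :
    ∑ j ∈ Finset.range (n - 2), (outerCost s W (h j) idx + W) ≤ 140 * (n * n * W) := by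
  have h1 := sum_sum_cost_le (n := n) (A := 8 * W) (X := 60 * n * W)
    (fun i => degreeOf s (idx i)) h hh
  rw [hidx] at h1
  simp only [outerCost]
  rw [Finset.sum_add_distrib, Finset.sum_add_distrib]
  simp only [Finset.sum_const, Finset.card_range, smul_eq_mul]
  have h3 : 60 * n * W * (∑ v, s v) ≤ 60 * n * W * (2 * n) := Nat.mul_le_mul_left _ (by omega)
  have h4 : (n - 2) * (n * (8 * W)) ≤ n * (n * (8 * W)) := Nat.mul_le_mul_right _ (by omega)
  have h5 : (n - 2) * (3 * W) ≤ n * (3 * W) := Nat.mul_le_mul_right _ (by omega)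
  have h6 : (n - 2) * W ≤ n * W := Nat.mul_le_mul_right _ (by omega)
  have h7 : 2 * (n * W) ≤ n * (n * W) := Nat.mul_le_mul_right _ hn
  nlinarith

theorem rankProg_spec {n : ℕ} {s : Vtx n → ℕ} (h1 : ∀ i, 1 ≤ s i) (h2 : ∑ i, s i + 2 = 2 * n)
    {T : Digraph (Vtx n)} (hT : T ∈ treesWithDegrees s) {t : ℕ → ℕ} (ht : IsArcTable T t) :
    Tri rankProg (rankInput s t) (180 * (n * n * (2 * bitLen (4 * n)))) fun τ =>
      τ.reg 0 = rankTree s T := by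
  have hn := two_le_of_degrees h1 h2
  set W := 2 * bitLen (4 * n) with hW
  set p := treePartition T with hpdef
  have hp : p ∈ setPartitions s := treePartition_mem hn hT
  obtain ⟨F, hF⟩ := exists_funGraph_eq_thetaInv hn hT.1
  let f : ℕ → ℕ := fun x => if h : x ∈ Finset.Ico 2 n then F ⟨x, h⟩ else 0
  have hf : IsLabelling p f := by
    intro x hx
    have hxV : x ∈ Finset.Icc 1 n := by simp at hx ⊢; omega
    refine ⟨F ⟨x, hx⟩, by simp only [f, dif_pos hx], ?_⟩
    refine (coe_mem_treePartition (u := ⟨x, hxV⟩)).2 ?_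
    rw [← hF]
    exact ⟨hx, rfl⟩
  have hsn : ∀ v, s v < n := by
    intro v
    have h3 : (p v).card ≤ (Finset.Ico 2 n).card := by
      refine Finset.card_le_card ?_
      rw [← hp.2.1]
      exact Finset.subset_biUnion_of_mem p (Finset.mem_univ v)
    rw [Nat.card_Ico] at h3
    have := hp.2.2 v
    omega
  have htotal : decFunProdFormula (shape s) (encode s p) ≤ (4 * n) ^ n :=
    (decFunProdFormula_lt _ (encode_mem hp)).le.trans (chooseProd_shape_le (by omega) s)
  rw [rankTree_eq_formula hn hT]
  set total := decFunProdFormula (shape s) (encode s p) with htot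
  refine Tri.mono (Tri.seq (c := 30 * (n * n * W)) (d := 4 * W + ((∑ j ∈ Finset.range (n - 2),
    (outerCost s W (j + 2) (fun i => i + 1) + W) + W) + n * W)) (Tri.mono (thetaInvProg_spec hT.1 hn
    (by simp [rankInput]) (by simp [rankInput]) ?_) le_rfl ?_)) ?_ fun _ h => h
  · intro w v hwv
    have hw := Finset.mem_Icc.1 w.2
    obtain ⟨hw2, hv⟩ := (ht w v).1 hwv
    have h3 : n + (w : ℕ) ∉ Finset.Icc 1 n := by simp; omega
    have h4 : n + 2 ≤ n + (w : ℕ) ∧ n + (w : ℕ) ≤ n + n := by omega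
    simp only [rankInput, dif_neg h3, if_pos h4]
    rw [Nat.add_sub_cancel_left, hv]
  · rintro σ₁ ⟨hc₁, hs₁, hlow₁, hlab₁⟩
    have h4₁ : σ₁.reg 4 = 0 := (hs₁ 4 (by decide)).trans (by simp [rankInput])
    have hst₁ : ∀ σ : MState, σ.mem = σ₁.mem → σ.reg 4 = 0 → σ.reg 11 = n - 2 →
        RankState s p f total (restBlocks s 2 1) σ := by
      intro σ hmem h4 h11
      rw [restBlocks_two]
      refine ⟨fun v => ?_, ?_, fun x hx => ?_, ?_⟩
      · have hv := Finset.mem_Icc.1 v.2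
        rw [hmem, hlow₁ v hv.2]
        simp only [rankInput, dif_pos v.2]
      · rw [labelSupport_blockOrder hf hp, h11, Nat.card_Ico]
      · have hxV : x ∈ Finset.Icc 1 n := by simp at hx ⊢; omega
        rw [labelSupport_blockOrder hf hp, if_pos hx, hmem]
        simp only [f, dif_pos hx]
        refine hlab₁ ⟨x, hxV⟩ _ ?_
        rw [← hF]
        exact ⟨hx, rfl⟩
      · rw [labelSupport_blockOrder hf hp, h4, zero_mul, zero_add, Nat.card_Ico, htot]
        rfl
    refine Tri.seq (Tri.mono (Tri.frame (Tri.of_vc (B := 4 * n) (P := rankInit)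
      (R := fun τ => τ.mem = σ₁.mem ∧ τ.reg 14 = n + 1 ∧ τ.reg 11 = n - 2 ∧ τ.reg 12 = 2) ?_))
      le_rfl ?_)
    · simp only [rankInit, vc, setReg_reg, setReg_mem, ArithOp.eval, hc₁.reg0, hc₁.reg3,
        Nat.reduceEqDiff, if_true, if_false, true_and, and_true, OfNat.zero_ne_ofNat]
      omega
    · rintro σ₂ ⟨⟨hmem₂, h14₂, h11₂, h12₂⟩, hs₂⟩
      have hc₂ := hc₁.of_sameOff hs₂
      have h4₂ := (hs₂ 4 (by decide)).trans h4₁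
      refine Tri.seq (Tri.mono (Tri.while_count (fun j τ => τ.reg 12 = j + 2 ∧
        RankState s p f total (restBlocks s (j + 2) 1) τ) (n - 2)
        (fun j => outerCost s W (j + 2) fun i => i + 1) W
        ⟨h12₂, hst₁ σ₂ hmem₂ h4₂ h11₂⟩ ?_ ?_) le_rfl ?_)
      · rintro j hj τ hs ⟨h12, hst⟩
        have hc := hc₂.of_sameOff hs
        have h14 := (hs 14 (by decide)).trans h14₂
        rw [h12, hc.reg0]
        refine ⟨by omega, guard_le (by omega) (by omega), ?_⟩
        exact rankOuter_spec hn hsn hf hp htotal (by omega) (by omega) hc h14 h12 hst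
      · rintro τ hs ⟨h12, -⟩
        rw [h12, (hc₂.of_sameOff hs).reg0]
        exact ⟨by omega, guard_le (by omega) (by omega)⟩
      · rintro τ ⟨⟨-, hst⟩, hs⟩
        -- All degrees are smaller than `n`, so no block is left.
        have hnil : restBlocks s (n - 2 + 2) 1 = [] := restBlocks_eq_nil fun u => by
          have := hsn u
          omega
        rw [hnil] at hst
        have hval := hst.value
        simp only [List.map_nil, shapeOfSizes, chooseProd, List.prod_nil, mul_one,
          decFunProdFormula, add_zero] at hval
        refine ⟨τ.setReg 0 (τ.reg 4 + τ.reg 2), _, .arith .add 0 4 2 τ, ?_, ?_⟩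
        · rw [hval, (hc₂.of_sameOff hs).reg2]
          refine (guard_le htotal (Nat.zero_le _)).trans ?_
          have := bitLen_pow_le (4 * n) n (by omega)
          rw [hW]
          nlinarith
        · simp [setReg_reg, hval, (hc₂.of_sameOff hs).reg2]
  · have h3 := sum_outerCost_le hn h2 W (h := fun j => j + 2) (idx := fun i => i + 1)
      (fun a _ b _ h => by simpa using h) (sum_degreeOf s)
    have h4 : W ≤ n * n * W := Nat.le_mul_of_pos_left _ (by nlinarith)
    have h5 : n * W ≤ n * n * W := by
      rw [mul_assoc]
      exact Nat.le_mul_of_pos_left _ (by omega)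
    omega

end CayleyRank

namespace CayleyRank

/-! ### The program that unranks a block -/

/-- Insert the label `v` at the positions in `l` into the word `A`. -/
def insertLabels (A : ℕ → ℕ) (l : List ℕ) (v : ℕ) (j : ℕ) : ℕ :=
  if j ∈ l then v else A (j - (l.filter fun y => y ≤ j).length)

/-- Register `25` runs down through the positions `y`. Register `24` holds the number `k` of labels
still to be inserted, register `23` the rank of their positions, and register `22` holds `C(y, k)`.
Register `29` becomes `C(y-1, k)`. If the rank is smaller than this, `y` is not a position of the
block and receives the letter from position `y - k`; otherwise it receives the label of the block.
-/
def unrankBlockBody : Program :=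
  .seq (.arith .sub 28 25 24) (.seq (.arith .mul 29 22 28) (.seq (.arith .div 29 29 25)
    (.seq (.arith .add 7 31 25) (.seq
      (.ifLt 23 29
        (.seq (.arith .add 22 29 2) (.seq (.arith .add 27 31 28)
          (.seq (.load 27 27) (.store 7 27))))
        (.seq (.arith .sub 23 23 29) (.seq (.arith .sub 22 22 29)
          (.seq (.arith .sub 24 24 3) (.store 7 13)))))
      (.arith .sub 25 25 3)))))

/-- The state of the loop that unranks a block, when `y` is the next position. -/
structure UnrankInv (n a b : ℕ) (l : List ℕ) (v : ℕ) (M : ℕ → ℕ) (y : ℕ) (σ : MState) : Prop where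
  reg25 : σ.reg 25 = y
  reg24 : σ.reg 24 ≤ b
  reg22 : σ.reg 22 = y.choose (σ.reg 24)
  reg23 : σ.reg 23 < y.choose (σ.reg 24)
  code : l.filter (fun x => x ≤ y) = decFunUnrank (σ.reg 24) (σ.reg 23)
  off : ∀ i, i ≤ n + 1 ∨ n + 1 + a < i → σ.mem i = M i
  word : ∀ j, 1 ≤ j → j ≤ a → σ.mem (n + 1 + j) =
    if y < j then insertLabels (fun j => M (n + 1 + j)) l v j else M (n + 1 + j)

/-- The scan merges all greedy searches into one: the first `y` with `C(y-1, k)` at most the current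
rank is the next entry of the sequence. The new word is formed in place, from right to left, during
the same scan. -/
theorem unrankBlockLoop_spec {n a b q v W : ℕ} (hn : 2 ≤ n) (han : a ≤ n) (hv : v ≤ n)
    (hq : q < a.choose b) {σ₀ : MState} (hc : Consts n σ₀) (h13 : σ₀.reg 13 = v)
    (h31 : σ₀.reg 31 = n + 1) (h22 : σ₀.reg 22 = a.choose b) (h23 : σ₀.reg 23 = q)
    (h24 : σ₀.reg 24 = b) (h25 : σ₀.reg 25 = a)
    (hM : ∀ j, 1 ≤ j → j ≤ n → σ₀.mem (n + 1 + j) ≤ n)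
    (hW : W = 2 * bitLen ((4 * n) ^ (b + 1))) :
    Tri (.whileLt 2 25 unrankBlockBody) σ₀ (a * (14 * W + W) + W) fun τ =>
      SameOff unrankBlockBody σ₀ τ ∧ (∀ i, i ≤ n + 1 ∨ n + 1 + a < i → τ.mem i = σ₀.mem i) ∧
      ∀ j, 1 ≤ j → j ≤ a → τ.mem (n + 1 + j) =
        insertLabels (fun j => σ₀.mem (n + 1 + j)) (decFunUnrank b q) v j := by
  subst hW
  set W := 2 * bitLen ((4 * n) ^ (b + 1)) with hW
  have hsmall : ∀ {x : ℕ}, x ≤ 4 * n → x ≤ (4 * n) ^ (b + 1) := fun h => le_bound h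
  obtain ⟨⟨-, hl2, hl3⟩, -⟩ := decFunUnrank_spec b hq
  have hba : b ≤ a := by
    by_contra hcon
    rw [Nat.choose_eq_zero_of_lt (by omega)] at hq
    omega
  set l := decFunUnrank b q with hl
  refine Tri.mono (Tri.while_count (fun i σ => UnrankInv n a b l v σ₀.mem (a - i) σ) a
    (fun _ => 14 * W) W ?_ ?_ ?_) ?_ ?_
  · refine ⟨by simpa using h25, h24.le, by simpa [h24] using h22, by simpa [h23, h24] using hq, ?_,
      fun _ _ => rfl, fun j _ hj => ?_⟩
    · rw [h23, h24, List.filter_eq_self.2]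
      intro x hx
      simpa using (hl3 x hx).2
    · rw [if_neg (by omega)]
  · rintro i hi σ hs ⟨h25, h24, h22, h23, hcode, hoff, hword⟩
    have hc := hc.of_sameOff hs
    have h13 : σ.reg 13 = v := (hs 13 (by decide)).trans h13
    have h31 : σ.reg 31 = n + 1 := (hs 31 (by decide)).trans h31
    have hi1 : a - (i + 1) = a - i - 1 := by omega
    simp only [hi1]
    set y := a - i with hy
    have hy1 : 1 ≤ y := by omega
    have hya : y ≤ a := by omega
    generalize hk : σ.reg 24 = k at *
    generalize hq' : σ.reg 23 = q' at *
    rw [hc.reg2, h25]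
    refine ⟨by omega, guard_le (hsmall (by omega)) (hsmall (by omega)), ?_⟩
    refine Tri.of_vc (B := (4 * n) ^ (b + 1)) (P := unrankBlockBody) ?_
    have hd := choose_mul_pred_div (k := k) hy1
    have hC := choose_le_bound (n := n) (y := y) (k := k) (by omega) (by omega) h24
    have hC' := choose_le_bound (n := n) (y := y - 1) (k := k) (by omega) (by omega) h24
    have hCm := choose_mul_le (n := n) (y := y) (k := k) (z := y - k) (by omega) (by omega) h24
      (by omega)
    have hfilter : l.filter (fun x => x ≤ y - 1) =
        (decFunUnrank k q').filter fun x => x ≤ y - 1 := by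
      rw [← hcode, List.filter_filter]
      refine List.filter_congr fun x _ => ?_
      rw [← Bool.decide_and, decide_eq_decide]
      omega
    have hmemy : y ∈ l ↔ y ∈ decFunUnrank k q' := by
      rw [← hcode]
      simp
    -- So `y - k` is the position from which `insertLabels` takes its letter.
    have hlen : (l.filter fun x => x ≤ y).length = k := by
      rw [hcode]
      exact (decFunUnrank_spec k h23).1.1
    simp only [unrankBlockBody, vc, setReg_reg, setReg_mem, setMem_reg, ArithOp.eval,
      hc.reg2, hc.reg3, h13, h22, hk, hq', h25, h31, hd, Nat.reduceEqDiff, if_true, if_false]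
    by_cases hqd : q' < (y - 1).choose k
    · have hky : k ≤ y - 1 := by
        by_contra hcon
        rw [Nat.choose_eq_zero_of_lt (by omega)] at hqd
        omega
      have hspec := (decFunUnrank_spec k hqd).1
      have hynl : y ∉ l := by
        rw [hmemy]
        intro h
        have := (hspec.2.2 y h).2
        omega
      -- Only positions above `y` have been overwritten, so the letter read is one of the old word.
      have hrd : σ.mem (n + 1 + (y - k)) = σ₀.mem (n + 1 + (y - k)) := by
        rw [hword (y - k) (by omega) (by omega), if_neg (by omega)]
      have hrd' := hM (y - k) (by omega) (by omega)
      have hrd2 : σ.mem (n + 1 + (y - k)) ≤ n := hrd.trans_le hrd'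
      refine ⟨?_, ?_, hC, ?_, hCm, ?_, ?_, ?_, ?_, ?_, fun _ => ⟨?_, ?_, ?_, ?_, ?_, ?_, ?_, ?_,
        ?_, ?_, ?_⟩, fun h => absurd hqd h⟩
      all_goals first | exact hC' | exact hsmall (by omega) | omega | skip
      refine ⟨?_, ?_, ?_, ?_, ?_, fun i hi => ?_, fun j hj1 hja => ?_⟩
      all_goals simp only [setReg_reg, setReg_mem, setMem_reg, setMem_mem, Nat.reduceEqDiff,
        if_true, if_false, h25, hk, hq', add_zero]
      · exact h24
      · exact hqd
      · rw [hfilter]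
        refine List.filter_eq_self.2 fun x hx => ?_
        simpa using (hspec.2.2 x hx).2
      · rw [Function.update_of_ne (by omega)]
        exact hoff i hi
      · by_cases hjy : j = y
        · subst hjy
          rw [Function.update_self, if_pos (by omega), hrd, insertLabels, if_neg hynl, hlen]
        · rw [Function.update_of_ne (by omega), hword j hj1 hja]
          have : y - 1 < j ↔ y < j := by omega
          simp only [this]
    · have hk1 : 1 ≤ k := by
        by_contra hcon
        obtain rfl : k = 0 := by omega
        simp only [Nat.choose_zero_right] at h23 hqd
        omega
      obtain ⟨k', rfl⟩ := Nat.exists_eq_add_of_le' hk1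
      have hch := choose_pred_add (k := k') hy1
      -- The rank lies between `C(y-1, k'+1)` and `C(y, k'+1)`, so the greedy choice is `y - 1`,
      -- that is, the entry `y`.
      have hun : decFunUnrank (k' + 1) q' =
          y :: decFunUnrank k' (q' - (y - 1).choose (k' + 1)) := by
        have h1 : y - 1 + 1 = y := by omega
        rw [decFunUnrank_succ (not_lt.1 hqd) (by rw [h1]; exact h23), h1]
      have hrest : q' - (y - 1).choose (k' + 1) < (y - 1).choose k' := by omega
      have hspec := (decFunUnrank_spec k' hrest).1
      have hyl : y ∈ l := by
        rw [hmemy, hun]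
        simp
      have hqB : q' ≤ (4 * n) ^ (b + 1) := h23.le.trans hC
      refine ⟨?_, ?_, hC, ?_, hCm, ?_, ?_, ?_, hqB, ?_, fun h => absurd h hqd, fun _ => ⟨hqB, ?_, hC,
        ?_, ?_, ?_, ?_, ?_, ?_, ?_, ?_⟩⟩
      all_goals first | exact hC' | exact hsmall (by omega) | omega | skip
      refine ⟨?_, ?_, ?_, ?_, ?_, fun i hi => ?_, fun j hj1 hja => ?_⟩
      all_goals simp only [setReg_reg, setReg_mem, setMem_reg, setMem_mem, Nat.reduceEqDiff,
        if_true, if_false, h25, hk, hq', h22, Nat.add_sub_cancel]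
      · omega
      · omega
      · exact hrest
      · rw [hfilter, hun, List.filter_cons_of_neg (by simp; omega)]
        refine List.filter_eq_self.2 fun x hx => ?_
        simpa using (hspec.2.2 x hx).2
      · rw [Function.update_of_ne (by omega)]
        exact hoff i hi
      · by_cases hjy : j = y
        · subst hjy
          rw [Function.update_self, if_pos (by omega), insertLabels, if_pos hyl]
        · rw [Function.update_of_ne (by omega), hword j hj1 hja]
          have : y - 1 < j ↔ y < j := by omega
          simp only [this]
  · rintro σ hs ⟨h25, -⟩
    rw [(hc.of_sameOff hs).reg2, h25]
    exact ⟨by omega, guard_le (hsmall (by omega)) (hsmall (by omega))⟩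
  · simp
  · rintro τ ⟨⟨h25, -, -, -, -, hoff, hword⟩, hs⟩
    refine ⟨hs, hoff, fun j hj1 hja => ?_⟩
    rw [hword j hj1 hja, if_pos (by omega)]

end CayleyRank

/-! ### Unranking one block, and the word of labels -/

namespace CayleyRank

/-- Register `1` is divided by the binomial coefficient in register `19`. The remainder goes to
register `23` as the rank for this block, and the quotient stays in register `1` for the blocks
before it. -/
def unrankBlockInit : Program :=
  .seq (.arith .div 29 1 19) (.seq (.arith .mul 30 29 19) (.seq (.arith .sub 23 1 30)
    (.seq (.arith .add 1 29 2) (.seq (.arith .add 22 19 2) (.seq (.arith .add 24 18 2)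
      (.arith .add 25 11 2))))))

/-- Unrank the block with label register `13` and size one less than register `12`. -/
def unrankBlock : Program :=
  .seq (.seq (.arith .sub 18 12 3) (.arith .add 11 11 18)) (.seq binomProg (.seq unrankBlockInit
    (.whileLt 2 25 unrankBlockBody)))

theorem unrankBlock_spec {n a b v : ℕ} (hn : 2 ≤ n) (hba : b ≤ a) (han : a + 2 ≤ n) (hv : v ≤ n)
    {σ₀ : MState} (hc : Consts n σ₀) (h11 : σ₀.reg 11 = a - b) (h12 : σ₀.reg 12 = b + 1)
    (h13 : σ₀.reg 13 = v) (h31 : σ₀.reg 31 = n + 1) (hr : σ₀.reg 1 ≤ (4 * n) ^ n)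
    (hM : ∀ j, 1 ≤ j → j ≤ n → σ₀.mem (n + 1 + j) ≤ n) :
    Tri unrankBlock σ₀ (60 * (n * ((b + 1) * (2 * bitLen (4 * n))))) fun τ =>
      SameOff unrankBlock σ₀ τ ∧ (∀ i, i ≤ n + 1 ∨ n + 1 + a < i → τ.mem i = σ₀.mem i) ∧
      (∀ j, 1 ≤ j → j ≤ a → τ.mem (n + 1 + j) = insertLabels (fun j => σ₀.mem (n + 1 + j))
        (decFunUnrank b (σ₀.reg 1 % a.choose b)) v j) ∧
      τ.reg 1 = σ₀.reg 1 / a.choose b ∧ τ.reg 11 = a := by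
  set W := 2 * bitLen ((4 * n) ^ (b + 1)) with hW
  set V := 2 * bitLen ((4 * n) ^ n) with hV
  have hsmall : ∀ {x : ℕ}, x ≤ 4 * n → x ≤ (4 * n) ^ (b + 1) := fun h => le_bound h
  have hn' : ∀ {x : ℕ}, x ≤ n → x ≤ (4 * n) ^ n := fun h =>
    (show _ ≤ 4 * n by omega).trans (Nat.le_self_pow (by omega) _)
  have hCpos : 1 ≤ a.choose b := Nat.choose_pos hba
  have hCle : a.choose b ≤ (4 * n) ^ n :=
    (choose_le_bound (by omega) (by omega) le_rfl).trans
      (Nat.pow_le_pow_right (by omega) (by omega))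
  refine Tri.mono (Tri.frame (c := 2 * W + ((3 * W + (b * (4 * W + W) + W)) + (7 * V +
    (a * (14 * W + W) + W)))) (R := fun τ =>
      (∀ i, i ≤ n + 1 ∨ n + 1 + a < i → τ.mem i = σ₀.mem i) ∧
      (∀ j, 1 ≤ j → j ≤ a → τ.mem (n + 1 + j) = insertLabels (fun j => σ₀.mem (n + 1 + j))
        (decFunUnrank b (σ₀.reg 1 % a.choose b)) v j) ∧
      τ.reg 1 = σ₀.reg 1 / a.choose b ∧ τ.reg 11 = a) ?_) ?_ fun τ h => ⟨h.2, h.1⟩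
  · refine Tri.seq (Tri.mono (Tri.frame (Tri.of_vc (B := (4 * n) ^ (b + 1))
      (P := .seq (.arith .sub 18 12 3) (.arith .add 11 11 18))
      (R := fun τ => τ.reg 18 = b ∧ τ.reg 11 = a ∧ τ.mem = σ₀.mem) ?_)) le_rfl ?_)
    · simp only [vc, setReg_reg, setReg_mem, ArithOp.eval, h11, h12, hc.reg3, Nat.reduceEqDiff,
        if_true, if_false, Nat.add_sub_cancel, and_true, true_and]
      exact ⟨hsmall (by omega), hsmall (by omega), hsmall (by omega), hsmall (by omega), by omega⟩
    · rintro σ₁ ⟨⟨h18, h11', hm₁⟩, hs₁⟩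
      have hc1 := hc.of_sameOff hs₁
      refine Tri.seq (Tri.mono (binomProg_spec (by omega) hc1 h11' h18 hba (by omega) hW) le_rfl ?_)
      rintro σ₂ ⟨hs₂, hm₂, h19⟩
      have hc2 := hc1.of_sameOff hs₂
      have e1 : σ₂.reg 1 = σ₀.reg 1 := (hs₂ 1 (by decide)).trans (hs₁ 1 (by decide))
      have e11 := (hs₂ 11 (by decide)).trans h11'
      have e18 := (hs₂ 18 (by decide)).trans h18
      have e13 := (hs₂ 13 (by decide)).trans ((hs₁ 13 (by decide)).trans h13)
      have e31 := (hs₂ 31 (by decide)).trans ((hs₁ 31 (by decide)).trans h31)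
      refine Tri.seq (Tri.mono (Tri.frame (Tri.of_vc (B := (4 * n) ^ n)
        (P := unrankBlockInit) (R := fun τ => τ.mem = σ₂.mem ∧ τ.reg 1 = σ₀.reg 1 / a.choose b ∧
          τ.reg 22 = a.choose b ∧ τ.reg 23 = σ₀.reg 1 % a.choose b ∧ τ.reg 24 = b ∧
          τ.reg 25 = a) ?_)) le_rfl ?_)
      · have hmod : σ₀.reg 1 - σ₀.reg 1 / a.choose b * a.choose b = σ₀.reg 1 % a.choose b := by
          rw [mul_comm]
          have := Nat.div_add_mod (σ₀.reg 1) (a.choose b)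
          omega
        have hd : σ₀.reg 1 / a.choose b ≤ (4 * n) ^ n := (Nat.div_le_self _ _).trans hr
        have hd' : σ₀.reg 1 / a.choose b * a.choose b ≤ (4 * n) ^ n :=
          (Nat.div_mul_le_self _ _).trans hr
        simp only [unrankBlockInit, vc, setReg_reg, setReg_mem, ArithOp.eval, hc2.reg2, e1,
          e11, e18, h19, Nat.reduceEqDiff, if_true, if_false, add_zero, and_true, hmod,
          OfNat.one_ne_ofNat, OfNat.ofNat_ne_one]
        exact ⟨hr, hCle, hd, hCle, hr, hd', hd, Nat.zero_le _, hCle, Nat.zero_le _,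
          hn' (by omega), Nat.zero_le _, hn' (by omega), Nat.zero_le _⟩
      · rintro σ₃ ⟨⟨hm₃, h1₃, h22, h23, h24, h25⟩, hs₃⟩
        have hmem : σ₃.mem = σ₀.mem := hm₃.trans (hm₂.trans hm₁)
        refine Tri.mono (unrankBlockLoop_spec hn (by omega) hv (Nat.mod_lt _ hCpos)
          (hc2.of_sameOff hs₃) ((hs₃ 13 (by decide)).trans e13)
          ((hs₃ 31 (by decide)).trans e31) h22 h23 h24 h25 (by rw [hmem]; exact hM) hW) le_rfl ?_
        rintro τ ⟨hs, hoff, hword⟩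
        rw [hmem] at hoff hword
        exact ⟨hoff, hword, (hs 1 (by decide)).trans h1₃, (hs 11 (by decide)).trans
          ((hs₃ 11 (by decide)).trans e11)⟩
  · have h1 := bitLen_pow_le (4 * n) (b + 1) (by omega)
    have h2 := bitLen_pow_le (4 * n) n (by omega)
    set Z := 2 * bitLen (4 * n) with hZ
    have h3 : W ≤ (b + 1) * Z := by rw [hW, hZ]; nlinarith
    have h4 : V ≤ n * Z := by rw [hV, hZ]; nlinarith
    have h5 : n * Z ≤ n * ((b + 1) * Z) :=
      Nat.mul_le_mul_left _ (Nat.le_mul_of_pos_left _ (by omega))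
    have h6 : n * W ≤ n * ((b + 1) * Z) := Nat.mul_le_mul_left _ h3
    have h7 : b * W ≤ n * W := Nat.mul_le_mul_right _ (by omega)
    have h8 : a * W ≤ n * W := Nat.mul_le_mul_right _ (by omega)
    have h9 : W ≤ n * W := Nat.le_mul_of_pos_left _ (by omega)
    have e1 : b * (4 * W + W) = 5 * (b * W) := by ring
    have e2 : a * (14 * W + W) = 15 * (a * W) := by ring
    rw [e1, e2]
    omega

/-! ### The word of labels -/

/-- Of the `b` entries at most `j - 1` lie below `j` and at most `a - j` above it, so the source
position lies within the shorter word. -/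
theorem insertLabels_pos_bounds {a b j : ℕ} {l : List ℕ} (hl : l ∈ decFun a b) (hj1 : 1 ≤ j)
    (hja : j ≤ a) (hj : j ∉ l) : 1 ≤ j - (l.filter fun y => y ≤ j).length ∧
      j - (l.filter fun y => y ≤ j).length ≤ a - b := by
  obtain ⟨hb, hp, hm⟩ := hl
  have hnd : l.Nodup := hp.imp fun h => ne_of_gt h
  have h1 : (l.filter fun y => y ≤ j).length ≤ (Finset.Ico 1 j).card := by
    rw [← List.toFinset_card_of_nodup (hnd.filter _)]
    refine Finset.card_le_card fun x hx => ?_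
    simp only [List.mem_toFinset, List.mem_filter, decide_eq_true_eq] at hx
    have hne : x ≠ j := by rintro rfl; exact hj hx.1
    have := hm x hx.1
    rw [Finset.mem_Ico]
    omega
  have h2 : (l.filter fun y => ! decide (y ≤ j)).length ≤ (Finset.Ioc j a).card := by
    rw [← List.toFinset_card_of_nodup (hnd.filter _)]
    refine Finset.card_le_card fun x hx => ?_
    simp only [List.mem_toFinset, List.mem_filter, Bool.not_eq_true', decide_eq_false_iff_not]
      at hx
    have := hm x hx.1
    rw [Finset.mem_Ioc]
    omega
  have h3 := List.length_eq_length_filter_add (l := l) fun y => decide (y ≤ j)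
  rw [Nat.card_Ico] at h1
  rw [Nat.card_Ioc] at h2
  omega

/-- The word whose `j`-th letter is the index of the block of the `j`-th element. -/
def codeLabels {n : ℕ} (s : Vtx n → ℕ) : List (Vtx n) → List ℕ → ℕ → ℕ
  | [], _ => fun _ => 0
  | v :: vs, w => insertLabels (codeLabels s vs (w.drop (s v - 1))) (w.take (s v - 1)) v

theorem rankIn_sdiff {D B : Finset ℕ} (hB : B ⊆ D) (x : ℕ) :
    rankIn (D \ B) x = rankIn D x - rankIn B x := by
  rw [rankIn, rankIn, rankIn, ← Finset.card_sdiff_of_subset (Finset.filter_subset_filter _ hB)]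
  congr 1
  ext y
  simp only [Finset.mem_filter, Finset.mem_sdiff]
  tauto

theorem length_filter_rankIn {D : Finset ℕ} {b : ℕ} {l : List ℕ} (hl : l ∈ decFun D.card b)
    {x : ℕ} (hx : x ∈ D) : (l.filter fun y => y ≤ rankIn D x).length =
      rankIn (D.filter fun x => rankIn D x ∈ l) x := by
  have hsub : (D.filter fun x => rankIn D x ∈ l) ⊆ D := Finset.filter_subset _ _
  conv_lhs => rw [← rankSeq_filter hl]
  conv_rhs => rw [rankIn]
  rw [List.filter_map, List.length_map,
    ← List.toFinset_card_of_nodup ((Finset.sort_nodup _ _).filter _)]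
  congr 1
  ext y
  simp only [List.mem_toFinset, List.mem_filter, Finset.mem_sort, Function.comp,
    decide_eq_true_eq]
  rw [Finset.mem_filter (s := D.filter fun x => rankIn D x ∈ l)]
  refine and_congr_right fun hy => ?_
  have := rankIn_lt_iff hx (hsub hy)
  omega

/-- Removing `B` from `D` lowers the rank of `x` by the number of elements of `B` up to `x`, and
this is the shift that `insertLabels` makes. -/
theorem codeLabels_rankIn {n : ℕ} (s : Vtx n → ℕ) (vs : List (Vtx n)) :
    ∀ (D : Finset ℕ) (w : List ℕ),
      w ∈ decFunProd (shapeOfSizes D.card (vs.map fun v => s v - 1)) →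
      ∀ q ∈ vs.zip (decodeBlocks D (vs.map fun v => s v - 1) w), ∀ x ∈ q.2,
        codeLabels s vs w (rankIn D x) = q.1 := by
  induction vs with
  | nil => intro D w _ q hq; simp at hq
  | cons v vs ih =>
    intro D w hw q hq x hx
    rw [List.map_cons, shapeOfSizes] at hw
    obtain ⟨l, hl, w', hw', rfl⟩ := hw
    have htake : (l ++ w').take (s v - 1) = l := by rw [← hl.1, List.take_left]
    have hdrop : (l ++ w').drop (s v - 1) = w' := by rw [← hl.1, List.drop_left]
    rw [List.map_cons, decodeBlocks, htake, hdrop, List.zip_cons_cons, List.mem_cons] at hq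
    rw [codeLabels, htake, hdrop, insertLabels]
    set B := D.filter fun x => rankIn D x ∈ l with hB
    have hBD : B ⊆ D := Finset.filter_subset _ _
    rcases hq with rfl | hq
    · rw [if_pos (Finset.mem_filter.1 hx).2]
    · have hcard : (D \ B).card = D.card - (s v - 1) := by
        rw [Finset.card_sdiff_of_subset hBD, hB, card_filter_rankIn hl]
      rw [← hcard] at hw'
      have hxD : x ∈ D \ B :=
        (decodeBlocks_spec _ _ _ hw').2.1 q.2 (List.of_mem_zip hq).2 hx
      rw [Finset.mem_sdiff] at hxD
      have hxl : rankIn D x ∉ l := fun h => hxD.2 (Finset.mem_filter.2 ⟨hxD.1, h⟩)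
      rw [if_neg hxl, length_filter_rankIn hl hxD.1, ← rankIn_sdiff hBD]
      exact ih _ _ hw' q hq x hx

theorem codeLabels_of_mem_decode {n : ℕ} {s : Vtx n → ℕ} {w : List ℕ}
    (hw : w ∈ decFunProd (shape s)) {v : Vtx n} {x : ℕ} (hx : x ∈ decode s w v)
    (hxn : x ∈ Finset.Ico 2 n) : codeLabels s (blockOrder s) w (x - 1) = v := by
  have hv : v ∈ blockOrder s := by
    by_contra h
    rw [decode_of_notMem h] at hx
    simp at hx
  -- The ranks start with the vertex `2`; hence letter `j` of the word, in cell `n + 1 + j`, is the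
  -- label of the vertex `j + 1`.
  have hrank : rankIn (Finset.Ico 2 n) x = x - 1 := by
    rw [Finset.mem_Ico] at hxn
    have : (Finset.Ico 2 n).filter (fun y => y ≤ x) = Finset.Icc 2 x := by
      ext y
      simp only [Finset.mem_filter, Finset.mem_Ico, Finset.mem_Icc]
      omega
    rw [rankIn, this, Nat.card_Icc]
    omega
  have hmap := map_decode hw
  rw [shape, ← Nat.card_Ico] at hw
  rw [← hrank]
  refine codeLabels_rankIn s (blockOrder s) _ w hw (v, decode s w v) ?_ x hx
  rw [← hmap, List.zip_map_right]
  refine List.mem_map.2 ⟨(v, v), ?_, rfl⟩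
  obtain ⟨i, hi, rfl⟩ := List.mem_iff_getElem.1 hv
  exact List.mem_iff_getElem.2 ⟨i, by simpa using hi, by simp⟩

end CayleyRank

namespace CayleyRank

/-! ### Recovering the set partition -/

/-- The sum of the sizes of the blocks in `rest`. -/
def sizeSum {n : ℕ} (s : Vtx n → ℕ) (rest : List (Vtx n)) : ℕ := (rest.map fun v => s v - 1).sum

/-- The parameters of the product class that belongs to the blocks in `rest`. -/
def restShape {n : ℕ} (s : Vtx n → ℕ) (rest : List (Vtx n)) : List (ℕ × ℕ) :=
  shapeOfSizes (sizeSum s rest) (rest.map fun v => s v - 1)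

theorem restShape_cons {n : ℕ} (s : Vtx n → ℕ) (v : Vtx n) (rest : List (Vtx n)) :
    restShape s (v :: rest) = (sizeSum s (v :: rest), s v - 1) :: restShape s rest := by
  rw [restShape, List.map_cons, shapeOfSizes, restShape]
  congr 2
  simp [sizeSum]

theorem sum_pred_degrees {n : ℕ} {s : Vtx n → ℕ} (h1 : ∀ i, 1 ≤ s i)
    (h2 : ∑ i, s i + 2 = 2 * n) : ∑ i, (s i - 1) + 2 = n := by
  have h : ∑ i, s i = ∑ i, (s i - 1) + ∑ _i : Vtx n, 1 := by
    rw [← Finset.sum_add_distrib]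
    refine Finset.sum_congr rfl fun i _ => ?_
    have := h1 i
    omega
  rw [Finset.sum_const, Finset.card_univ, Fintype.card_coe, Nat.card_Icc, smul_eq_mul, mul_one] at h
  omega

theorem sizeSum_add_two_le {n : ℕ} {s : Vtx n → ℕ} (h1 : ∀ i, 1 ≤ s i)
    (h2 : ∑ i, s i + 2 = 2 * n) {rest : List (Vtx n)} (hnd : rest.Nodup) :
    sizeSum s rest + 2 ≤ n := by
  have h3 := sum_pred_degrees h1 h2
  have h4 : sizeSum s rest ≤ ∑ i, (s i - 1) := by
    rw [sizeSum, ← List.sum_toFinset _ hnd]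
    exact Finset.sum_le_univ_sum_of_nonneg fun _ => Nat.zero_le _
  omega

theorem sizeSum_blockOrder {n : ℕ} {s : Vtx n → ℕ} (h1 : ∀ i, 1 ≤ s i)
    (h2 : ∑ i, s i + 2 = 2 * n) : sizeSum s (blockOrder s) = n - 2 := by
  have h3 := sum_pred_degrees h1 h2
  have h4 : sizeSum s (blockOrder s) = ∑ i, (s i - 1) := by
    rw [sizeSum, ← List.sum_toFinset _ (nodup_blockOrder s)]
    refine Finset.sum_subset (Finset.subset_univ _) fun i _ hi => ?_
    rw [List.mem_toFinset, mem_blockOrder] at hi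
    omega
  omega

theorem degree_lt {n : ℕ} {s : Vtx n → ℕ} (h1 : ∀ i, 1 ≤ s i)
    (h2 : ∑ i, s i + 2 = 2 * n) (v : Vtx n) : s v < n := by
  have := sizeSum_add_two_le h1 h2 (List.nodup_singleton v)
  simp only [sizeSum, List.map_cons, List.map_nil, List.sum_cons, List.sum_nil] at this
  omega

/-- The state of the unranking program when the blocks in `rest` have been processed. -/
structure UnrankState {n : ℕ} (s : Vtx n → ℕ) (r : ℕ) (rest : List (Vtx n)) (σ : MState) :
    Prop where
  low : ∀ v : Vtx n, σ.mem v = s v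
  reg31 : σ.reg 31 = n + 1
  reg11 : σ.reg 11 = sizeSum s rest
  reg1 : σ.reg 1 = r / chooseProd (restShape s rest)
  labels : ∀ j, 1 ≤ j → j ≤ sizeSum s rest → σ.mem (n + 1 + j) =
    codeLabels s rest (decFunProdUnrank (restShape s rest) (r % chooseProd (restShape s rest))) j
  small : ∀ j, 1 ≤ j → j ≤ n → σ.mem (n + 1 + j) ≤ n

theorem UnrankState.congr {n : ℕ} {s : Vtx n → ℕ} {r : ℕ} {rest : List (Vtx n)} {σ τ : MState}
    (h : UnrankState s r rest σ) (hmem : τ.mem = σ.mem) (h1 : τ.reg 1 = σ.reg 1)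
    (h11 : τ.reg 11 = σ.reg 11) (h31 : τ.reg 31 = σ.reg 31) : UnrankState s r rest τ :=
  ⟨fun u => by rw [hmem, h.low], h31.trans h.reg31, h11.trans h.reg11, h1.trans h.reg1,
    by rw [hmem]; exact h.labels, by rw [hmem]; exact h.small⟩

/-- The blocks are processed from the last to the first, so that each step divides by one binomial
coefficient instead of a product of many, and the word grows by insertion. -/
theorem unrankBlock_state {n : ℕ} {s : Vtx n → ℕ} (h1 : ∀ i, 1 ≤ s i)
    (h2 : ∑ i, s i + 2 = 2 * n) {r : ℕ} (hr : r ≤ (4 * n) ^ n)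
    {v : Vtx n} {rest : List (Vtx n)} (hnd : (v :: rest).Nodup) {σ : MState} (hc : Consts n σ)
    (h12 : σ.reg 12 = s v) (h13 : σ.reg 13 = v) (h : UnrankState s r rest σ) :
    Tri unrankBlock σ (60 * (n * (s v * (2 * bitLen (4 * n))))) fun τ =>
      SameOff unrankBlock σ τ ∧ UnrankState s r (v :: rest) τ := by
  have hn := two_le_of_degrees h1 h2
  have ha := sizeSum_add_two_le h1 h2 hnd
  have hsum : sizeSum s (v :: rest) = (s v - 1) + sizeSum s rest := by simp [sizeSum]
  have hv := h1 v
  have hvn := Finset.mem_Icc.1 v.2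
  have hr1 : σ.reg 1 ≤ (4 * n) ^ n := by
    rw [h.reg1]
    exact (Nat.div_le_self _ _).trans hr
  have hb : s v = s v - 1 + 1 := by omega
  rw [hb] at h12
  set b := s v - 1 with hbdef
  set a := sizeSum s (v :: rest) with hadef
  have hspec := unrankBlock_spec hn (a := a) (b := b) (v := v) (by omega) ha hvn.2 hc
    (by rw [h.reg11]; omega) h12 h13 h.reg31 hr1 h.small
  rw [← hb] at hspec
  refine Tri.mono hspec le_rfl ?_
  rintro τ ⟨hs, hoff, hword, hreg1, hreg11⟩
  set C := a.choose b with hC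
  have hCpos : 0 < C := Nat.choose_pos (by omega)
  set CP := chooseProd (restShape s rest) with hCP
  have hprod : chooseProd (restShape s (v :: rest)) = CP * C := by
    rw [restShape_cons, chooseProd_cons, mul_comm]
  have hl := (decFunUnrank_spec b (Nat.mod_lt (σ.reg 1) hCpos)).1
  have hlab : ∀ j, 1 ≤ j → j ≤ a → j ∉ decFunUnrank b (σ.reg 1 % C) →
      insertLabels (fun j => σ.mem (n + 1 + j)) (decFunUnrank b (σ.reg 1 % C)) v j ≤ n := by
    intro j hj1 hja hj
    have := insertLabels_pos_bounds hl hj1 hja hj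
    rw [insertLabels, if_neg hj]
    exact h.small _ this.1 (by omega)
  refine ⟨hs, fun u => ?_, (hs 31 (by decide)).trans h.reg31, hreg11, ?_, fun j hj1 hja => ?_,
    fun j hj1 hjn => ?_⟩
  · have := Finset.mem_Icc.1 u.2
    rw [hoff u (by omega), h.low]
  · rw [hreg1, h.reg1, hprod, Nat.div_div_eq_div_mul]
  -- Extracting digits from below agrees with extracting them from above: `(r mod CP * C) / CP = (r
  -- / CP) mod C` and `(r mod CP * C) mod CP = r mod CP`.
  · rw [hword j hj1 hja, hprod, restShape_cons, decFunProdUnrank, codeLabels, ← hCP, ← hbdef,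
      Nat.mod_mul_right_div_self, Nat.mod_mod_of_dvd _ (dvd_mul_right _ _), ← h.reg1]
    have hlen : (decFunUnrank b (σ.reg 1 % C)).length = b := hl.1
    rw [List.take_left' hlen, List.drop_left' hlen]
    by_cases hj : j ∈ decFunUnrank b (σ.reg 1 % C)
    · rw [insertLabels, if_pos hj, insertLabels, if_pos hj]
    · have := insertLabels_pos_bounds hl hj1 hja hj
      rw [insertLabels, if_neg hj, insertLabels, if_neg hj]
      exact h.labels _ this.1 (this.2.trans (by omega))
  · by_cases hja : j ≤ a
    · rw [hword j hj1 hja]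
      by_cases hj : j ∈ decFunUnrank b (σ.reg 1 % C)
      · rw [insertLabels, if_pos hj]
        exact hvn.2
      · exact hlab j hj1 hja hj
    · rw [hoff _ (by omega)]
      exact h.small j hj1 hjn

/-- The reverse of the scan for ranking: degrees from `n - 1` down to `2`, and for each of them the
vertices from `n` down to `1`. -/
def unrankInner : Program :=
  .seq (.seq (.load 15 13) (distProg 15 12))
    (.seq (.ifLt 2 16 .skip unrankBlock) (.arith .sub 13 13 3))

def unrankOuter : Program :=
  .seq (.arith .add 13 0 2) (.seq (.whileLt 2 13 unrankInner) (.arith .sub 12 12 3))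

def unrankInit : Program :=
  .seq (.const 3 1) (.seq (.arith .add 31 0 3) (.arith .sub 12 0 3))

/-- The program that finds the set partition. -/
def labelProg : Program := .seq unrankInit (.whileLt 3 12 unrankOuter)

theorem unrankInner_spec {n : ℕ} {s : Vtx n → ℕ} (h1 : ∀ i, 1 ≤ s i)
    (h2 : ∑ i, s i + 2 = 2 * n) {r : ℕ} (hr : r ≤ (4 * n) ^ n)
    {z : ℕ} (hz : 2 ≤ z) (hzn : z < n) {v : Vtx n} {σ : MState} (hc : Consts n σ)
    (h12 : σ.reg 12 = z) (h13 : σ.reg 13 = v)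
    (h : UnrankState s r (restBlocks s z (v + 1)) σ) :
    Tri unrankInner σ (7 * (2 * bitLen (4 * n)) +
        if degreeOf s v = z then 60 * n * (2 * bitLen (4 * n)) * degreeOf s v else 0) fun τ =>
      τ.reg 13 = v - 1 ∧ UnrankState s r (restBlocks s z v) τ := by
  set W := 2 * bitLen (4 * n) with hW
  have hvn := Finset.mem_Icc.1 v.2
  have hv := degree_lt h1 h2 v
  rw [degreeOf_coe]
  have hfin : ∀ τ rest, UnrankState s r rest τ → Consts n τ → τ.reg 13 = v →
      Tri (.arith .sub 13 13 3) τ (1 * W) fun τ => τ.reg 13 = v - 1 ∧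
        UnrankState s r rest τ := by
    intro τ rest h hc h13
    refine Tri.of_vc (B := 4 * n) (P := .arith .sub 13 13 3) ?_
    simp only [vc, ArithOp.eval, h13, hc.reg3]
    exact ⟨by omega, by omega, by simp [setReg_reg], h.congr rfl (by simp [setReg_reg])
      (by simp [setReg_reg]) (by simp [setReg_reg])⟩
  refine Tri.mono (Tri.seq (c := 4 * W) (d := (1 * W + (W + if s v = z then
    60 * n * W * s v else 0)) + 1 * W) (Tri.mono (Tri.frame (Tri.of_vc (B := 4 * n)
    (P := .seq (.load 15 13) (distProg 15 12))
    (R := fun τ => τ.reg 16 = (s v - z) + (z - s v) ∧ τ.mem = σ.mem) ?_)) le_rfl ?_)) (by omega)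
    fun _ h => h
  · simp only [distProg, vc, setReg_reg, setReg_mem, ArithOp.eval, h12, h13, h.low v,
      Nat.reduceEqDiff, if_true, if_false, and_true]
    refine ⟨?_, ?_, ?_, ?_, ?_, ?_, ?_, ?_⟩ <;> omega
  · rintro τ ⟨⟨h16, hmem⟩, hs⟩
    have hcτ := hc.of_sameOff hs
    have h12τ := (hs 12 (by decide)).trans h12
    have h13τ := (hs 13 (by decide)).trans h13
    have hst := h.congr hmem (hs 1 (by decide)) (hs 11 (by decide)) (hs 31 (by decide))
    refine Tri.seq (Tri.ifLt (B := 4 * n)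
      (c := W + if s v = z then 60 * n * W * s v else 0) (by rw [hcτ.reg2]; omega)
      (by rw [h16]; omega) ?_ ?_ |>.mono (by omega) fun _ h => h)
    · intro hlt
      rw [hcτ.reg2, h16] at hlt
      have hne : s v ≠ z := by omega
      rw [← restBlocks_succ_of_ne hne] at hst
      exact ⟨τ, 1, .skip τ, by have := one_le_bitLen (4 * n); omega, hfin τ _ hst hcτ h13τ⟩
    · intro hlt
      rw [hcτ.reg2, h16] at hlt
      have heq : s v = z := by omega
      have hnd := nodup_restBlocks s z v
      rw [restBlocks_eq_cons hz heq] at hnd ⊢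
      rw [if_pos heq]
      refine Tri.mono (unrankBlock_state h1 h2 hr hnd hcτ (h12τ.trans heq.symm) h13τ hst)
        ((le_of_eq (by ring)).trans (Nat.le_add_left _ _)) ?_
      rintro υ ⟨hsυ, hstυ⟩
      exact hfin υ _ hstυ (hcτ.of_sameOff hsυ) ((hsυ 13 (by decide)).trans h13τ)

theorem unrankOuter_spec {n : ℕ} {s : Vtx n → ℕ} (h1 : ∀ i, 1 ≤ s i)
    (h2 : ∑ i, s i + 2 = 2 * n) {r : ℕ} (hr : r ≤ (4 * n) ^ n)
    {z : ℕ} (hz : 2 ≤ z) (hzn : z < n) {σ : MState} (hc : Consts n σ)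
    (h12 : σ.reg 12 = z) (h : UnrankState s r (restBlocks s (z + 1) 1) σ) :
    Tri unrankOuter σ (outerCost s (2 * bitLen (4 * n)) z fun i => n - i) fun τ =>
      τ.reg 12 = z - 1 ∧ UnrankState s r (restBlocks s z 1) τ := by
  set W := 2 * bitLen (4 * n) with hW
  refine Tri.mono (Tri.seq (c := 1 * W) (d := (∑ i ∈ Finset.range n, ((7 * W +
    if degreeOf s (n - i) = z then 60 * n * W * degreeOf s (n - i) else 0) + W) + W) + 1 * W)
    (Tri.mono (Tri.frame (Tri.of_vc (B := 4 * n) (P := .arith .add 13 0 2)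
    (R := fun τ => τ.reg 13 = n ∧ τ.mem = σ.mem) ?_)) le_rfl ?_)) ?_ fun _ h => h
  · simp only [vc, setReg_reg, setReg_mem, ArithOp.eval, hc.reg0, hc.reg2, if_true, and_true,
      add_zero]
    omega
  · rintro σ₁ ⟨⟨h13, hmem⟩, hs₁⟩
    have hc₁ := hc.of_sameOff hs₁
    have h12₁ := (hs₁ 12 (by decide)).trans h12
    rw [← restBlocks_succ] at h
    refine Tri.seq (Tri.mono (Tri.while_count (fun i τ => τ.reg 13 = n - i ∧
      UnrankState s r (restBlocks s z (n - i + 1)) τ) n (fun i => 7 * W +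
        if degreeOf s (n - i) = z then 60 * n * W * degreeOf s (n - i) else 0) W
      ⟨h13, h.congr hmem (hs₁ 1 (by decide)) (hs₁ 11 (by decide)) (hs₁ 31 (by decide))⟩
      ?_ ?_) le_rfl ?_)
    · rintro i hi τ hs ⟨h13, hst⟩
      have h12 := (hs 12 (by decide)).trans h12₁
      have hcτ := hc₁.of_sameOff hs
      rw [h13, hcτ.reg2]
      refine ⟨by omega, guard_le (by omega) (by omega), ?_⟩
      have hi' : n - (i + 1) + 1 = n - i := by omega
      have hi'' : n - (i + 1) = n - i - 1 := by omega
      rw [hi', hi'']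
      exact unrankInner_spec h1 h2 hr hz hzn (v := ⟨n - i, by simp; omega⟩) hcτ h12 h13 hst
    · rintro τ hs ⟨h13, -⟩
      rw [h13, (hc₁.of_sameOff hs).reg2]
      exact ⟨by omega, guard_le (by omega) (by omega)⟩
    · rintro τ ⟨⟨h13, hst⟩, hs⟩
      have h12 := (hs 12 (by decide)).trans h12₁
      rw [Nat.sub_self, zero_add] at hst
      refine Tri.of_vc (B := 4 * n) (P := .arith .sub 12 12 3) ?_
      simp only [vc, ArithOp.eval, h12, (hc₁.of_sameOff hs).reg3]
      exact ⟨by omega, by omega, by simp [setReg_reg], hst.congr rfl (by simp [setReg_reg])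
        (by simp [setReg_reg]) (by simp [setReg_reg])⟩
  · rw [outerCost]
    refine le_of_eq ?_
    have : ∀ i, 7 * W + (if degreeOf s (n - i) = z then 60 * n * W * degreeOf s (n - i) else 0) +
      W = 8 * W + if degreeOf s (n - i) = z then 60 * n * W * degreeOf s (n - i) else 0 :=
      fun i => by ring
    simp only [this]
    ring

theorem labelProg_spec {n : ℕ} {s : Vtx n → ℕ} (h1 : ∀ i, 1 ≤ s i)
    (h2 : ∑ i, s i + 2 = 2 * n) {r : ℕ} (hr : r < chooseProd (shape s)) :
    Tri labelProg (unrankInput s r) (144 * (n * n * (2 * bitLen (4 * n)))) fun τ =>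
      Consts n τ ∧ τ.reg 31 = n + 1 ∧
      ∀ x ∈ Finset.Ico 2 n, ∀ v, x ∈ decode s (decFunProdUnrank (shape s) r) v →
        τ.mem (n + x) = v := by
  have hn := two_le_of_degrees h1 h2
  have hr' : r ≤ (4 * n) ^ n := hr.le.trans (chooseProd_shape_le (by omega) s)
  set W := 2 * bitLen (4 * n) with hW
  refine Tri.mono (Tri.seq (c := 3 * W) (d := ∑ j ∈ Finset.range (n - 2),
    (outerCost s W (n - 1 - j) (fun i => n - i) + W) + W) (Tri.mono
    (Tri.of_vc (B := 4 * n) (P := unrankInit) (R := fun τ => Consts n τ ∧ τ.reg 12 = n - 1 ∧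
      UnrankState s r [] τ) ?_) le_rfl ?_)) ?_ fun _ h => h
  · simp only [unrankInit, vc, setReg_reg, ArithOp.eval, unrankInput,
      Nat.reduceEqDiff, if_true, if_false, OfNat.zero_ne_ofNat, OfNat.ofNat_ne_zero]
    refine ⟨by omega, by omega, by omega, by omega, by omega, ⟨by simp [setReg_reg],
      by simp [setReg_reg], by simp [setReg_reg]⟩, trivial, fun v => ?_, by simp [setReg_reg], ?_, ?_,
      fun j hj1 hj => ?_, fun j hj1 hj => ?_⟩
    · simp only [setReg_mem, dif_pos v.2]
    · simp [setReg_reg, sizeSum]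
    · simp [setReg_reg, restShape, shapeOfSizes, chooseProd]
    · simp [sizeSum] at hj
      omega
    · have : n + 1 + j ∉ Finset.Icc 1 n := by simp; omega
      simp only [setReg_mem, dif_neg this]
      omega
  · rintro σ₁ ⟨hc₁, h12₁, hst₁⟩
    have hnil : restBlocks s n 1 = [] := restBlocks_eq_nil fun u => degree_lt h1 h2 u
    rw [← hnil] at hst₁
    refine Tri.mono (Tri.while_count (fun j τ => τ.reg 12 = n - 1 - j ∧
      UnrankState s r (restBlocks s (n - j) 1) τ) (n - 2)
      (fun j => outerCost s W (n - 1 - j) fun i => n - i) W ⟨h12₁, hst₁⟩ ?_ ?_) le_rfl ?_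
    · rintro j hj τ hs ⟨h12, hst⟩
      have hc := hc₁.of_sameOff hs
      rw [h12, hc.reg3]
      refine ⟨by omega, guard_le (by omega) (by omega), ?_⟩
      have e1 : n - j = n - 1 - j + 1 := by omega
      have e2 : n - (j + 1) = n - 1 - j := by omega
      have e3 : n - 1 - (j + 1) = n - 1 - j - 1 := by omega
      rw [e1] at hst
      rw [e2, e3]
      exact unrankOuter_spec h1 h2 hr' (by omega) (by omega) hc h12 hst
    · rintro τ hs ⟨h12, -⟩
      rw [h12, (hc₁.of_sameOff hs).reg3]
      exact ⟨by omega, guard_le (by omega) (by omega)⟩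
    · rintro τ ⟨⟨-, hst⟩, hs⟩
      have e : n - (n - 2) = 2 := by omega
      rw [e, restBlocks_two] at hst
      have hsum := sizeSum_blockOrder h1 h2
      have hshape : restShape s (blockOrder s) = shape s := by rw [restShape, hsum, shape]
      refine ⟨hc₁.of_sameOff hs, hst.reg31, fun x hx v hxv => ?_⟩
      rw [← codeLabels_of_mem_decode (decFunProdUnrank_spec _ hr).1 hxv hx]
      rw [Finset.mem_Ico] at hx
      have := hst.labels (x - 1) (by omega) (by omega)
      rw [hshape, Nat.mod_eq_of_lt hr] at this
      rw [← this]
      congr 1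
      omega
  · have hidx : ∑ i ∈ Finset.range n, degreeOf s (n - i) = ∑ v, s v := by
      rw [← sum_degreeOf s, ← Finset.sum_range_reflect]
      refine Finset.sum_congr rfl fun i hi => ?_
      rw [Finset.mem_range] at hi
      congr 1
      omega
    have h3 := sum_outerCost_le hn h2 W (h := fun j => n - 1 - j) (idx := fun i => n - i)
      (fun a ha b hb h => by
        simp only [Finset.coe_range, Set.mem_Iio] at ha hb h
        omega) hidx
    have h4 : W ≤ n * n * W := Nat.le_mul_of_pos_left _ (by nlinarith)
    omega

end CayleyRank

namespace CayleyRank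
open Relation

/-! ### The program for `Θ` -/

/-- The iterates up to the first visit to the fixed point `m` are distinct, so this visit happens
within `card α` steps, and from then on the iteration stays there. -/
theorem iterate_card_eq_of_exists {α : Type*} [Fintype α] {g : α → α} {x m : α} (hm : g m = m)
    (h : ∃ k, g^[k] x = m) : g^[Fintype.card α] x = m := by
  classical
  have hk := Nat.find_spec h
  have hmin : ∀ j < Nat.find h, g^[j] x ≠ m := fun j => Nat.find_min h
  set k := Nat.find h with hkdef
  have hinj : Set.InjOn (fun j => g^[j] x) (Finset.range (k + 1)) := by
    have key : ∀ i j, i < j → j ≤ k → g^[i] x ≠ g^[j] x := by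
      intro i j hij hj heq
      refine hmin (k - j + i) (by omega) ?_
      rw [Function.iterate_add_apply, heq, ← Function.iterate_add_apply,
        Nat.sub_add_cancel hj, hk]
    intro i hi j hj heq
    simp only [Finset.coe_range, Set.mem_Iio] at hi hj
    rcases lt_trichotomy i j with h | h | h
    · exact absurd heq (key i j h (by omega))
    · exact h
    · exact absurd heq.symm (key j i h (by omega))
  have hcard := Finset.card_le_card_of_injOn (s := Finset.range (k + 1)) (t := Finset.univ)
    (fun j => g^[j] x) (fun _ _ => Finset.mem_coe.2 (Finset.mem_univ _)) hinj
  rw [Finset.card_range, Finset.card_univ] at hcard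
  rw [show Fintype.card α = (Fintype.card α - k) + k by omega, Function.iterate_add_apply, hk,
    Function.iterate_fixed hm]

/-- The total function that agrees with `f` and fixes `1` and `n`. -/
def extendFun {n : ℕ} (f : FunClass n) (x : Vtx n) : Vtx n :=
  if h : (x : ℕ) ∈ Finset.Ico 2 n then f ⟨x, h⟩ else x

theorem funGraph_adj_extendFun {n : ℕ} (f : FunClass n) {x : Vtx n} (h2 : 2 ≤ (x : ℕ))
    (hn : (x : ℕ) < n) : (funGraph f).Adj x (extendFun f x) := by
  have h : (x : ℕ) ∈ Finset.Ico 2 n := by simp; omega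
  exact ⟨h, by rw [extendFun, dif_pos h]⟩

theorem extendFun_eq_of_adj {n : ℕ} {f : FunClass n} {x y : Vtx n} (h : (funGraph f).Adj x y) :
    extendFun f x = y := by
  have := funGraph_adj_mem h
  exact funGraph_rightUnique f (funGraph_adj_extendFun f this.1 this.2) h

/-- One step of the walk that stops at a vertex that is not smaller than `m`. -/
def walkStep {n : ℕ} (f : FunClass n) (m x : Vtx n) : Vtx n := if x < m then extendFun f x else x

/-- A walk from `f m` that is frozen at the first vertex not smaller than `m` comes back to `m` if
and only if `m` lies on a cycle without larger vertices. -/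
theorem isCycleMax_iff_exists_iterate {n : ℕ} {f : FunClass n} {m : Vtx n} (h2 : 2 ≤ (m : ℕ))
    (hmn : (m : ℕ) < n) :
    IsCycleMax (funGraph f) m ↔ ∃ k, (walkStep f m)^[k] (extendFun f m) = m := by
  have hadj := funGraph_adj_extendFun f h2 hmn
  constructor
  · intro hm
    have key : ∀ x, ReflTransGen (funGraph f).Adj x m → ReflTransGen (funGraph f).Adj m x →
        ∃ k, (walkStep f m)^[k] x = m := by
      intro x hx
      induction hx using ReflTransGen.head_induction_on with
      | refl => exact fun _ => ⟨0, rfl⟩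
      | head h hz ih =>
        rename_i x z
        intro hmx
        by_cases hxm : x = m
        · exact ⟨0, hxm⟩
        · have hle : x ≤ m := by
            rcases hmx.cases_tail with h' | ⟨y, hy, hyx⟩
            · exact h'.le
            · exact hm.2 x (TransGen.tail' hy hyx) (TransGen.head' h hz)
          obtain ⟨k, hk⟩ := ih (hmx.tail h)
          refine ⟨k + 1, ?_⟩
          rw [Function.iterate_succ_apply, walkStep, if_pos (lt_of_le_of_ne hle hxm),
            extendFun_eq_of_adj h, hk]
    refine key _ ?_ (.single hadj)
    obtain ⟨y, hy, hym⟩ := TransGen.head'_iff.1 hm.1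
    rwa [extendFun_eq_of_adj hy]
  · rintro ⟨K, hK⟩
    set y : ℕ → Vtx n := fun j => (walkStep f m)^[j] (extendFun f m) with hy
    have hfix : ∀ j, m ≤ y j → ∀ i, y (i + j) = y j := by
      intro j hj i
      simp only [hy]
      rw [Function.iterate_add_apply, Function.iterate_fixed]
      exact if_neg (not_lt.2 hj)
    -- A walk that exceeds `m` is frozen there for good, but it is also frozen at `m` from step `K`
    -- on.
    have hle : ∀ j, y j ≤ m := by
      intro j
      by_contra hcon
      rw [not_le] at hcon
      have h3 := hfix j hcon.le K
      rw [Nat.add_comm, hfix K (show m ≤ y K from hK.ge) j] at h3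
      exact hcon.ne (hK.symm.trans h3)
    have hreach : ∀ j, ReflTransGen (funGraph f).Adj (extendFun f m) (y j) := by
      intro j
      induction j with
      | zero => exact .refl
      | succ j ih =>
        simp only [hy, Function.iterate_succ_apply'] at ih ⊢
        rw [walkStep]
        split_ifs with hlt
        -- At the vertex `1`, which `extendFun` fixes, the walk rests.
        · by_cases h1 : 2 ≤ (((walkStep f m)^[j] (extendFun f m) : Vtx n) : ℕ)
          · exact ih.tail (funGraph_adj_extendFun f h1 (lt_trans hlt hmn))
          · have h3 : (((walkStep f m)^[j] (extendFun f m) : Vtx n) : ℕ) ∉ Finset.Ico 2 n := by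
              rw [Finset.mem_Ico]
              exact fun h => h1 h.1
            have h4 : extendFun f ((walkStep f m)^[j] (extendFun f m)) =
                (walkStep f m)^[j] (extendFun f m) := dif_neg h3
            rwa [h4]
        · exact ih
    have hclosed : ∀ w, TransGen (funGraph f).Adj m w → ∃ j, w = y j := by
      intro w hw
      induction hw with
      | single h => exact ⟨0, (extendFun_eq_of_adj h).symm⟩
      | tail _ h ih =>
        obtain ⟨j, rfl⟩ := ih
        rcases (hle j).lt_or_eq with hlt | heq
        · refine ⟨j + 1, ?_⟩
          simp only [hy, Function.iterate_succ_apply'] at hlt h ⊢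
          rw [walkStep, if_pos hlt, extendFun_eq_of_adj h]
        · rw [heq] at h
          exact ⟨0, (extendFun_eq_of_adj h).symm⟩
    refine ⟨TransGen.head' hadj (hK ▸ hreach K), fun w hw _ => ?_⟩
    obtain ⟨j, rfl⟩ := hclosed w hw
    exact hle j

theorem isCycleMax_iff_iterate {n : ℕ} {f : FunClass n} {m : Vtx n} (h2 : 2 ≤ (m : ℕ))
    (hmn : (m : ℕ) < n) :
    IsCycleMax (funGraph f) m ↔ (walkStep f m)^[n] (extendFun f m) = m := by
  rw [isCycleMax_iff_exists_iterate h2 hmn]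
  refine ⟨fun h => ?_, fun h => ⟨n, h⟩⟩
  have := iterate_card_eq_of_exists (g := walkStep f m) (if_neg (lt_irrefl m)) h
  rwa [Fintype.card_coe, Nat.card_Icc, Nat.add_sub_cancel] at this

/-- `t` is the head of the new arc that leaves a jump vertex `k` in `theta G`. -/
def IsTarget {n : ℕ} (G : Digraph (Vtx n)) (k : ℕ) (t : Vtx n) : Prop :=
  (∃ m, IsGreatest {m' : Vtx n | IsCycleMax G m' ∧ (m' : ℕ) < k} m ∧ G.Adj m t) ∨
    ((∀ m, IsCycleMax G m → ¬ (m : ℕ) < k) ∧ (t : ℕ) = 1)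

theorem IsTarget.adj_theta {n : ℕ} {G : Digraph (Vtx n)} {u t : Vtx n} (h : IsTarget G u t)
    (hu : (u : ℕ) = n ∨ IsCycleMax G u) : (theta G).Adj u t :=
  Or.inr ⟨hu, h⟩

theorem isTarget_succ_of_isCycleMax {n : ℕ} {G : Digraph (Vtx n)} {m t : Vtx n}
    (hm : IsCycleMax G m) (ht : G.Adj m t) : IsTarget G (m + 1) t :=
  Or.inl ⟨m, ⟨⟨hm, Nat.lt_succ_self _⟩, fun _ h => Nat.lt_succ_iff.1 h.2⟩, ht⟩

theorem IsTarget.succ_of_not {n : ℕ} {G : Digraph (Vtx n)} {m t : Vtx n}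
    (h : IsTarget G m t) (hm : ¬ IsCycleMax G m) : IsTarget G (m + 1) t := by
  have key : ∀ m' : Vtx n, IsCycleMax G m' → ((m' : ℕ) < m + 1 ↔ (m' : ℕ) < m) := by
    intro m' hm'
    have : (m' : ℕ) ≠ m := fun h => hm (Subtype.ext h ▸ hm')
    omega
  have hset : {m' : Vtx n | IsCycleMax G m' ∧ (m' : ℕ) < m + 1} =
      {m' : Vtx n | IsCycleMax G m' ∧ (m' : ℕ) < m} :=
    Set.ext fun m' => and_congr_right (key m')
  rw [IsTarget, hset]
  exact h.imp_right fun h => ⟨fun m' hm' hlt => h.1 m' hm' ((key m' hm').1 hlt), h.2⟩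

def walkBody : Program :=
  .seq (.ifLt 34 33 (.seq (.arith .add 36 0 34) (.load 34 36)) .skip) (.arith .add 35 35 3)

def thetaBodyInit : Program := .seq (.arith .add 7 0 33) (.seq (.load 34 7) (.const 35 0))

/-- Register `32` holds the head for the next jump vertex. If the walk has not come back to `m`, the
arc of `m` is copied; otherwise `m` is given the head in register `32`, and its old head takes that
place. -/
def thetaBodyFinish : Program :=
  .seq (distProg 34 33) (.seq (.seq (.arith .add 7 0 33) (.load 36 7))
    (.seq (.ifLt 2 16 (.store 33 36) (.seq (.store 33 32) (.arith .add 32 36 2)))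
      (.arith .add 33 33 3)))

def thetaBody : Program := .seq thetaBodyInit (.seq (.whileLt 35 0 walkBody) thetaBodyFinish)

/-- The arcs of the function are in the cells above `n`, those of its image under `Θ` are
written to the cells `2, …, n`. -/
def thetaProg : Program :=
  .seq (.seq (.store 31 3) (.seq (.const 32 1) (.const 33 2)))
    (.seq (.whileLt 33 0 thetaBody) (.store 0 32))

theorem walk_spec {n : ℕ} (hn : 2 ≤ n) {f : FunClass n} {m : Vtx n} (hmn : (m : ℕ) < n)
    {σ₀ : MState} (hc : Consts n σ₀) (h33 : σ₀.reg 33 = m) (h34 : σ₀.reg 34 = extendFun f m)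
    (h35 : σ₀.reg 35 = 0) (hM : ∀ x : Vtx n, (x : ℕ) < n → σ₀.mem (n + x) = extendFun f x) :
    Tri (.whileLt 35 0 walkBody) σ₀ (n * (5 * (2 * bitLen (4 * n)) + 2 * bitLen (4 * n)) +
      2 * bitLen (4 * n)) fun τ => SameOff walkBody σ₀ τ ∧ τ.mem = σ₀.mem ∧
        τ.reg 34 = (walkStep f m)^[n] (extendFun f m) := by
  set W := 2 * bitLen (4 * n) with hW
  refine Tri.mono (Tri.while_count (fun i σ => σ.mem = σ₀.mem ∧ σ.reg 35 = i ∧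
    σ.reg 34 = (walkStep f m)^[i] (extendFun f m)) n (fun _ => 5 * W) W ⟨rfl, h35, h34⟩ ?_ ?_)
    (by simp) fun τ h => ⟨h.2, h.1.1, h.1.2.2⟩
  · rintro i hi σ hs ⟨hmem, h35, h34⟩
    have hc := hc.of_sameOff hs
    have h33 := (hs 33 (by decide)).trans h33
    rw [h35, hc.reg0]
    refine ⟨hi, guard_le (by omega) (by omega), ?_⟩
    refine Tri.mono (Tri.of_vc (B := 4 * n) (P := walkBody) ?_) le_rfl fun _ h => h
    rw [Function.iterate_succ_apply']
    generalize (walkStep f m)^[i] (extendFun f m) = x at h34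
    have hxn := Finset.mem_Icc.1 x.2
    have hyn := Finset.mem_Icc.1 (extendFun f x).2
    have hx := hM x
    simp only [walkBody, vc, setReg_reg, setReg_mem, ArithOp.eval, hc.reg0, hc.reg3, h33, h34, h35,
      hmem, Nat.reduceEqDiff, if_true, if_false, walkStep, ← Subtype.coe_lt_coe]
    refine ⟨by omega, by omega, fun hlt => ?_, fun hlt => ?_⟩
    · rw [hx (by omega)]
      refine ⟨by omega, by omega, by omega, by omega, by omega, by omega, trivial, trivial, ?_⟩
      rw [if_pos hlt]
    · refine ⟨by omega, by omega, trivial, trivial, ?_⟩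
      rw [if_neg hlt]
  · rintro σ hs ⟨-, h35, -⟩
    rw [h35, (hc.of_sameOff hs).reg0]
    exact ⟨lt_irrefl _, guard_le (by omega) (by omega)⟩

/-- The state when the vertices smaller than `m` have been processed. -/
structure ThetaInv {n : ℕ} (f : FunClass n) (m : ℕ) (σ : MState) : Prop where
  reg33 : σ.reg 33 = m
  arcs : ∀ x : Vtx n, (x : ℕ) < n → σ.mem (n + x) = extendFun f x
  target : ∃ t : Vtx n, σ.reg 32 = t ∧ IsTarget (funGraph f) m t
  done : ∀ u : Vtx n, 2 ≤ (u : ℕ) → (u : ℕ) < m →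
    ∃ v : Vtx n, (theta (funGraph f)).Adj u v ∧ σ.mem u = v

theorem thetaBody_spec {n : ℕ} (hn : 2 ≤ n) {f : FunClass n} {m : Vtx n} (h2 : 2 ≤ (m : ℕ))
    (hmn : (m : ℕ) < n) {σ₀ : MState} (hc : Consts n σ₀) (h : ThetaInv f m σ₀) :
    Tri thetaBody σ₀ (20 * (n * (2 * bitLen (4 * n)))) (ThetaInv f (m + 1)) := by
  set W := 2 * bitLen (4 * n) with hW
  have hy := Finset.mem_Icc.1 (extendFun f m).2
  refine Tri.mono (Tri.seq (c := 3 * W) (d := (n * (5 * W + W) + W) + 10 * W) (Tri.mono (Tri.frame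
    (Tri.of_vc (B := 4 * n) (P := thetaBodyInit) (R := fun τ => τ.mem = σ₀.mem ∧
      τ.reg 34 = extendFun f m ∧ τ.reg 35 = 0) ?_)) le_rfl ?_)) ?_ fun _ h => h
  · simp only [thetaBodyInit, vc, setReg_reg, setReg_mem, ArithOp.eval, hc.reg0, h.reg33,
      h.arcs m hmn, Nat.reduceEqDiff, if_true, if_false, and_true]
    omega
  · rintro σ₁ ⟨⟨hm₁, h34, h35⟩, hs₁⟩
    have hc₁ := hc.of_sameOff hs₁
    have e33 := (hs₁ 33 (by decide)).trans h.reg33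
    refine Tri.seq (Tri.mono (walk_spec hn hmn hc₁ e33 h34 h35 (by rw [hm₁]; exact h.arcs))
      le_rfl ?_)
    rintro σ₂ ⟨hs₂, hm₂, h34⟩
    have hc₂ := hc₁.of_sameOff hs₂
    have e33 := (hs₂ 33 (by decide)).trans e33
    obtain ⟨t, ht, htt⟩ := h.target
    have htn := Finset.mem_Icc.1 t.2
    have e32 : σ₂.reg 32 = t := (hs₂ 32 (by decide)).trans ((hs₁ 32 (by decide)).trans ht)
    have hmem : σ₂.mem = σ₀.mem := hm₂.trans hm₁
    have hiff := isCycleMax_iff_iterate (f := f) h2 hmn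
    generalize (walkStep f m)^[n] (extendFun f m) = x at h34 hiff
    have hxn := Finset.mem_Icc.1 x.2
    have hadj := funGraph_adj_extendFun f h2 hmn
    have harcs : ∀ y, ∀ x : Vtx n, (x : ℕ) < n →
        Function.update σ₀.mem m y (n + x) = extendFun f x := by
      intro y x hx
      have := Finset.mem_Icc.1 x.2
      rw [Function.update_of_ne (by omega), h.arcs x hx]
    have hdone : ∀ v : Vtx n, (theta (funGraph f)).Adj m v → ∀ u : Vtx n, 2 ≤ (u : ℕ) →
        (u : ℕ) < m + 1 → ∃ w : Vtx n, (theta (funGraph f)).Adj u w ∧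
          Function.update σ₀.mem m v u = w := by
      intro v hv u hu hum
      by_cases hum' : u = m
      · subst hum'
        exact ⟨v, hv, Function.update_self ..⟩
      · have : (u : ℕ) ≠ m := fun h => hum' (Subtype.ext h)
        rw [Function.update_of_ne this]
        exact h.done u hu (by omega)
    refine Tri.of_vc (B := 4 * n) (P := thetaBodyFinish) ?_
    simp only [thetaBodyFinish, distProg, vc, setReg_reg, setReg_mem, setMem_reg, ArithOp.eval,
      hc₂.reg0, hc₂.reg2, hc₂.reg3, h34, e33, e32, hmem, h.arcs m hmn, Nat.reduceEqDiff, if_true,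
      if_false, add_zero]
    refine ⟨by omega, by omega, by omega, by omega, by omega, by omega, by omega, by omega,
      by omega, by omega, by omega, by omega, fun hlt => ⟨by omega, by omega, by omega, by omega, ?_⟩,
      fun hlt => ⟨by omega, by omega, by omega, by omega, by omega, by omega, ?_⟩⟩
    · have hnot : ¬ IsCycleMax (funGraph f) m := by
        rw [hiff]
        rintro rfl
        omega
      refine ⟨by simp [setReg_reg], ?_, ⟨t, by simp [setReg_reg, setMem_reg, e32],
        htt.succ_of_not hnot⟩, ?_⟩
      · simp only [setReg_mem, setMem_mem, hmem]
        exact harcs _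
      · simp only [setReg_mem, setMem_mem, hmem]
        exact hdone _ (Or.inl ⟨hadj, hnot⟩)
    · have hmax : IsCycleMax (funGraph f) m := hiff.2 (Subtype.ext (by omega))
      refine ⟨by simp [setReg_reg], ?_, ⟨extendFun f m, by simp [setReg_reg],
        isTarget_succ_of_isCycleMax hmax hadj⟩, ?_⟩
      · simp only [setReg_mem, setMem_mem, hmem]
        exact harcs _
      · simp only [setReg_mem, setMem_mem, hmem]
        exact hdone _ (htt.adj_theta (Or.inr hmax))
  · have h9 : W ≤ n * W := Nat.le_mul_of_pos_left _ (by omega)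
    have h10 : 2 * W ≤ n * W := Nat.mul_le_mul_right _ hn
    have e1 : n * (5 * W + W) = 6 * (n * W) := by ring
    rw [e1]
    omega

/-- Going through the vertices upwards, the head needed at a jump vertex is the old head of the last
cycle maximum that was met, or `1`. Each vertex is tested for being a cycle maximum by `n` steps of
a walk, which gives `O(n²)` steps in all. -/
theorem thetaProg_spec {n : ℕ} (hn : 2 ≤ n) {f : FunClass n} {σ₀ : MState} (hc : Consts n σ₀)
    (h31 : σ₀.reg 31 = n + 1)
    (hM : ∀ x ∈ Finset.Ico 2 n, ∀ v, (∃ u : Vtx n, (u : ℕ) = x ∧ (funGraph f).Adj u v) →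
      σ₀.mem (n + x) = v) :
    Tri thetaProg σ₀ (30 * (n * n * (2 * bitLen (4 * n)))) fun τ =>
      IsArcTable (theta (funGraph f)) τ.mem := by
  set W := 2 * bitLen (4 * n) with hW
  have h1V : 1 ∈ Finset.Icc 1 n := by simp; omega
  refine Tri.mono (Tri.seq (c := 3 * W) (d := (∑ j ∈ Finset.range (n - 2),
    (20 * (n * W) + W) + W) + 1 * W) (Tri.mono (Tri.frame
    (Tri.of_vc (B := 4 * n) (P := .seq (.store 31 3) (.seq (.const 32 1) (.const 33 2)))
      (R := ThetaInv f 2) ?_)) le_rfl ?_)) ?_ fun _ h => h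
  · simp only [vc, hc.reg3, h31]
    refine ⟨by omega, by omega, by omega, by omega, by simp [setReg_reg], fun x hx => ?_,
      ⟨⟨1, h1V⟩, by simp [setReg_reg], Or.inr ⟨fun m hm => ?_, rfl⟩⟩, fun u hu hu2 => by omega⟩
    · have hx1 := Finset.mem_Icc.1 x.2
      simp only [setReg_mem, setMem_mem]
      -- Cell `n + 1` was set to `1`, in accordance with the fixed point `1` of `extendFun`.
      by_cases h : (x : ℕ) = 1
      · have h3 : (x : ℕ) ∉ Finset.Ico 2 n := by simp; omega
        rw [extendFun, dif_neg h3, h, Function.update_self]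
      · rw [Function.update_of_ne (by omega)]
        exact hM x (by simp; omega) _ ⟨x, rfl, funGraph_adj_extendFun f (by omega) hx⟩
    · have := hm.bounds
      omega
  · rintro σ₁ ⟨hI₁, hs₁⟩
    have hc₁ := hc.of_sameOff hs₁
    refine Tri.seq (Tri.mono (Tri.while_count (fun j => ThetaInv f (j + 2)) (n - 2)
      (fun _ => 20 * (n * W)) W hI₁ ?_ ?_) le_rfl ?_)
    · rintro j hj τ hs h
      have hc := hc₁.of_sameOff hs
      rw [h.reg33, hc.reg0]
      refine ⟨by omega, guard_le (by omega) (by omega), ?_⟩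
      exact thetaBody_spec hn (m := ⟨j + 2, by simp; omega⟩) (by simp) (by simp; omega) hc h
    · rintro τ hs h
      rw [h.reg33, (hc₁.of_sameOff hs).reg0]
      exact ⟨by omega, guard_le (by omega) (by omega)⟩
    · rintro τ ⟨h, hs⟩
      have hc := hc₁.of_sameOff hs
      rw [Nat.sub_add_cancel hn] at h
      obtain ⟨t, ht, htt⟩ := h.target
      have htn := Finset.mem_Icc.1 t.2
      refine Tri.of_vc (B := 4 * n) (P := .store 0 32) ?_
      simp only [vc, hc.reg0, ht, setMem_mem]
      refine ⟨by omega, by omega, ?_⟩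
      have key : ∀ u : Vtx n, 2 ≤ (u : ℕ) → ∃ v : Vtx n, (theta (funGraph f)).Adj u v ∧
          Function.update τ.mem n (t : ℕ) u = v := by
        intro u hu
        have hun := Finset.mem_Icc.1 u.2
        by_cases hn' : (u : ℕ) = n
        · refine ⟨t, IsTarget.adj_theta (by rwa [hn']) (Or.inl hn'), ?_⟩
          rw [hn', Function.update_self]
        · rw [Function.update_of_ne hn']
          exact h.done u hu (by omega)
      have hT := theta_mem_rootedTrees hn f
      intro u v
      constructor
      · intro huv
        have hu := (rootedTrees_adj_bounds hT huv)
        obtain ⟨w, hw, hw'⟩ := key u (by omega)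
        rw [rootedTrees_rightUnique hT huv hw]
        exact ⟨by omega, hw'⟩
      · rintro ⟨hu, huv⟩
        obtain ⟨w, hw, hw'⟩ := key u hu
        rwa [Subtype.ext (huv.symm.trans hw')]
  · simp only [Finset.sum_const, Finset.card_range, smul_eq_mul]
    have h4 : W ≤ n * n * W := Nat.le_mul_of_pos_left _ (by nlinarith)
    have h5 : (n - 2) * (20 * (n * W) + W) ≤ n * (20 * (n * W) + W) :=
      Nat.mul_le_mul_right _ (by omega)
    have h6 : n * (20 * (n * W) + W) = 20 * (n * n * W) + n * W := by ring
    have h7 : n * W ≤ n * n * W := by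
      rw [mul_assoc]
      exact Nat.le_mul_of_pos_left _ (by omega)
    omega

end CayleyRank

namespace CayleyRank

/-! ### The unranking program and the bit bounds -/

/-- The unranking program. -/
def unrankProg : Program := .seq labelProg thetaProg

theorem unrankProg_spec {n : ℕ} {s : Vtx n → ℕ} (h1 : ∀ i, 1 ≤ s i)
    (h2 : ∑ i, s i + 2 = 2 * n) {r : ℕ} (hr : r < chooseProd (shape s)) :
    Tri unrankProg (unrankInput s r) (180 * (n * n * (2 * bitLen (4 * n)))) fun τ =>
      IsArcTable (unrankTree s r) τ.mem := by
  have hn := two_le_of_degrees h1 h2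
  have hp := decode_mem h1 h2 (decFunProdUnrank_spec _ hr).1
  obtain ⟨f, hf⟩ := exists_funGraph_eq_partitionGraph hp
  refine Tri.mono (Tri.seq (d := 30 * (n * n * (2 * bitLen (4 * n))))
    (Tri.mono (labelProg_spec h1 h2 hr) le_rfl ?_)) (by omega) fun _ h => h
  rintro σ ⟨hc, h31, hlab⟩
  rw [unrankTree, ← hf]
  refine thetaProg_spec hn hc h31 fun x hx v ⟨u, hu, huv⟩ => hlab x hx v ?_
  rw [hf] at huv
  rw [← hu]
  exact huv

/-- As `log₂ n ≥ 1`, the left side is at most `8 * ⌊log₂ n⌋`; passing to the natural logarithm costs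
a factor of at most `2`, because `Real.log 2 > 1/2`. The factor `16` turns the constant `180` into
`2880`. -/
theorem two_mul_bitLen_le {n : ℕ} (hn : 2 ≤ n) :
    ((2 * bitLen (4 * n) : ℕ) : ℝ) ≤ 16 * Real.log n := by
  have h1 : bitLen (4 * n) = Nat.log 2 n + 3 := by
    rw [bitLen, show 4 * n = n * 2 * 2 by ring, Nat.log_mul_base (by norm_num) (by omega),
      Nat.log_mul_base (by norm_num) (by omega)]
  have h2 : 1 ≤ Nat.log 2 n := Nat.log_pos (by norm_num) hn
  have h3 : ((Nat.log 2 n : ℕ) : ℝ) * Real.log 2 ≤ Real.log n := by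
    rw [← Real.log_pow]
    refine Real.log_le_log (by positivity) ?_
    exact_mod_cast Nat.pow_log_le_self 2 (by omega)
  have h4 := Real.log_two_gt_d9
  have h5 : (0 : ℝ) ≤ (Nat.log 2 n : ℕ) := Nat.cast_nonneg _
  have h6 : ((2 * bitLen (4 * n) : ℕ) : ℝ) ≤ 8 * (Nat.log 2 n : ℕ) := by
    rw [h1]
    exact_mod_cast (by omega : 2 * (Nat.log 2 n + 3) ≤ 8 * Nat.log 2 n)
  nlinarith

theorem Tri.exists_runs_le {P : Program} {σ : MState} {n : ℕ} {R : MState → Prop} (hn : 2 ≤ n)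
    (h : Tri P σ (180 * (n * n * (2 * bitLen (4 * n)))) R) :
    ∃ (τ : MState) (c : ℕ), Runs P σ τ c ∧ R τ ∧ (c : ℝ) ≤ 2880 * (n : ℝ) ^ 2 * Real.log n := by
  obtain ⟨τ, c, hrun, hc, hR⟩ := h
  refine ⟨τ, c, hrun, hR, ?_⟩
  have h1 := two_mul_bitLen_le hn
  calc (c : ℝ) ≤ ((180 * (n * n * (2 * bitLen (4 * n))) : ℕ) : ℝ) := by exact_mod_cast hc
    _ = 180 * (n : ℝ) ^ 2 * ((2 * bitLen (4 * n) : ℕ) : ℝ) := by push_cast; ring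
    _ ≤ 180 * (n : ℝ) ^ 2 * (16 * Real.log n) := by gcongr
    _ = 2880 * (n : ℝ) ^ 2 * Real.log n := by ring

end CayleyRank

theorem mainTheorem1 :
    -- `Θ` is a bijection from the functions onto the trees, inverted by `Θ⁻¹`
    (∀ n : ℕ, 2 ≤ n →
      Set.BijOn (fun f : FunClass n => theta (funGraph f)) Set.univ (rootedTrees n) ∧
      ∀ f : FunClass n, thetaInv (theta (funGraph f)) = funGraph f) ∧
    -- the ranking and unranking bijections, and the steps through which they go
    (∀ (n : ℕ) (s : Vtx n → ℕ), (∀ i, 1 ≤ s i) → ∑ i, s i + 2 = 2 * n →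
      Set.BijOn treePartition (treesWithDegrees s) (setPartitions s) ∧
      Set.BijOn (encode s) (setPartitions s) (decFunProd (shape s)) ∧
      Set.BijOn (lexRank (decFunProd (shape s))) (decFunProd (shape s))
        (Set.Iio (treesWithDegrees s).ncard) ∧
      (∀ w ∈ decFunProd (shape s),
        lexRank (decFunProd (shape s)) w = decFunProdFormula (shape s) w) ∧
      Set.BijOn (rankTree s) (treesWithDegrees s) (Set.Iio (treesWithDegrees s).ncard) ∧
      Set.BijOn (unrankTree s) (Set.Iio (treesWithDegrees s).ncard) (treesWithDegrees s) ∧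
      Set.InvOn (unrankTree s) (rankTree s) (treesWithDegrees s)
        (Set.Iio (treesWithDegrees s).ncard)) ∧
    -- each direction is computed by one program with `O(n² log n)` bit operations
    (∃ (P Q : Program) (K : ℝ), ∀ (n : ℕ) (s : Vtx n → ℕ),
      (∀ i, 1 ≤ s i) → ∑ i, s i + 2 = 2 * n →
      (∀ T ∈ treesWithDegrees s, ∀ t : ℕ → ℕ, IsArcTable T t →
        ∃ (τ : MState) (c : ℕ), Runs P (rankInput s t) τ c ∧
          τ.reg 0 = rankTree s T ∧ (c : ℝ) ≤ K * (n : ℝ) ^ 2 * Real.log n) ∧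
      (∀ r < (treesWithDegrees s).ncard,
        ∃ (τ : MState) (c : ℕ), Runs Q (unrankInput s r) τ c ∧
          IsArcTable (unrankTree s r) τ.mem ∧ (c : ℝ) ≤ K * (n : ℝ) ^ 2 * Real.log n)) := by
  refine ⟨fun n hn => ⟨bijOn_theta hn, thetaInv_theta hn⟩, fun n s h1 h2 => ?_,
    rankProg, unrankProg, 2880, fun n s h1 h2 => ⟨fun T hT t ht => ?_, fun r hr => ?_⟩⟩
  · refine ⟨bijOn_treePartition (two_le_of_degrees h1 h2) s, bijOn_encode h1 h2, ?_,
      fun w hw => lexRank_eq_formula hw, bijOn_rankTree h1 h2, bijOn_unrankTree h1 h2,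
      invOn_unrankTree_rankTree h1 h2⟩
    rw [ncard_treesWithDegrees h1 h2]
    exact bijOn_lexRank (shape s)
  · exact (rankProg_spec h1 h2 hT ht).exists_runs_le (two_le_of_degrees h1 h2)
  · rw [ncard_treesWithDegrees h1 h2] at hr
    exact (unrankProg_spec h1 h2 hr).exists_runs_le (two_le_of_degrees h1 h2)
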